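/- Fix an odd prime $p$. **Schur $\sigma$-groups.** For a pro-$p$ group $G$ put $d(G)=\dim_{\mathbb F_p}H^1(G,\mathbb Z/p)$ and $r(G)=\dim_{\mathbb F_p}H^2(G,\mathbb Z/p)$ (continuous cohomology). A GI-automorphism of a profinite group is a continuous automorphism that inverts every element of some set of topological generators. A Schur $\sigma$-group is a topologically finitely generated pro-$p$ group $G$ with finite abelianization and $d(G)=r(G)$ that admits a GI-automorphism. Let $P_0(G)=G$, let $P_{n+1}(G)$ be the closed subgroup generated by $[G,P_n(G)]$ and $P_n(G)^p$, and let $Q_c(G)=G/P_c(G)$. Let $\mathcal G$ be the set of isomorphism classes of Schur $\sigma$-groups, and let $\Omega$ be the $\sigma$-algebra on $\mathcal G$ generated by the sets $\{G : Q_c(G)\cong P\}$ for all integers $c\ge 0$ and all finite $p$-groups $P$. A Schur $\sigma$-ancestor group is a group isomorphic to $Q_c(G)$ for some Schur $\sigma$-group $G$ and some $c\ge 0$. **Moments.** Choose a GI-automorphism $\sigma$ of each Schur $\sigma$-group and of each Schur $\sigma$-ancestor group; $\mathrm{Sur}_\sigma(G,H)$ is the set of continuous surjective homomorphisms $G\to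 H$ that commute with the chosen automorphisms (its size does not depend on the choices). The $H$-moment of a measure $\nu$ on $\Omega$ is $\int_{\mathcal G}|\mathrm{Sur}_\sigma(G,H)|\,d\nu(G)$. **The measure $\mu_{BBH}$.** Let $\mu_{CL}$ be the probability measure on the set of isomorphism classes of finite abelian $p$-groups with $\mu_{CL}(A)$ proportional to $1/|\mathrm{Aut}(A)|$, and let $\mu_{CL}(g)=\sum_{A\text{ of rank }g}\mu_{CL}(A)$. Let $F_g$ be the free pro-$p$ group on $x_1,\dots,x_g$, with the automorphism $\sigma(x_i)=x_i^{-1}$, let $\Phi(F_g)=P_1(F_g)$ be its Frattini subgroup, and let $X=\{s\in\Phi(F_g) : \sigma(s)=s^{-1}\}$, with the probability measure $\mu$ that is the limit of the uniform measures on the images of $X$ in the finite groups $Q_c(F_g)$, on the $\sigma$-algebra generated by the fibers of the maps $X\to Q_c(F_g)$; $X^g$ carries the product measure $\mu^{g}$. For $A\in\Omega$ put $$\mu_{BBH}(A)=\sum_{g\ge 0}\mu_{CL}(g)\,\mu^{g}\bigl(E_g(A)\bigr),$$ where $E_g(A)$ is the set of all $(r_1,\dots,r_g)\in X^g$ such that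 the quotient of $F_g$ by the closed normal subgroup generated by $r_1,\dots,r_g$ is a Schur $\sigma$-group with isomorphism class in $A$. **Theorem 4.8.** The sets $E_g(A)$ are measurable for all $g\ge 0$ and $A\in\Omega$. If $\nu$ is a measure on $\Omega$ whose $H$-moment is $1$ for every Schur $\sigma$-ancestor group $H$, then $\nu=\mu_{BBH}$, that is, $\nu(A)=\mu_{BBH}(A)$ for every $A\in\Omega$. -/

import Mathlib

noncomputable section

open MeasureTheory Filter
open scoped ENNReal

namespace BBH

/-! ### Pro-`p` groups, the lower `p`-central series and GI-automorphisms -/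

section ProP

variable (p : ℕ) (G : Type) [Group G] [TopologicalSpace G] [IsTopologicalGroup G]

/-- `G` is a pro-`p` group: a profinite group all of whose open normal subgroups have index a
power of `p`. -/
structure IsProP : Prop where
  compact : CompactSpace G
  t2 : T2Space G
  totallyDisconnected : TotallyDisconnectedSpace G
  index_eq : ∀ U : Subgroup G, U.Normal → IsOpen (U : Set G) → ∃ k : ℕ, U.index = p ^ k

/-- `S` is a set of topological generators of `G`. -/
def TopGenerates (S : Set G) : Prop :=
  (Subgroup.closure S).topologicalClosure = ⊤

/-- `G` is topologically finitely generated. -/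
def IsTopFG : Prop := ∃ S : Set G, S.Finite ∧ TopGenerates G S

/-- The lower `p`-central series: `P₀(G) = G` and `Pₙ₊₁(G)` is the closed subgroup generated by
`[G, Pₙ(G)]` and the `p`-th powers of the elements of `Pₙ(G)`. -/
def lowerPCentral : ℕ → Subgroup G
  | 0 => ⊤
  | n + 1 => (⁅(⊤ : Subgroup G), lowerPCentral n⁆ ⊔
      Subgroup.closure ((fun x : G => x ^ p) '' (lowerPCentral n : Set G))).topologicalClosure

instance lowerPCentral_normal (n : ℕ) : (lowerPCentral p G n).Normal := by
  induction n with
  | zero => exact inferInstanceAs (⊤ : Subgroup G).Normal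
  | succ n ih =>
    have h1 : (Subgroup.closure
        ((fun x : G => x ^ p) '' (lowerPCentral p G n : Set G))).Normal := by
      refine ⟨fun x hx g => ?_⟩
      induction hx using Subgroup.closure_induction with
      | mem x hx =>
        obtain ⟨y, hy, rfl⟩ := hx
        refine Subgroup.subset_closure ⟨g * y * g⁻¹, ih.conj_mem y hy g, ?_⟩
        simp [conj_pow]
      | one => simp
      | mul x y _ _ hx hy =>
        have := mul_mem hx hy
        rwa [show g * x * g⁻¹ * (g * y * g⁻¹) = g * (x * y) * g⁻¹ by group] at this
      | inv x _ hx =>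
        have := inv_mem hx
        rwa [show (g * x * g⁻¹)⁻¹ = g * x⁻¹ * g⁻¹ by group] at this
    exact Subgroup.is_normal_topologicalClosure _

lemma lowerPCentral_antitone : Antitone (lowerPCentral p G) := by
  refine antitone_nat_of_succ_le fun n => ?_
  have hcl : IsClosed (lowerPCentral p G n : Set G) := by
    cases n with
    | zero => exact isClosed_univ
    | succ n => exact Subgroup.isClosed_topologicalClosure _
  refine Subgroup.topologicalClosure_minimal _ (sup_le (Subgroup.commutator_le_right _ _) ?_) hcl
  rw [Subgroup.closure_le]
  rintro _ ⟨x, hx, rfl⟩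
  exact pow_mem hx p

/-- `Q_c(G) = G / P_c(G)`, the maximal quotient of `G` of `p`-class at most `c`. -/
abbrev QuotClass (c : ℕ) : Type := G ⧸ lowerPCentral p G c

/-- `H¹(G, ℤ/p)` for the trivial action: the continuous homomorphisms `G → ℤ/p`. -/
def H1 : Submodule (ZMod p) (G → ZMod p) where
  carrier := {f | Continuous f ∧ ∀ g h, f (g * h) = f g + f h}
  zero_mem' := ⟨continuous_const, by simp⟩
  add_mem' := by
    rintro a b ⟨ha, ha'⟩ ⟨hb, hb'⟩
    refine ⟨ha.add hb, fun g h => ?_⟩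
    simp only [Pi.add_apply, ha', hb']
    ring
  smul_mem' := by
    rintro r a ⟨ha, ha'⟩
    refine ⟨ha.const_smul r, fun g h => ?_⟩
    simp only [Pi.smul_apply, ha', smul_eq_mul]
    ring

/-- The continuous inhomogeneous `2`-cocycles of `G` with values in the trivial module `ℤ/p`. -/
def Z2 : Submodule (ZMod p) (G × G → ZMod p) where
  carrier := {f | Continuous f ∧
    ∀ g h k, f (h, k) - f (g * h, k) + f (g, h * k) - f (g, h) = 0}
  zero_mem' := ⟨continuous_const, by simp⟩
  add_mem' := by
    rintro a b ⟨ha, ha'⟩ ⟨hb, hb'⟩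
    refine ⟨ha.add hb, fun g h k => ?_⟩
    have h1 := ha' g h k
    have h2 := hb' g h k
    simp only [Pi.add_apply]
    linear_combination h1 + h2
  smul_mem' := by
    rintro r a ⟨ha, ha'⟩
    refine ⟨ha.const_smul r, fun g h k => ?_⟩
    have h1 := ha' g h k
    simp only [Pi.smul_apply, smul_eq_mul]
    linear_combination r * h1

/-- The coboundaries of the continuous `1`-cochains of `G` with values in `ℤ/p`. -/
def B2 : Submodule (ZMod p) (G × G → ZMod p) where
  carrier := {f | ∃ b : G → ZMod p, Continuous b ∧ ∀ g h, f (g, h) = b h - b (g * h) + b g}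
  zero_mem' := ⟨0, continuous_const, by simp⟩
  add_mem' := by
    rintro _ _ ⟨a, ha, ha'⟩ ⟨b, hb, hb'⟩
    refine ⟨a + b, ha.add hb, fun g h => ?_⟩
    simp only [Pi.add_apply, ha', hb']
    ring
  smul_mem' := by
    rintro r _ ⟨a, ha, ha'⟩
    refine ⟨r • a, ha.const_smul r, fun g h => ?_⟩
    simp only [Pi.smul_apply, ha', smul_eq_mul]
    ring

/-- Continuous cohomology `H²(G, ℤ/p)` for the trivial action. -/
abbrev H2 : Type := Z2 p G ⧸ (B2 p G).submoduleOf (Z2 p G)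

variable {G} in
/-- `σ` is a GI-automorphism (generator-inverting automorphism) of `G`: it inverts every element
of some set of topological generators. -/
def IsGI (σ : G ≃ₜ* G) : Prop :=
  ∃ S : Set G, TopGenerates G S ∧ ∀ s ∈ S, σ s = s⁻¹

/-- A chosen GI-automorphism of `G` (if `G` has one). -/
def chosenGI : G ≃ₜ* G :=
  haveI : Nonempty (G ≃ₜ* G) := ⟨ContinuousMulEquiv.refl G⟩
  Classical.epsilon fun σ : G ≃ₜ* G => IsGI σ

/-- `G` is a Schur `σ`-group: a finitely generated pro-`p` group with finite abelianization,
with generator rank `dim H¹(G, ℤ/p)` equal to its relation rank `dim H²(G, ℤ/p)`, that admits a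
GI-automorphism. -/
structure IsSchurSigma : Prop where
  proP : IsProP p G
  fg : IsTopFG G
  finite_ab : Finite (TopologicalAbelianization G)
  rank_eq : Module.rank (ZMod p) (H1 p G) = Module.rank (ZMod p) (H2 p G)
  exists_GI : ∃ σ : G ≃ₜ* G, IsGI σ

end ProP

/-! ### The set of isomorphism classes of Schur `σ`-groups and its `σ`-algebra -/

/-- A Schur `σ`-group, bundled. -/
structure SchurSigmaGrp (p : ℕ) : Type 1 where
  carrier : Type
  [group : Group carrier]
  [topology : TopologicalSpace carrier]
  [topGroup : IsTopologicalGroup carrier]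
  isSchur : IsSchurSigma p carrier

attribute [instance] SchurSigmaGrp.group SchurSigmaGrp.topology SchurSigmaGrp.topGroup

/-- Isomorphism of Schur `σ`-groups, as topological groups. -/
instance schurSetoid (p : ℕ) : Setoid (SchurSigmaGrp p) where
  r G H := Nonempty (G.carrier ≃ₜ* H.carrier)
  iseqv :=
    { refl := fun _ => ⟨ContinuousMulEquiv.refl _⟩
      symm := fun ⟨e⟩ => ⟨e.symm⟩
      trans := fun ⟨e⟩ ⟨f⟩ => ⟨e.trans f⟩ }

/-- The set of isomorphism classes of Schur `σ`-groups. -/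
def SchurClass (p : ℕ) : Type 1 := Quotient (schurSetoid p)

/-- The isomorphism class of a Schur `σ`-group. -/
def SchurClass.mk {p : ℕ} (G : SchurSigmaGrp p) : SchurClass p := Quotient.mk _ G

/-- A representative of an isomorphism class of Schur `σ`-groups. -/
def SchurClass.rep {p : ℕ} (C : SchurClass p) : SchurSigmaGrp p := Quotient.out C

/-- The set `{G | Q_c(G) ≅ P}` of isomorphism classes of Schur `σ`-groups. -/
def quotClassSet (p c : ℕ) (P : Type) [Group P] : Set (SchurClass p) :=
  {C | ∃ G : SchurSigmaGrp p, SchurClass.mk G = C ∧ Nonempty (QuotClass p G.carrier c ≃* P)}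

/-- The `σ`-algebra `Ω`, generated by the sets `{G | Q_c(G) ≅ P}` for all `c` and all finite
`p`-groups `P`. -/
instance (p : ℕ) : MeasurableSpace (SchurClass p) :=
  MeasurableSpace.generateFrom
    {A | ∃ (c : ℕ) (P : Type) (_ : Group P), Finite P ∧ IsPGroup p P ∧ A = quotClassSet p c P}

/-- `H` is a Schur `σ`-ancestor group: `H ≅ Q_c(G)` for a Schur `σ`-group `G` and some `c`. -/
def IsSchurAncestor (p : ℕ) (H : Type) [Group H] : Prop :=
  ∃ (G : SchurSigmaGrp p) (c : ℕ), Nonempty (QuotClass p G.carrier c ≃* H)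

/-! ### Moments -/

/-- The set `Sur_σ(G, H)` of continuous surjective homomorphisms from `G` to `H` that are
equivariant for the chosen GI-automorphisms of `G` and `H`. -/
def SurSigma (G H : Type) [Group G] [TopologicalSpace G] [IsTopologicalGroup G]
    [Group H] [TopologicalSpace H] [IsTopologicalGroup H] : Set (G →ₜ* H) :=
  {φ | Function.Surjective φ ∧ ∀ x, φ (chosenGI G x) = chosenGI H (φ x)}

/-- The `H`-moment `∫ |Sur_σ(G, H)| dν` of a measure on the set of isomorphism classes of
Schur `σ`-groups. -/
def moment {p : ℕ} (ν : Measure (SchurClass p)) (H : Type)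
    [Group H] [TopologicalSpace H] [IsTopologicalGroup H] : ℝ≥0∞ :=
  ∫⁻ C, ((SurSigma C.rep.carrier H).encard : ℝ≥0∞) ∂ν

/-! ### The Cohen-Lenstra measure -/

/-- A finite abelian `p`-group, bundled. -/
structure FinAbPGrp (p : ℕ) : Type 1 where
  carrier : Type
  [group : CommGroup carrier]
  [finite : Finite carrier]
  isPGroup : IsPGroup p carrier

attribute [instance] FinAbPGrp.group FinAbPGrp.finite

/-- Isomorphism of finite abelian `p`-groups. -/
instance finAbSetoid (p : ℕ) : Setoid (FinAbPGrp p) where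
  r G H := Nonempty (G.carrier ≃* H.carrier)
  iseqv :=
    { refl := fun _ => ⟨MulEquiv.refl _⟩
      symm := fun ⟨e⟩ => ⟨e.symm⟩
      trans := fun ⟨e⟩ ⟨f⟩ => ⟨e.trans f⟩ }

/-- The Cohen-Lenstra weight `1 / |Aut A|` of an isomorphism class of finite abelian
`p`-groups. -/
def clWeight {p : ℕ} (A : Quotient (finAbSetoid p)) : ℝ≥0∞ :=
  ((Nat.card (MulAut A.out.carrier) : ℕ) : ℝ≥0∞)⁻¹

/-- `μ_CL(g)`, the probability under the Cohen-Lenstra measure that a finite abelian `p`-group has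
rank `g`.  The Cohen-Lenstra measure is the probability measure on the set of isomorphism classes
of finite abelian `p`-groups that gives `A` a mass proportional to `1 / |Aut A|`. -/
def muCL (p g : ℕ) : ℝ≥0∞ :=
  (∑' A : {A : Quotient (finAbSetoid p) // Group.rank A.out.carrier = g}, clWeight A.1) /
    ∑' A : Quotient (finAbSetoid p), clWeight A

/-! ### The free pro-`p` group on `g` generators -/

section Free

variable (p g : ℕ)

/-- The (abstract) free group on `g` generators carries the discrete topology. -/
instance : TopologicalSpace (FreeGroup (Fin g)) := ⊥

instance : DiscreteTopology (FreeGroup (Fin g)) := ⟨rfl⟩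

/-- The normal subgroups of `p`-power index of the free group on `g` generators. -/
abbrev PPowerNormal : Type :=
  {N : Subgroup (FreeGroup (Fin g)) // N.Normal ∧ ∃ k : ℕ, N.index = p ^ k}

instance (N : PPowerNormal p g) : N.1.Normal := N.2.1

/-- The free pro-`p` group `F_g` on `g` generators: the inverse limit of the (discrete) quotients
of the free group on `g` generators by its normal subgroups of `p`-power index. -/
def FreeProP : Subgroup (∀ N : PPowerNormal p g, FreeGroup (Fin g) ⧸ N.1) where
  carrier := {x | ∀ (N M : PPowerNormal p g) (h : N.1 ≤ M.1),
    QuotientGroup.map N.1 M.1 (MonoidHom.id _) h (x N) = x M}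
  one_mem' := by
    intro N M h
    simp
  mul_mem' := by
    intro a b ha hb N M h
    simp only [Pi.mul_apply, map_mul, ha N M h, hb N M h]
  inv_mem' := by
    intro a ha N M h
    simp only [Pi.inv_apply, map_inv, ha N M h]

/-- The endomorphism of the free group that inverts each free generator. -/
def freeInv : FreeGroup (Fin g) →* FreeGroup (Fin g) :=
  FreeGroup.lift fun i => (FreeGroup.of i)⁻¹

lemma freeInv_surjective : Function.Surjective (freeInv g) := by
  have h : (freeInv g).comp (freeInv g) = MonoidHom.id _ := by
    ext i
    simp [freeInv]
  exact fun x => ⟨freeInv g x, DFunLike.congr_fun h x⟩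

variable {p g} in
/-- The preimage of a normal subgroup of `p`-power index under `freeInv`. -/
def PPowerNormal.comapInv (N : PPowerNormal p g) : PPowerNormal p g :=
  ⟨N.1.comap (freeInv g), N.2.1.comap _, by
    obtain ⟨k, hk⟩ := N.2.2
    exact ⟨k, by rw [Subgroup.index_comap_of_surjective _ (freeInv_surjective g), hk]⟩⟩

/-- The automorphism `σ` of `F_g` induced by `xᵢ ↦ xᵢ⁻¹` (as a homomorphism). -/
def freeSigma : FreeProP p g →* FreeProP p g where
  toFun x := ⟨fun N => QuotientGroup.map N.comapInv.1 N.1 (freeInv g) le_rfl (x.1 N.comapInv), by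
    intro N M h
    have h' : N.comapInv.1 ≤ M.comapInv.1 := Subgroup.comap_mono h
    change QuotientGroup.map N.1 M.1 (MonoidHom.id _) h
        (QuotientGroup.map N.comapInv.1 N.1 (freeInv g) le_rfl (x.1 N.comapInv)) =
      QuotientGroup.map M.comapInv.1 M.1 (freeInv g) le_rfl (x.1 M.comapInv)
    rw [← x.2 N.comapInv M.comapInv h']
    induction x.1 N.comapInv using QuotientGroup.induction_on with
    | H z => rfl⟩
  map_one' := by
    ext N
    simp
  map_mul' a b := by
    ext N
    simp

/-! ### Random relations -/

/-- `X = {s ∈ Φ(F_g) | σ(s) = s⁻¹}`, where `Φ(F_g) = P₁(F_g)` is the Frattini subgroup. -/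
def Relator : Type :=
  {s : FreeProP p g // s ∈ lowerPCentral p (FreeProP p g) 1 ∧ freeSigma p g s = s⁻¹}

variable {p g} in
/-- The map from `X` to the finite group `Q_c(F_g)`. -/
def Relator.level (c : ℕ) (s : Relator p g) : QuotClass p (FreeProP p g) c :=
  QuotientGroup.mk s.1

/-- The `σ`-algebra on `X` generated by the fibres of the maps to the groups `Q_c(F_g)`. -/
instance instMeasurableSpaceRelator : MeasurableSpace (Relator p g) :=
  MeasurableSpace.generateFrom
    {A | ∃ (c : ℕ) (y : QuotClass p (FreeProP p g) c), A = Relator.level c ⁻¹' {y}}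

/-- The proportion of the image `X_c` of `X` in the finite group `Q_c(F_g)` that is covered by the
image of `A`, that is, the mass of the image of `A` for the uniform measure on `X_c`. -/
def density (c : ℕ) (A : Set (Relator p g)) : ℝ≥0∞ :=
  ((Relator.level c '' A).encard : ℝ≥0∞) /
    ((Relator.level c '' (Set.univ : Set (Relator p g))).encard : ℝ≥0∞)

/-- The limit of the uniform masses of the images of `A` in the finite sets `X_c`. -/
def limitDensity (A : Set (Relator p g)) : ℝ≥0∞ :=
  liminf (fun c => density p g c A) atTop

lemma limitDensity_empty : limitDensity p g ∅ = 0 := by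
  simp [limitDensity, density]

variable {p g} in
lemma density_inter_add_diff (c k : ℕ) (hk : c ≤ k) (y : QuotClass p (FreeProP p g) c)
    (t : Set (Relator p g)) :
    density p g k (t ∩ Relator.level c ⁻¹' {y}) + density p g k (t \ Relator.level c ⁻¹' {y}) =
      density p g k t := by
  have hdisj : Disjoint (Relator.level k '' (t ∩ Relator.level c ⁻¹' {y}))
      (Relator.level k '' (t \ Relator.level c ⁻¹' {y})) := by
    rw [Set.disjoint_left]
    rintro _ ⟨a, ⟨_, ha⟩, rfl⟩ ⟨b, ⟨_, hb⟩, hab⟩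
    refine hb ?_
    have h1 := QuotientGroup.eq.1 hab
    have h2 : Relator.level c b = Relator.level c a :=
      QuotientGroup.eq.2 (lowerPCentral_antitone p (FreeProP p g) hk h1)
    exact h2.trans ha
  unfold density
  rw [← ENNReal.add_div, ← ENat.toENNReal_add, ← Set.encard_union_eq hdisj, ← Set.image_union,
    Set.inter_union_sdiff]

lemma relator_le_caratheodory :
    instMeasurableSpaceRelator p g ≤
      (OuterMeasure.ofFunction (limitDensity p g) (limitDensity_empty p g)).caratheodory := by
  refine MeasurableSpace.generateFrom_le ?_
  rintro _ ⟨c, y, rfl⟩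
  refine OuterMeasure.ofFunction_caratheodory fun t => ?_
  simp only [limitDensity, liminf_eq_iSup_iInf_of_nat]
  rw [ENNReal.iSup_add_iSup_of_monotone]
  · refine iSup_le fun n => le_iSup_of_le (max n c) (le_iInf₂ fun k hk => ?_)
    rw [← density_inter_add_diff c k ((le_max_right _ _).trans hk) y t]
    exact add_le_add (iInf₂_le k ((le_max_left _ _).trans hk))
      (iInf₂_le k ((le_max_left _ _).trans hk))
  all_goals
    exact fun m n hmn => le_iInf₂ fun k hk => iInf₂_le k (hmn.trans hk)

/-- The profinite probability measure on `X`, the limit of the uniform measures on the finite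
sets `X_c`: the Carathéodory extension of the limit density of the fibres of `X → X_c`. -/
def muX : Measure (Relator p g) :=
  (OuterMeasure.ofFunction (limitDensity p g) (limitDensity_empty p g)).toMeasure
    (relator_le_caratheodory p g)

variable {p g} in
/-- The closed normal subgroup `⟨⟨r₁, …, r_g⟩⟩` of `F_g`. -/
def relSubgroup (r : Fin g → Relator p g) : Subgroup (FreeProP p g) :=
  (Subgroup.normalClosure (Set.range fun i => (r i).1)).topologicalClosure

instance (r : Fin g → Relator p g) : (relSubgroup r).Normal :=
  Subgroup.is_normal_topologicalClosure _

/-- The set of those `(r₁, …, r_g) ∈ X^g` for which `F_g / ⟨⟨r₁, …, r_g⟩⟩` is a Schur `σ`-group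
whose isomorphism class is in `A`. -/
def relEvent (A : Set (SchurClass p)) : Set (Fin g → Relator p g) :=
  {r | ∃ h : IsSchurSigma p (FreeProP p g ⧸ relSubgroup r),
    SchurClass.mk ⟨FreeProP p g ⧸ relSubgroup r, h⟩ ∈ A}

end Free

/-- The Boston-Bush-Hajir mass of a set `A` of isomorphism classes of Schur `σ`-groups: choose the
rank `g` according to the Cohen-Lenstra measure, and then `g` independent random relations
in `X ⊆ F_g`. -/
def muBBH (p : ℕ) (A : Set (SchurClass p)) : ℝ≥0∞ :=
  ∑' g : ℕ, muCL p g * Measure.pi (fun _ : Fin g => muX p g) (relEvent p g A)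

end BBH

end

/-!
Let `R = ⟨⟨r₁, …, r_g⟩⟩` with `rᵢ ∈ X`.  Since `H²(F_g, ℤ/p) = 0`, the dimension of
`H²(F_g / R, ℤ/p)` is that of `Hom(R, ℤ/p)^{F_g}` (`rank_H2`).  It is at most `g`, because `R` has
`g` normal generators, and at least `g` if the abelianization of `F_g / R` is finite.  So `F_g / R`
is a Schur `σ`-group if and only if its abelianization is finite (`isSchurSigma_iff`).  This
property, like the isomorphism type of `Q_c(F_g / R)`, is decided by the images of the relations in
finite quotients of `F_g`.  Hence the events are measurable (`measurableSet_relEvent`).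

The images of the random relations under an equivariant surjection of `F_g` onto a finite `p`-group
are independent and uniformly distributed in the inverted elements of its Frattini subgroup
(`relLaw_image`).  For the quotients `(ℤ/pⁿ)^g` this shows that the abelianization of the random
group is almost surely finite (`relLaw_relEvent_univ`), and that it is a given group `A` of rank `g`
with a probability proportional to `1 / |Aut A|`; as these probabilities add up to `1`, the constant
of proportionality determines `μ_CL(g)` (`tsum_clWeight_rank`, `muCL_eq`).  For a Schur `σ`-ancestor
group `H` of rank `d` it shows that the expected number of equivariant surjections `F_g → H` that
kill `g` random relations is `∏_{i < d} (p^g - pⁱ)`, whatever the inverted elements of the Frattini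
subgroup of `H` are (`tsum_relLaw_surCount`).  So the `H`-moment of `μ_BBH` is
`∑_g μ_CL(g) ∏_{i < d} (p^g - pⁱ)`, and it is `1` because the sum of the series
`∑ₘ q^{m(m+d)} / ((q)ₘ (q)ₘ₊d)`, `q = 1/p`, does not depend on `d` (`tsum_qTerm_eq`,
`tsum_muBBH_surCount`).

It remains to see that the moments determine the measure.  For fixed `c ≥ 1`, the masses of the
sets `{G | Q_c(G) ≅ H}` under a measure with moments `1` satisfy the linear equations
`∑_K ν(K) |Sur_σ(K, H)| = 1` (`moment_level`), where `K` and `H` run over the groups `Q_c(G)`.  For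
`μ_BBH` the diagonal term `μ_BBH(H) |Aut_σ(H)|` is more than half of the sum.  Indeed, let
`H = Q_c(G)` be of rank `d`, and let `φ : F_d → H` be an equivariant surjection, which lifts to
`G`.  The random relations present a group with `Q_c` equal to `F_d / ker φ` if they lie in `ker φ`
and generate `ker φ` modulo `P_c(F_d)`, `[F_d, ker φ]` and `(ker φ)ᵖ`.  Since this quotient of
`ker φ` is a quotient of the relation module of `G`, it has rank at most `d` and is inverted by
`σ`, which bounds the probability of this event from below (`exists_event_ker`).  Summation over
`φ` and multiplication by `μ_CL(d)` show that the diagonal term is at least the inverse of the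
total Cohen-Lenstra weight `∑_A 1 / |Aut A|` (`inv_clTotal_le`), which is less than `2` because `p`
is odd (`clTotal_lt_two`).  With such a dominant diagonal the equations have only one solution
(`eq_of_moments`).  So `ν` and `μ_BBH` agree on the sets `{G | Q_c(G) ≅ H}`, which form a
`π`-system that generates `Ω`.
-/

noncomputable section

open MeasureTheory Filter
open scoped ENNReal commutatorElement

set_option linter.unusedSectionVars false

namespace BBH

/-! ### The lower `p`-central series: functoriality, and the quotients of finite `p`-groups -/

section LowerCentral

variable {p : ℕ} {G G' : Type} [Group G] [TopologicalSpace G] [IsTopologicalGroup G]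
  [Group G'] [TopologicalSpace G'] [IsTopologicalGroup G']

lemma isClosed_lowerPCentral (n : ℕ) : IsClosed (lowerPCentral p G n : Set G) := by
  cases n with
  | zero => exact isClosed_univ
  | succ n => exact Subgroup.isClosed_topologicalClosure _

lemma commutator_mem_lowerPCentral_succ {n : ℕ} (g : G) {x : G} (hx : x ∈ lowerPCentral p G n) :
    ⁅g, x⁆ ∈ lowerPCentral p G (n + 1) :=
  Subgroup.le_topologicalClosure _ <|
    (le_sup_left : _ ≤ ⁅(⊤ : Subgroup G), lowerPCentral p G n⁆ ⊔ _)
      (Subgroup.commutator_mem_commutator (Subgroup.mem_top g) hx)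

lemma pow_mem_lowerPCentral_succ {n : ℕ} {x : G} (hx : x ∈ lowerPCentral p G n) :
    x ^ p ∈ lowerPCentral p G (n + 1) :=
  Subgroup.le_topologicalClosure _ <|
    (le_sup_right : _ ≤ ⁅(⊤ : Subgroup G), lowerPCentral p G n⁆ ⊔ _)
      (Subgroup.subset_closure ⟨x, hx, rfl⟩)

lemma lowerPCentral_succ_le {n : ℕ} {K : Subgroup G} (hK : IsClosed (K : Set G))
    (h1 : ∀ g : G, ∀ x ∈ lowerPCentral p G n, ⁅g, x⁆ ∈ K)
    (h2 : ∀ x ∈ lowerPCentral p G n, x ^ p ∈ K) : lowerPCentral p G (n + 1) ≤ K := by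
  refine Subgroup.topologicalClosure_minimal _ (sup_le ?_ ?_) hK
  · exact Subgroup.commutator_le.2 fun g _ x hx => h1 g x hx
  · rw [Subgroup.closure_le]
    rintro _ ⟨x, hx, rfl⟩
    exact h2 x hx

lemma map_mem_lowerPCentral (φ : G →* G') (hφ : Continuous φ) :
    ∀ (n : ℕ) {x : G}, x ∈ lowerPCentral p G n → φ x ∈ lowerPCentral p G' n
  | 0, _, _ => Subgroup.mem_top _
  | n + 1, x, hx => by
    have h : lowerPCentral p G (n + 1) ≤ (lowerPCentral p G' (n + 1)).comap φ :=
      lowerPCentral_succ_le ((isClosed_lowerPCentral (n + 1)).preimage hφ :)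
        (fun g x hx => by
          rw [Subgroup.mem_comap, map_commutatorElement]
          exact commutator_mem_lowerPCentral_succ _ (map_mem_lowerPCentral φ hφ n hx))
        (fun x hx => by
          rw [Subgroup.mem_comap, map_pow]
          exact pow_mem_lowerPCentral_succ (map_mem_lowerPCentral φ hφ n hx))
    exact h hx

lemma map_lowerPCentral [CompactSpace G] [T2Space G'] (φ : G →* G') (hφ : Continuous φ)
    (hs : Function.Surjective φ) (n : ℕ) :
    (lowerPCentral p G n).map φ = lowerPCentral p G' n := by
  refine le_antisymm (Subgroup.map_le_iff_le_comap.2 fun x hx =>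
    map_mem_lowerPCentral φ hφ n hx) ?_
  induction n with
  | zero =>
    intro y _
    obtain ⟨x, rfl⟩ := hs y
    exact ⟨x, Subgroup.mem_top _, rfl⟩
  | succ n ih =>
    refine lowerPCentral_succ_le ?_ ?_ ?_
    · rw [Subgroup.coe_map]
      exact ((isClosed_lowerPCentral _).isCompact.image hφ).isClosed
    · intro g x hx
      obtain ⟨x, hx', rfl⟩ := ih hx
      obtain ⟨g, rfl⟩ := hs g
      exact ⟨⁅g, x⁆, commutator_mem_lowerPCentral_succ g hx', map_commutatorElement _ _ _⟩
    · intro x hx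
      obtain ⟨x, hx', rfl⟩ := ih hx
      exact ⟨x ^ p, pow_mem_lowerPCentral_succ hx', map_pow _ _ _⟩

lemma lowerPCentral_quotClass [CompactSpace G] (c : ℕ) :
    lowerPCentral p (QuotClass p G c) c = ⊥ := by
  have : IsClosed (lowerPCentral p G c : Set G) := isClosed_lowerPCentral c
  have : T2Space (QuotClass p G c) := inferInstance
  rw [← map_lowerPCentral (QuotientGroup.mk' (lowerPCentral p G c)) continuous_quotient_mk'
    (QuotientGroup.mk'_surjective _) c, eq_bot_iff, Subgroup.map_le_iff_le_comap]
  intro x hx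
  simpa using hx

/-- The quotient by `P₁` is abelian. -/
lemma mul_comm_quotClass_one (a b : QuotClass p G 1) : a * b = b * a := by
  obtain ⟨a, rfl⟩ := QuotientGroup.mk_surjective a
  obtain ⟨b, rfl⟩ := QuotientGroup.mk_surjective b
  rw [← QuotientGroup.mk_mul, ← QuotientGroup.mk_mul, QuotientGroup.eq]
  have := commutator_mem_lowerPCentral_succ (p := p) (n := 0) b⁻¹ (x := a⁻¹) (Subgroup.mem_top _)
  simpa [commutatorElement_def, mul_assoc] using this

lemma pow_quotClass_one (a : QuotClass p G 1) : a ^ p = 1 := by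
  obtain ⟨a, rfl⟩ := QuotientGroup.mk_surjective a
  rw [← QuotientGroup.mk_pow, QuotientGroup.eq_one_iff]
  exact pow_mem_lowerPCentral_succ (n := 0) (Subgroup.mem_top _)

instance : CommGroup (QuotClass p G 1) :=
  { (inferInstance : Group (QuotClass p G 1)) with mul_comm := mul_comm_quotClass_one }

/-- In a finite `p`-group every maximal subgroup contains `P₁`, so `P₁` consists of
non-generators. -/
lemma eq_top_of_sup_lowerPCentral_one [Fact p.Prime] [Finite G] [DiscreteTopology G]
    (hG : IsPGroup p G) {K : Subgroup G} (hK : K ⊔ lowerPCentral p G 1 = ⊤) : K = ⊤ := by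
  obtain h | ⟨M, hM, hKM⟩ := eq_top_or_exists_le_coatom K
  · exact h
  exfalso
  have := hG.isNilpotent
  have : M.Normal :=
    Subgroup.NormalizerCondition.normal_of_coatom M
      Group.normalizerCondition_of_isNilpotent hM
  have : Nontrivial (G ⧸ M) := by
    rw [← not_subsingleton_iff_nontrivial, QuotientGroup.subsingleton_iff]
    exact hM.1
  have hsub : ∀ L : Subgroup (G ⧸ M), L = ⊥ ∨ L = ⊤ := by
    intro L
    have h1 : M ≤ L.comap (QuotientGroup.mk' M) := by
      intro x hx
      have : (QuotientGroup.mk' M) x = 1 := (QuotientGroup.eq_one_iff x).2 hx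
      rw [Subgroup.mem_comap, this]
      exact one_mem _
    have hinj := Subgroup.comap_injective (QuotientGroup.mk'_surjective M)
    rcases hM.le_iff.1 h1 with h | h
    · right
      exact hinj (by rw [h, Subgroup.comap_top])
    · left
      exact hinj (by rw [h, MonoidHom.comap_bot, QuotientGroup.ker_mk'])
  have hQ : IsPGroup p (G ⧸ M) := hG.to_quotient M
  have hdvd : p ∣ Nat.card (G ⧸ M) := by
    obtain ⟨k, hk, hk'⟩ := hQ.nontrivial_iff_card.1 inferInstance
    rw [hk']
    exact dvd_pow_self _ hk.ne'
  obtain ⟨z, hz⟩ := exists_prime_orderOf_dvd_card' p hdvd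
  have hz1 : Subgroup.zpowers z = ⊤ := by
    refine (hsub _).resolve_left fun h => ?_
    rw [Subgroup.zpowers_eq_bot] at h
    rw [h, orderOf_one] at hz
    exact (Fact.out : p.Prime).one_lt.ne hz
  have hmem : ∀ x : G ⧸ M, x ∈ Subgroup.zpowers z := fun x => hz1 ▸ Subgroup.mem_top x
  have hle : lowerPCentral p G 1 ≤ M := by
    refine lowerPCentral_succ_le (isClosed_discrete _) ?_ ?_
    · intro g x _
      rw [← QuotientGroup.eq_one_iff]
      change (QuotientGroup.mk' M) ⁅g, x⁆ = 1
      rw [map_commutatorElement, commutatorElement_eq_one_iff_mul_comm]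
      obtain ⟨a, ha⟩ := hmem (QuotientGroup.mk' M g)
      obtain ⟨b, hb⟩ := hmem (QuotientGroup.mk' M x)
      simp only at ha hb
      rw [← ha, ← hb, ← zpow_add, ← zpow_add, add_comm]
    · intro x _
      rw [← QuotientGroup.eq_one_iff, QuotientGroup.mk_pow]
      obtain ⟨a, ha⟩ := hmem (x : G ⧸ M)
      simp only at ha
      rw [← ha, ← zpow_natCast, ← zpow_mul, mul_comm, zpow_mul, zpow_natCast, ← hz,
        pow_orderOf_eq_one, one_zpow]
  exact hM.1 (top_le_iff.1 (hK ▸ sup_le hKM hle))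

/-! ### Openness of the lower `p`-central series of a finitely generated pro-`p` group -/

lemma IsProP.quotient (hG : IsProP p G) (N : Subgroup G) [N.Normal] (hN : IsClosed (N : Set G)) :
    IsProP p (G ⧸ N) := by
  have := hG.compact
  have := hG.t2
  have := hG.totallyDisconnected
  have : T2Space (G ⧸ N) := by
    have := hN
    infer_instance
  refine ⟨inferInstance, inferInstance, ?_, ?_⟩
  · -- a point `≠ 1` of the quotient is separated from `1` by an open subgroup
    have hsep : ∀ x : G ⧸ N, x ≠ 1 → ∃ U : Subgroup (G ⧸ N), IsOpen (U : Set (G ⧸ N)) ∧ x ∉ U := by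
      intro x hx
      obtain ⟨x, rfl⟩ := QuotientGroup.mk_surjective x
      have hx' : x ∉ N := fun h => hx ((QuotientGroup.eq_one_iff x).2 h)
      have hop : IsOpen {u : G | x * u ∉ N} :=
        (hN.preimage (continuous_const_mul x)).isOpen_compl
      obtain ⟨V, hV⟩ := ProfiniteGrp.exist_openNormalSubgroup_sub_open_nhds_of_one hop
        (by simpa using hx')
      refine ⟨V.toSubgroup.map (QuotientGroup.mk' N), ?_, ?_⟩
      · exact QuotientGroup.isOpenMap_coe _ V.isOpen'
      · rintro ⟨v, hv, hvx⟩
        have h1 : v⁻¹ * x ∈ N := QuotientGroup.eq.1 hvx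
        have h2 := hV (inv_mem hv)
        refine h2 ?_
        have := (inferInstance : N.Normal).conj_mem _ h1 v
        have h3 : x * v⁻¹ ∈ N := by simpa [mul_assoc] using this
        exact h3
    have : TotallySeparatedSpace (G ⧸ N) := by
      rw [totallySeparatedSpace_iff_exists_isClopen]
      intro x y hxy
      obtain ⟨U, hU, hxU⟩ := hsep (x⁻¹ * y) (by rwa [ne_eq, inv_mul_eq_one])
      refine ⟨{z | x⁻¹ * z ∈ U}, ⟨?_, ?_⟩, by simp [one_mem], hxU⟩
      · exact (U.isClosed_of_isOpen hU).preimage (continuous_const_mul x⁻¹)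
      · exact hU.preimage (continuous_const_mul x⁻¹)
    infer_instance
  · intro U hU hUo
    obtain ⟨k, hk⟩ := hG.index_eq (U.comap (QuotientGroup.mk' N)) (hU.comap _)
      (hUo.preimage continuous_quotient_mk')
    exact ⟨k, by rw [← hk, Subgroup.index_comap_of_surjective _ (QuotientGroup.mk'_surjective N)]⟩

/-- By induction on `n`: a dense finitely generated subgroup meets the open subgroup `Pₙ` in a
finitely generated subgroup, whose image in `Pₙ / Pₙ₊₁` is abelian of exponent `p`, hence finite,
and dense. -/
lemma isOpen_lowerPCentral [Fact p.Prime] [CompactSpace G] [T2Space G] (hfg : IsTopFG G) (n : ℕ) :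
    IsOpen (lowerPCentral p G n : Set G) := by
  induction n with
  | zero => exact isOpen_univ
  | succ n ih =>
    obtain ⟨S, hS, hgen⟩ := hfg
    have hdense : Dense ((Subgroup.closure S : Subgroup G) : Set G) := by
      have h := congrArg (fun K : Subgroup G => (K : Set G)) hgen
      simp only [Subgroup.topologicalClosure_coe, Subgroup.coe_top] at h
      exact dense_iff_closure_eq.2 h
    set Γ := Subgroup.closure S
    set U := lowerPCentral p G n
    set N := lowerPCentral p G (n + 1)
    have hNc : IsClosed (N : Set G) := isClosed_lowerPCentral _
    have : U.FiniteIndex := by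
      have : Finite (G ⧸ U) := Subgroup.quotient_finite_of_isOpen U ih
      exact Subgroup.finiteIndex_of_finite_quotient
    have : Group.FG Γ := by
      have := hS.to_subtype
      exact Group.closure_finite_fg S
    have hfg : Group.FG (U.subgroupOf Γ) := Subgroup.fg_of_index_ne_zero _
    -- the image of `Γ ∩ U` in `G / N`
    let f : (U.subgroupOf Γ) →* G ⧸ N :=
      (QuotientGroup.mk' N).comp (Γ.subtype.comp (U.subgroupOf Γ).subtype)
    have hfU : ∀ x : U.subgroupOf Γ, (x.1.1 : G) ∈ U := fun x => x.2
    have hcomm : ∀ a b : f.range, a * b = b * a := by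
      rintro ⟨_, a, rfl⟩ ⟨_, b, rfl⟩
      apply Subtype.ext
      change f a * f b = f b * f a
      rw [← commutatorElement_eq_one_iff_mul_comm]
      change (QuotientGroup.mk' N a.1.1 : G ⧸ N) * _ * _ * _ = 1
      exact (QuotientGroup.eq_one_iff (⁅(a.1.1 : G), (b.1.1 : G)⁆)).2
        (commutator_mem_lowerPCentral_succ _ (hfU b))
    let _ : CommGroup f.range := { (inferInstance : Group f.range) with mul_comm := hcomm }
    have : Group.FG f.range := Group.fg_range f
    have hfin : Finite f.range := by
      refine CommGroup.finite_of_fg_isMulTorsion _ ?_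
      rintro ⟨_, a, rfl⟩
      rw [isOfFinOrder_iff_pow_eq_one]
      refine ⟨p, (Fact.out : p.Prime).pos, Subtype.ext ?_⟩
      exact (QuotientGroup.eq_one_iff ((a.1.1 : G) ^ p)).2 (pow_mem_lowerPCentral_succ (hfU a))
    -- by density it is all of `U / N`
    have hUN : ∀ u ∈ U, (QuotientGroup.mk' N u) ∈ f.range := by
      intro u hu
      have hcl : IsClosed ((QuotientGroup.mk' N) ⁻¹' (f.range : Set (G ⧸ N))) :=
        (Set.Finite.isClosed (Set.toFinite (f.range : Set (G ⧸ N)))).preimage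
          continuous_quotient_mk'
      have h1 : u ∈ closure ((U : Set G) ∩ Γ) :=
        hdense.open_subset_closure_inter ih hu
      refine closure_minimal ?_ hcl h1
      rintro x ⟨hxU, hxΓ⟩
      exact ⟨⟨⟨x, hxΓ⟩, hxU⟩, rfl⟩
    have hrel : N.relIndex U ≠ 0 := by
      have : Finite (U ⧸ N.subgroupOf U) := by
        refine Finite.of_injective (β := f.range)
          (fun x => Quotient.liftOn' x (fun u => ⟨QuotientGroup.mk' N u.1, hUN u.1 u.2⟩) ?_) ?_
        · intro a b hab
          apply Subtype.ext
          exact QuotientGroup.eq.2 (QuotientGroup.leftRel_apply.1 hab :)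
        · intro a b
          induction a using Quotient.inductionOn' with | h a => ?_
          induction b using Quotient.inductionOn' with | h b => ?_
          intro h
          have h' : ((a.1 : G) : G ⧸ N) = (b.1 : G) := congrArg Subtype.val h
          exact Quotient.sound' (QuotientGroup.leftRel_apply.2 (QuotientGroup.eq.1 h' :))
      exact Subgroup.index_ne_zero_of_finite
    have hidx : N.index ≠ 0 := by
      rw [← Subgroup.relIndex_mul_index (lowerPCentral_antitone p G (Nat.le_succ n))]
      exact mul_ne_zero hrel Subgroup.FiniteIndex.index_ne_zero
    have : N.FiniteIndex := ⟨hidx⟩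
    exact N.isOpen_of_isClosed_of_finiteIndex hNc

lemma discreteTopology_quotClass [Fact p.Prime] [CompactSpace G] [T2Space G] (hfg : IsTopFG G)
    (c : ℕ) : DiscreteTopology (QuotClass p G c) :=
  QuotientGroup.discreteTopology (isOpen_lowerPCentral (p := p) hfg c)

lemma finite_quotClass [Fact p.Prime] [CompactSpace G] [T2Space G] (hfg : IsTopFG G)
    (c : ℕ) : Finite (QuotClass p G c) :=
  Subgroup.quotient_finite_of_isOpen _ (isOpen_lowerPCentral (p := p) hfg c)

lemma isPGroup_quotClass [Fact p.Prime] (hG : IsProP p G) (hfg : IsTopFG G)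
    (c : ℕ) : IsPGroup p (QuotClass p G c) := by
  have := hG.compact
  have := hG.t2
  obtain ⟨k, hk⟩ := hG.index_eq _ inferInstance (isOpen_lowerPCentral (p := p) hfg c)
  exact IsPGroup.of_card (n := k) (by rw [← hk, Subgroup.index])

end LowerCentral

/-! ### Counting tuples of generators of an elementary abelian group -/

/-- The number of `g`-tuples that generate an elementary abelian `p`-group of rank `d`.  Truncated
subtraction is harmless: for `g < d` the factor with `i = g` is `0`. -/
def genCount (p g d : ℕ) : ℕ := ∏ i ∈ Finset.range d, (p ^ g - p ^ i)

lemma card_span_eq_top {K W : Type} [Field K] [Fintype K] [AddCommGroup W] [Module K W]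
    [Module.Finite K W] (g : ℕ) :
    Nat.card {v : Fin g → W // Submodule.span K (Set.range v) = ⊤} =
      genCount (Fintype.card K) g (Module.finrank K W) := by
  set d := Module.finrank K W
  let b : Module.Basis (Fin d) K W := Module.finBasis K W
  -- the matrix of coordinates of the tuple, read by columns
  let e : (Fin g → W) ≃ (Fin d → Fin g → K) :=
    { toFun := fun v j i => b.repr (v i) j
      invFun := fun m i => b.equivFun.symm fun j => m j i
      left_inv := fun v => by
        funext i
        exact b.equivFun.symm_apply_apply (v i)
      right_inv := fun m => by
        funext j i
        have := b.equivFun.apply_symm_apply (fun j => m j i)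
        exact congrFun this j }
  have key : ∀ v : Fin g → W, Submodule.span K (Set.range v) = ⊤ ↔ LinearIndependent K (e v) := by
    intro v
    constructor
    · intro h
      rw [Fintype.linearIndependent_iff]
      intro c hc
      let l : W →ₗ[K] K := ∑ j, c j • b.coord j
      have hl : l = 0 := by
        refine LinearMap.ext_on_range h fun i => ?_
        have := congrFun hc i
        simpa [l, e] using this
      intro j
      have := LinearMap.congr_fun hl (b j)
      simpa [l, Finsupp.single_apply, Finset.sum_ite_eq] using this
    · intro h
      by_contra hne
      obtain ⟨l, hl0, hl⟩ := Submodule.exists_le_ker_of_lt_top _ (lt_top_iff_ne_top.2 hne)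
      refine hl0 (b.ext fun j => ?_)
      rw [Fintype.linearIndependent_iff] at h
      refine h (fun j => l (b j)) ?_ j
      funext i
      have h1 : l (v i) = 0 := hl (Submodule.subset_span ⟨i, rfl⟩)
      rw [← b.sum_repr (v i), map_sum] at h1
      simpa [e, mul_comm] using h1
  rw [Nat.card_congr (e.subtypeEquiv (q := fun m => LinearIndependent K m) key)]
  by_cases hd : d ≤ g
  · have h := card_linearIndependent (K := K) (V := Fin g → K) (k := d) (by simpa using hd)
    rw [h, genCount, Finset.prod_range]
    simp
  · have h1 : genCount (Fintype.card K) g d = 0 :=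
      Finset.prod_eq_zero (Finset.mem_range.2 (not_le.1 hd)) (Nat.sub_self _)
    rw [h1, Nat.card_eq_zero]
    left
    refine ⟨fun ⟨m, hm⟩ => hd ?_⟩
    simpa using hm.fintype_card_le_finrank

lemma ncard_closure_eq_top {p : ℕ} [Fact p.Prime] {V : Type} [CommGroup V] [Finite V]
    (hV : ∀ x : V, x ^ p = 1) {d : ℕ} (hd : Nat.card V = p ^ d) (g : ℕ) :
    {v : Fin g → V | Subgroup.closure (Set.range v) = ⊤}.ncard = genCount p g d := by
  let _ : Module (ZMod p) (Additive V) := AddCommGroup.zmodModule (n := p) fun x => hV x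
  have hfr : Module.finrank (ZMod p) (Additive V) = d := by
    have h1 : Nat.card (Additive V) = Nat.card (ZMod p) ^ Module.finrank (ZMod p) (Additive V) :=
      Module.natCard_eq_pow_finrank
    have h2 : Nat.card (Additive V) = Nat.card V := rfl
    rw [h2, hd, Nat.card_zmod] at h1
    exact (Nat.pow_right_injective (Fact.out : p.Prime).two_le h1).symm
  have h := card_span_eq_top (K := ZMod p) (W := Additive V) g
  rw [hfr, ZMod.card] at h
  rw [← h, ← Nat.card_coe_set_eq]
  refine Nat.card_congr (Equiv.subtypeEquivRight fun v => ?_)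
  let w : (Fin g → V) → Fin g → Additive V := fun v i => Additive.ofMul (v i)
  rw [Set.mem_ofPred_eq]
  change _ ↔ Submodule.span (ZMod p) (Set.range (w v)) = ⊤
  have h3 : Submodule.span (ZMod p) (Set.range (w v)) = ⊤ ↔
      AddSubgroup.closure (Set.range (w v)) = ⊤ := by
    constructor
    · intro h
      rw [eq_top_iff]
      intro x _
      have hx : x ∈ Submodule.span (ZMod p) (Set.range (w v)) := h ▸ trivial
      have hle : Submodule.span (ZMod p) (Set.range (w v)) ≤
          AddSubgroup.toZModSubmodule p (AddSubgroup.closure (Set.range (w v))) :=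
        Submodule.span_le.2 AddSubgroup.subset_closure
      exact hle hx
    · intro h
      rw [eq_top_iff]
      intro x _
      have hx : x ∈ AddSubgroup.closure (Set.range (w v)) := h ▸ trivial
      have hle : AddSubgroup.closure (Set.range (w v)) ≤
          (Submodule.span (ZMod p) (Set.range (w v))).toAddSubgroup :=
        (AddSubgroup.closure_le _).2 Submodule.subset_span
      exact hle hx
  rw [h3]
  constructor
  · intro h
    rw [eq_top_iff]
    intro x _
    have hx : x ∈ Subgroup.closure (Set.range v) := h ▸ trivial
    exact Subgroup.closure_induction (p := fun x _ =>
      (Additive.ofMul x) ∈ AddSubgroup.closure (Set.range (w v)))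
      (fun x hx => AddSubgroup.subset_closure hx) (zero_mem _)
      (fun _ _ _ _ => add_mem) (fun _ _ => neg_mem) hx
  · intro h
    rw [eq_top_iff]
    intro x _
    have hx : Additive.ofMul x ∈ AddSubgroup.closure (Set.range (w v)) :=
      h ▸ trivial
    exact AddSubgroup.closure_induction (p := fun x _ =>
      (Additive.toMul x) ∈ Subgroup.closure (Set.range v))
      (fun x hx => Subgroup.subset_closure hx) (one_mem _)
      (fun _ _ _ _ => mul_mem) (fun _ _ => inv_mem) hx

/-- If the fibres of `θ` on `A` over the points of `B` all have `k` elements, then every tuple of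
elements of `B` lifts to `k ^ |ι|` tuples of elements of `A`. -/
lemma ncard_tuples {α β ι : Type} [Finite α] [Finite β] [Fintype ι] (θ : α → β) (A : Set α)
    (B : Set β) (k : ℕ) (hk : ∀ b ∈ B, {a | a ∈ A ∧ θ a = b}.ncard = k) (T : Set (ι → β))
    (hT : ∀ t ∈ T, ∀ i, t i ∈ B) :
    {a : ι → α | (∀ i, a i ∈ A) ∧ (fun i => θ (a i)) ∈ T}.ncard = T.ncard * k ^ Fintype.card ι := by
  classical
  have := Fintype.ofFinite T
  let e : {a : ι → α | (∀ i, a i ∈ A) ∧ (fun i => θ (a i)) ∈ T} ≃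
      Σ t : T, ∀ i, {a | a ∈ A ∧ θ a = t.1 i} :=
    { toFun := fun a => ⟨⟨_, a.2.2⟩, fun i => ⟨a.1 i, a.2.1 i, rfl⟩⟩
      invFun := fun s => ⟨fun i => (s.2 i).1, fun i => (s.2 i).2.1, by
        have : (fun i => θ (s.2 i).1) = s.1.1 := funext fun i => (s.2 i).2.2
        rw [this]; exact s.1.2⟩
      left_inv := fun a => rfl
      right_inv := by
        rintro ⟨⟨t, ht⟩, s⟩
        have h : (fun i => θ (s i).1) = t := funext fun i => (s i).2.2
        refine Sigma.ext (Subtype.ext h) ?_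
        refine Function.hfunext rfl fun i j hij => ?_
        cases hij
        refine (Subtype.heq_iff_coe_eq fun x => ?_).2 rfl
        change (x ∈ A ∧ θ x = θ (s i).1) ↔ (x ∈ A ∧ θ x = t i)
        rw [show θ (s i).1 = t i from (s i).2.2] }
  rw [← Nat.card_coe_set_eq, Nat.card_congr e, Nat.card_sigma]
  have : ∀ t : T, Nat.card (∀ i, {a | a ∈ A ∧ θ a = t.1 i}) = k ^ Fintype.card ι := by
    intro t
    rw [Nat.card_pi]
    simp only [Nat.card_coe_set_eq]
    rw [Finset.prod_congr rfl fun i _ => hk _ (hT t.1 t.2 i), Finset.prod_const, Finset.card_univ]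
  rw [Finset.sum_congr rfl fun t _ => this t, Finset.sum_const, smul_eq_mul, Finset.card_univ,
    ← Nat.card_eq_fintype_card, Nat.card_coe_set_eq]

lemma ncard_fiberwise {α β : Type} [Finite α] [Finite β] (θ : α → β) (A : Set α)
    (B : Set β) (k : ℕ) (hk : ∀ b ∈ B, {a | a ∈ A ∧ θ a = b}.ncard = k) (T : Set β)
    (hT : T ⊆ B) : {a | a ∈ A ∧ θ a ∈ T}.ncard = T.ncard * k := by
  classical
  have := Fintype.ofFinite T
  let e : {a | a ∈ A ∧ θ a ∈ T} ≃ Σ t : T, {a | a ∈ A ∧ θ a = t.1} :=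
    { toFun := fun a => ⟨⟨_, a.2.2⟩, ⟨a.1, a.2.1, rfl⟩⟩
      invFun := fun s => ⟨s.2.1, s.2.2.1, by
        have : θ s.2.1 = s.1.1 := s.2.2.2
        rw [this]; exact s.1.2⟩
      left_inv := fun a => rfl
      right_inv := by
        rintro ⟨⟨t, ht⟩, ⟨a, ha⟩⟩
        have h : θ a = t := ha.2
        subst h
        rfl }
  rw [← Nat.card_coe_set_eq, Nat.card_congr e, Nat.card_sigma]
  simp only [Nat.card_coe_set_eq]
  rw [Finset.sum_congr rfl fun t _ => hk _ (hT t.2), Finset.sum_const, smul_eq_mul,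
    Finset.card_univ, ← Nat.card_eq_fintype_card, Nat.card_coe_set_eq]

/-! ### Elements inverted by an involution -/

section Inverted

variable {G Q : Type} [Group G] [Group Q]

/-- Squaring is inverted by a power map in a finite group of odd order. -/
lemma exists_pow_mul_self [Finite G] (hodd : Odd (Nat.card G)) :
    ∃ k : ℕ, ∀ x : G, x ^ k * x ^ k = x := by
  obtain ⟨m, hm⟩ := hodd
  refine ⟨m + 1, fun x => ?_⟩
  rw [← pow_add, show m + 1 + (m + 1) = (2 * m + 1) + 1 by ring, ← hm, pow_succ, pow_card_eq_one',
    one_mul]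

/-- If the image of `y` is inverted, then `y σ(y)⁻¹` is an inverted lift of the square of the
image of `y`. -/
lemma exists_inv_lift_sq (σ : G →* G) (hσ : ∀ x, σ (σ x) = x) (π : G →* Q) (τ : Q →* Q)
    (hπ : ∀ x, π (σ x) = τ (π x)) (K : Subgroup G) (hK : ∀ x ∈ K, σ x ∈ K) {y : G} (hy : y ∈ K)
    (hinv : τ (π y) = (π y)⁻¹) : ∃ z ∈ K, σ z = z⁻¹ ∧ π z = π y * π y := by
  refine ⟨y * (σ y)⁻¹, mul_mem hy (inv_mem (hK y hy)), ?_, ?_⟩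
  · simp [hσ]
  · simp [hπ, hinv]

lemma exists_inv_lift [Finite Q] (hodd : Odd (Nat.card Q)) (σ : G →* G) (hσ : ∀ x, σ (σ x) = x)
    (π : G →* Q) (τ : Q →* Q) (hπ : ∀ x, π (σ x) = τ (π x)) (K : Subgroup G)
    (hK : ∀ x ∈ K, σ x ∈ K) {y : G} (hy : y ∈ K) (hinv : τ (π y) = (π y)⁻¹) :
    ∃ z ∈ K, σ z = z⁻¹ ∧ π z = π y := by
  obtain ⟨k, hk⟩ := exists_pow_mul_self hodd
  obtain ⟨z, hz, h1, h2⟩ := exists_inv_lift_sq σ hσ π τ hπ K hK (pow_mem hy k)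
    (by rw [map_pow, map_pow, hinv, inv_pow])
  exact ⟨z, hz, h1, by rw [h2, map_pow, hk]⟩

/-- The inverted elements of `K` are uniformly distributed in the inverted elements of the image
of `K`. -/
lemma ncard_inv_fiber [Finite G] (hodd : Odd (Nat.card G)) (σ : G →* G) (hσ : ∀ x, σ (σ x) = x)
    (π : G →* Q) (τ : Q →* Q) (hπ : ∀ x, π (σ x) = τ (π x)) (K : Subgroup G)
    (hK : ∀ x ∈ K, σ x ∈ K) {v : Q} (hv : v ∈ K.map π) (hinv : τ v = v⁻¹) :
    {x | (x ∈ K ∧ σ x = x⁻¹) ∧ π x = v}.ncard = {x | (x ∈ K ∧ σ x = x⁻¹) ∧ π x = 1}.ncard := by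
  obtain ⟨k, hk⟩ := exists_pow_mul_self hodd
  obtain ⟨y, hy, rfl⟩ := hv
  obtain ⟨x, hx, hxi, hxy⟩ : ∃ x ∈ K, σ x = x⁻¹ ∧ π x = π y := by
    obtain ⟨z, hz, h1, h2⟩ := exists_inv_lift_sq σ hσ π τ hπ K hK (pow_mem hy k)
      (by rw [map_pow, map_pow, hinv, inv_pow])
    exact ⟨z, hz, h1, by rw [h2, ← map_mul, hk]⟩
  set w := x ^ k with hw
  have hwK : w ∈ K := pow_mem hx k
  have hwi : σ w = w⁻¹ := by rw [hw, map_pow, hxi, inv_pow]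
  have hww : w * w = x := hk x
  have hinj : Function.Injective fun n : G => w * n * w := by
    intro a b h
    simpa using h
  rw [← Set.ncard_image_of_injective {x | (x ∈ K ∧ σ x = x⁻¹) ∧ π x = 1} hinj]
  congr 1
  ext z
  constructor
  · rintro ⟨⟨h1, h2⟩, h3⟩
    refine ⟨w⁻¹ * z * w⁻¹, ⟨⟨mul_mem (mul_mem (inv_mem hwK) h1) (inv_mem hwK), ?_⟩, ?_⟩, ?_⟩
    · simp [h2, hwi, mul_assoc]
    · have : π w * π w = π y := by rw [← map_mul, hww, hxy]
      rw [map_mul, map_mul, h3, map_inv, ← this]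
      group
    · simp [mul_assoc]
  · rintro ⟨n, ⟨⟨h1, h2⟩, h3⟩, rfl⟩
    refine ⟨⟨mul_mem (mul_mem hwK h1) hwK, ?_⟩, ?_⟩
    · simp [h2, hwi, mul_assoc]
    · simp only [map_mul, h3, mul_one]
      rw [← map_mul, hww, hxy]

end Inverted

/-! ### Generator-inverting automorphisms -/

section GI

variable {p : ℕ} {G H : Type} [Group G] [TopologicalSpace G] [IsTopologicalGroup G]
  [Group H] [TopologicalSpace H] [IsTopologicalGroup H]

variable (p) in
/-- `σ` is an involution that acts as inversion modulo the Frattini subgroup `P₁`. -/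
structure IsInvolutive (σ : G →* G) : Prop where
  invol : ∀ x, σ (σ x) = x
  inv_mod : ∀ x, σ x * x ∈ lowerPCentral p G 1

lemma IsGI.isInvolutive [T2Space G] {σ : G ≃ₜ* G} (h : IsGI σ) :
    IsInvolutive p (σ : G →* G) := by
  obtain ⟨S, hS, hσ⟩ := h
  have hc : Continuous σ := σ.continuous_toFun
  constructor
  · let K : Subgroup G :=
      { carrier := {x | σ (σ x) = x}
        mul_mem' := fun {a b} ha hb => by
          rw [Set.mem_ofPred_eq] at *
          rw [map_mul, map_mul, ha, hb]
        one_mem' := by simp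
        inv_mem' := fun {a} ha => by
          rw [Set.mem_ofPred_eq] at *
          rw [map_inv, map_inv, ha] }
    have hK : (Subgroup.closure S).topologicalClosure ≤ K := by
      refine Subgroup.topologicalClosure_minimal _ ((Subgroup.closure_le _).2 fun s hs => ?_)
        (isClosed_eq (hc.comp hc) continuous_id)
      change σ (σ s) = s
      rw [hσ s hs, map_inv, hσ s hs, inv_inv]
    exact fun x => hK (hS ▸ Subgroup.mem_top x)
  · let K : Subgroup G :=
      { carrier := {x | σ x * x ∈ lowerPCentral p G 1}
        mul_mem' := fun {a b} ha hb => by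
          rw [Set.mem_ofPred_eq, ← QuotientGroup.eq_one_iff] at *
          rw [map_mul, QuotientGroup.mk_mul, QuotientGroup.mk_mul, QuotientGroup.mk_mul,
            mul_mul_mul_comm, ← QuotientGroup.mk_mul, ← QuotientGroup.mk_mul, ha, hb, one_mul]
        one_mem' := by simp
        inv_mem' := fun {a} ha => by
          rw [Set.mem_ofPred_eq, ← QuotientGroup.eq_one_iff] at *
          rw [map_inv, QuotientGroup.mk_mul, QuotientGroup.mk_inv, QuotientGroup.mk_inv,
            ← mul_inv, ← QuotientGroup.mk_mul, ha, inv_one] }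
    have hK : (Subgroup.closure S).topologicalClosure ≤ K := by
      refine Subgroup.topologicalClosure_minimal _ ((Subgroup.closure_le _).2 fun s hs => ?_)
        ((isClosed_lowerPCentral 1).preimage (hc.mul continuous_id))
      change σ s * s ∈ lowerPCentral p G 1
      rw [hσ s hs, inv_mul_cancel]
      exact one_mem _
    exact fun x => hK (hS ▸ Subgroup.mem_top x)

lemma TopGenerates.image {S : Set G} (hS : TopGenerates G S) (π : G →* H) (hπ : Continuous π)
    (hs : Function.Surjective π) : TopGenerates H (π '' S) := by
  have h1 : (Subgroup.closure S).topologicalClosure ≤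
      ((Subgroup.closure (π '' S)).topologicalClosure).comap π := by
    refine Subgroup.topologicalClosure_minimal _ ((Subgroup.closure_le _).2 fun s hs => ?_)
      ((Subgroup.isClosed_topologicalClosure _).preimage hπ)
    exact Subgroup.le_topologicalClosure _ (Subgroup.subset_closure ⟨s, hs, rfl⟩)
  rw [TopGenerates, eq_top_iff]
  intro y _
  obtain ⟨x, rfl⟩ := hs y
  exact h1 (hS ▸ Subgroup.mem_top x)

lemma IsTopFG.of_surjective (hG : IsTopFG G) (π : G →* H) (hπ : Continuous π)
    (hs : Function.Surjective π) : IsTopFG H := by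
  obtain ⟨S, hS, h⟩ := hG
  exact ⟨π '' S, hS.image _, h.image π hπ hs⟩

lemma IsGI.of_surjective {σ : G ≃ₜ* G} (h : IsGI σ) (π : G →* H) (hπ : Continuous π)
    (hs : Function.Surjective π) (τ : H ≃ₜ* H) (hτ : ∀ x, π (σ x) = τ (π x)) : IsGI τ := by
  obtain ⟨S, hS, hσ⟩ := h
  refine ⟨π '' S, hS.image π hπ hs, ?_⟩
  rintro _ ⟨s, hs, rfl⟩
  rw [← hτ, hσ s hs, map_inv]

lemma isGI_chosenGI (h : ∃ σ : G ≃ₜ* G, IsGI σ) : IsGI (chosenGI G) := by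
  obtain ⟨σ, hσ⟩ := h
  exact Classical.epsilon_spec_aux ⟨ContinuousMulEquiv.refl G⟩ _ ⟨σ, hσ⟩

/-- An involution `δ` of a finite `p`-group (`p` odd) that is trivial modulo `P₁` is trivial: every
`x` can be corrected by a power of the inverted element `x⁻¹ δ(x)` of `P₁` to a fixed point, so the
fixed points generate modulo `P₁`. -/
lemma eq_one_of_invol [Fact p.Prime] [Finite H] [DiscreteTopology H] (hH : IsPGroup p H)
    (hodd : Odd (Nat.card H)) (δ : H →* H) (h2 : ∀ x, δ (δ x) = x)
    (h1 : ∀ x, x⁻¹ * δ x ∈ lowerPCentral p H 1) (x : H) : δ x = x := by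
  obtain ⟨k, hk⟩ := exists_pow_mul_self hodd
  have hfix : (δ.eqLocus (MonoidHom.id H)) = ⊤ := by
    refine eq_top_of_sup_lowerPCentral_one hH (eq_top_iff.2 fun x _ => ?_)
    set n := x⁻¹ * δ x with hn
    have hδn : δ n = n⁻¹ := by simp [hn, h2]
    have hδm : δ (n ^ k) = (n ^ k)⁻¹ := by rw [map_pow, hδn, inv_pow]
    have hfix : δ (x * n ^ k) = x * n ^ k := by
      rw [map_mul, hδm, show δ x = x * n by simp [hn], mul_assoc]
      congr 1
      rw [mul_inv_eq_iff_eq_mul, hk]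
    have : x = (x * n ^ k) * (n ^ k)⁻¹ := by group
    rw [this]
    exact Subgroup.mul_mem_sup hfix (inv_mem (pow_mem (h1 x) k))
  have : x ∈ δ.eqLocus (MonoidHom.id H) := hfix ▸ Subgroup.mem_top x
  exact this

/-- Any two generator-inverting involutions of a finite `p`-group (`p` odd) are conjugate. -/
lemma IsInvolutive.conj [Fact p.Prime] [Finite H] [DiscreteTopology H] (hH : IsPGroup p H)
    (hodd : Odd (Nat.card H)) {σ τ : H →* H} (hσ : IsInvolutive p σ) (hτ : IsInvolutive p τ) :
    ∃ α : H ≃* H, ∀ x, α (σ x) = τ (α x) := by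
  let s : MulAut H := MulEquiv.mk' ⟨σ, σ, hσ.invol, hσ.invol⟩ σ.map_mul
  let t : MulAut H := MulEquiv.mk' ⟨τ, τ, hτ.invol, hτ.invol⟩ τ.map_mul
  have hss : s * s = 1 := MulEquiv.ext hσ.invol
  have htt : t * t = 1 := MulEquiv.ext hτ.invol
  have hmod : ∀ ρ : H →* H, IsInvolutive p ρ → ∀ x : H,
      ((ρ x : H) : QuotClass p H 1) = (x : QuotClass p H 1)⁻¹ := by
    intro ρ hρ x
    rw [eq_inv_iff_mul_eq_one, ← QuotientGroup.mk_mul, QuotientGroup.eq_one_iff]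
    exact hρ.inv_mod x
  let δ : MulAut H := s * t
  -- powers of `δ` are trivial modulo `P₁`
  have hδ : ∀ n : ℕ, ∀ x, (((δ ^ n) x : H) : QuotClass p H 1) = x := by
    intro n
    induction n with
    | zero => intro x; rfl
    | succ n ih =>
      intro x
      rw [pow_succ', MulAut.mul_apply]
      change ((σ (τ ((δ ^ n) x)) : H) : QuotClass p H 1) = x
      rw [hmod σ hσ, hmod τ hτ, inv_inv, ih]
  have hfin : Finite (MulAut H) := Finite.of_injective (fun e : MulAut H => (e : H → H))
    DFunLike.coe_injective
  have hord : Odd (orderOf δ) := by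
    by_contra hev
    rw [Nat.not_odd_iff_even] at hev
    obtain ⟨k, hk⟩ := hev
    have hpos : 0 < orderOf δ := orderOf_pos δ
    have h1 : δ ^ k = 1 := by
      refine MulEquiv.ext fun x => ?_
      refine eq_one_of_invol (p := p) hH hodd (δ ^ k : MulAut H).toMonoidHom (fun x => ?_)
        (fun x => ?_) x
      · change (δ ^ k * δ ^ k) x = x
        rw [← pow_add, ← hk, pow_orderOf_eq_one]; rfl
      · exact QuotientGroup.eq.1 (hδ k x).symm
    have := orderOf_dvd_of_pow_eq_one h1
    have := Nat.le_of_dvd (by omega) this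
    omega
  obtain ⟨m, hm⟩ := hord
  -- `ε = δ ^ (m + 1)` is the square root of `δ`, and `ε⁻¹ σ ε = τ`
  set ε := δ ^ (m + 1) with hε
  have hεε : ε * ε = δ := by
    rw [hε, ← pow_add, show m + 1 + (m + 1) = (2 * m + 1) + 1 by ring, ← hm, pow_succ,
      pow_orderOf_eq_one, one_mul]
  have hsinv : s⁻¹ = s := by rw [inv_eq_iff_mul_eq_one, hss]
  have htinv : t⁻¹ = t := by rw [inv_eq_iff_mul_eq_one, htt]
  have hsδ : s * δ * s⁻¹ = δ⁻¹ := by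
    simp only [δ, mul_inv_rev, hsinv, htinv]
    rw [← mul_assoc, hss, one_mul]
  have hsε : s * ε * s⁻¹ = ε⁻¹ := by
    rw [hε, ← conj_pow, hsδ, inv_pow]
  refine ⟨ε⁻¹, fun x => ?_⟩
  have : ε⁻¹ * s = t * ε⁻¹ := by
    have h3 : ε⁻¹ * s = s * ε := by rw [← hsε]; simp
    have h4 : s * ε * ε = t := by
      rw [mul_assoc, hεε]; simp only [δ]; rw [← mul_assoc, hss, one_mul]
    rw [h3, ← h4]; simp
  exact DFunLike.congr_fun this x

/-- The inverted elements of the Frattini subgroup `P₁(G)`. -/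
def invFrattini (p : ℕ) (σ : G →* G) : Set G :=
  {x | x ∈ lowerPCentral p G 1 ∧ σ x = x⁻¹}

lemma closure_eq_top_iff_mk [Fact p.Prime] [Finite H] [DiscreteTopology H] (hH : IsPGroup p H)
    {S : Set H} : Subgroup.closure S = ⊤ ↔
      Subgroup.closure ((fun x : H => (x : QuotClass p H 1)) '' S) = ⊤ := by
  have hmap : Subgroup.closure ((fun x : H => (x : QuotClass p H 1)) '' S) =
      (Subgroup.closure S).map (QuotientGroup.mk' (lowerPCentral p H 1)) := by
    rw [MonoidHom.map_closure]; rfl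
  rw [hmap]
  constructor
  · intro h
    rw [h, Subgroup.map_top_of_surjective _ (QuotientGroup.mk'_surjective _)]
  · intro h
    refine eq_top_of_sup_lowerPCentral_one hH ?_
    have := congrArg (Subgroup.comap (QuotientGroup.mk' (lowerPCentral p H 1))) h
    rwa [Subgroup.comap_map_eq, QuotientGroup.ker_mk', Subgroup.comap_top] at this

/-- The number of tuples of inverted elements that generate a finite `p`-group `H`: each generating
tuple of `H / P₁`, where all elements are inverted, has equally many inverted lifts. -/
lemma ncard_inverted_generators [Fact p.Prime] [Finite H] [DiscreteTopology H]
    (hH : IsPGroup p H) (hodd : Odd (Nat.card H)) {σ : H →* H} (hσ : IsInvolutive p σ) {d : ℕ}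
    (hd : Nat.card (QuotClass p H 1) = p ^ d) (g : ℕ) :
    {h : Fin g → H | (∀ i, σ (h i) = (h i)⁻¹) ∧ Subgroup.closure (Set.range h) = ⊤}.ncard =
      genCount p g d * (invFrattini p σ).ncard ^ g := by
  have hstab : ∀ x ∈ lowerPCentral p H 1, σ x ∈ lowerPCentral p H 1 := fun x hx =>
    map_mem_lowerPCentral σ continuous_of_discreteTopology 1 hx
  let τ : QuotClass p H 1 →* QuotClass p H 1 := QuotientGroup.map _ _ σ hstab
  have hτ : ∀ v, τ v = v⁻¹ := by
    intro v
    obtain ⟨x, rfl⟩ := QuotientGroup.mk_surjective v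
    change ((σ x : H) : QuotClass p H 1) = _
    rw [eq_inv_iff_mul_eq_one, ← QuotientGroup.mk_mul, QuotientGroup.eq_one_iff]
    exact hσ.inv_mod x
  have h := ncard_tuples (ι := Fin g) (fun x : H => (x : QuotClass p H 1)) {x | σ x = x⁻¹} Set.univ
    (invFrattini p σ).ncard (fun v _ => by
      have := ncard_inv_fiber hodd σ hσ.invol (QuotientGroup.mk' (lowerPCentral p H 1)) τ
        (fun _ => rfl) ⊤ (fun _ _ => Subgroup.mem_top _) (v := v)
        (by rw [Subgroup.map_top_of_surjective _ (QuotientGroup.mk'_surjective _)]; trivial) (hτ v)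
      simp only [Subgroup.mem_top, true_and, QuotientGroup.mk'_apply] at this
      refine Eq.trans ?_ (this.trans ?_)
      · rfl
      · unfold invFrattini
        congr 1
        ext x
        simp [and_comm]) {v | Subgroup.closure (Set.range v) = ⊤} (fun _ _ _ => trivial)
  rw [Fintype.card_fin, ncard_closure_eq_top pow_quotClass_one hd] at h
  rw [← h]
  congr 1
  ext a
  simp only [Set.mem_ofPred_eq]
  rw [closure_eq_top_iff_mk (p := p) hH, ← Set.range_comp]
  rfl

end GI

/-! ### Pro-`p` groups -/

section ProP

variable {p : ℕ} {G : Type} [Group G] [TopologicalSpace G] [IsTopologicalGroup G]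

/-- A closed subgroup of a pro-`p` group that generates it modulo `P₁` is the whole group. -/
lemma IsProP.eq_top_of_sup [Fact p.Prime] (hG : IsProP p G) {K : Subgroup G}
    (hKc : IsClosed (K : Set G)) (hK : K ⊔ lowerPCentral p G 1 = ⊤) : K = ⊤ := by
  have := hG.compact
  have := hG.t2
  have := hG.totallyDisconnected
  rw [eq_top_iff]
  intro y _
  by_contra hy
  have hop : IsOpen {u : G | y * u ∉ K} := (hKc.preimage (continuous_const_mul y)).isOpen_compl
  obtain ⟨V, hV⟩ := ProfiniteGrp.exist_openNormalSubgroup_sub_open_nhds_of_one hop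
    (by simpa using hy)
  have hVo : IsOpen ((V.toSubgroup : Subgroup G) : Set G) := V.isOpen'
  obtain ⟨k, hk⟩ := hG.index_eq V.toSubgroup inferInstance hVo
  have : DiscreteTopology (G ⧸ V.toSubgroup) := QuotientGroup.discreteTopology hVo
  have : Finite (G ⧸ V.toSubgroup) := Subgroup.quotient_finite_of_isOpen _ hVo
  have hP : IsPGroup p (G ⧸ V.toSubgroup) := IsPGroup.of_card (n := k) hk
  have htop : K.map (QuotientGroup.mk' V.toSubgroup) = ⊤ := by
    refine eq_top_of_sup_lowerPCentral_one hP (top_le_iff.1 ?_)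
    rw [← Subgroup.map_top_of_surjective _ (QuotientGroup.mk'_surjective V.toSubgroup), ← hK,
      Subgroup.map_sup]
    refine sup_le_sup_left ?_ _
    exact (map_lowerPCentral _ continuous_quotient_mk' (QuotientGroup.mk'_surjective _) 1).le
  have hmem : QuotientGroup.mk' V.toSubgroup y ∈ K.map (QuotientGroup.mk' V.toSubgroup) :=
    htop ▸ Subgroup.mem_top _
  obtain ⟨x, hx, hxy⟩ := hmem
  have h1 : y⁻¹ * x ∈ V.toSubgroup := QuotientGroup.eq.1 hxy.symm
  exact hV h1 (by simpa using hx)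

end ProP

/-! ### The free pro-`p` group -/

namespace FreeProP

section

variable {p g : ℕ}

lemma exists_le_inf [Fact p.Prime] (N M : PPowerNormal p g) :
    ∃ L : PPowerNormal p g, L.1 ≤ N.1 ∧ L.1 ≤ M.1 := by
  obtain ⟨a, ha⟩ := N.2.2
  obtain ⟨b, hb⟩ := M.2.2
  refine ⟨⟨N.1 ⊓ M.1, inferInstance, ?_⟩, inf_le_left, inf_le_right⟩
  have h1 : (N.1 ⊓ M.1).index ∣ p ^ (b + a) := by
    rw [← Subgroup.relIndex_mul_index (inf_le_left : N.1 ⊓ M.1 ≤ N.1), Subgroup.inf_relIndex_left,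
      ha, pow_add, ← hb]
    exact mul_dvd_mul_right (Subgroup.relIndex_dvd_index_of_normal _ _) _
  obtain ⟨k, _, hk⟩ := (Nat.dvd_prime_pow Fact.out).1 h1
  exact ⟨k, hk⟩

lemma exists_le_finset [Fact p.Prime] (I : Finset (PPowerNormal p g)) :
    ∃ L : PPowerNormal p g, ∀ N ∈ I, L.1 ≤ N.1 := by
  classical
  induction I using Finset.induction_on with
  | empty => exact ⟨⟨⊤, inferInstance, 0, by simp⟩, by simp⟩
  | insert N I _ ih =>
    obtain ⟨L, hL⟩ := ih
    obtain ⟨L', h1, h2⟩ := exists_le_inf N L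
    refine ⟨L', fun M hM => ?_⟩
    rcases Finset.mem_insert.1 hM with rfl | hM
    · exact h1
    · exact h2.trans (hL M hM)

instance [Fact p.Prime] (N : PPowerNormal p g) : Finite (FreeGroup (Fin g) ⧸ N.1) := by
  obtain ⟨k, hk⟩ := N.2.2
  have : N.1.FiniteIndex := ⟨by rw [hk]; exact pow_ne_zero _ (Fact.out : p.Prime).ne_zero⟩
  infer_instance

instance (N : PPowerNormal p g) : DiscreteTopology (FreeGroup (Fin g) ⧸ N.1) :=
  QuotientGroup.discreteTopology (isOpen_discrete _)

lemma isClosed_coe :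
    IsClosed (FreeProP p g : Set (∀ N : PPowerNormal p g, FreeGroup (Fin g) ⧸ N.1)) := by
  have : (FreeProP p g : Set (∀ N : PPowerNormal p g, FreeGroup (Fin g) ⧸ N.1)) =
      ⋂ (N : PPowerNormal p g) (M : PPowerNormal p g) (h : N.1 ≤ M.1),
        {x | QuotientGroup.map N.1 M.1 (MonoidHom.id _) h (x N) = x M} := by
    ext x
    simp only [Set.mem_iInter]
    rfl
  rw [this]
  exact isClosed_iInter fun N => isClosed_iInter fun M => isClosed_iInter fun h =>
    isClosed_eq (continuous_of_discreteTopology.comp (continuous_apply N)) (continuous_apply M)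

instance [Fact p.Prime] : CompactSpace (FreeProP p g) :=
  isCompact_iff_compactSpace.1 isClosed_coe.isCompact

variable (p g) in
/-- The canonical map from the free group to the free pro-`p` group. -/
def ofFree : FreeGroup (Fin g) →* FreeProP p g where
  toFun γ := ⟨fun N => (γ : FreeGroup (Fin g) ⧸ N.1), fun _ _ _ => rfl⟩
  map_one' := rfl
  map_mul' _ _ := rfl

/-- The free generators `xᵢ`. -/
def gen (i : Fin g) : FreeProP p g := ofFree p g (FreeGroup.of i)

/-- The projection to a finite quotient of the free group. -/
def proj (N : PPowerNormal p g) : FreeProP p g →* FreeGroup (Fin g) ⧸ N.1 :=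
  (Pi.evalMonoidHom _ N).comp (FreeProP p g).subtype

lemma continuous_proj (N : PPowerNormal p g) : Continuous (proj N) :=
  (continuous_apply N).comp continuous_subtype_val

lemma exists_proj_subset [Fact p.Prime] {U : Set (FreeProP p g)} (hU : IsOpen U)
    {x : FreeProP p g} (hx : x ∈ U) : ∃ N : PPowerNormal p g, ∀ y, proj N y = proj N x → y ∈ U := by
  obtain ⟨W, hW, rfl⟩ := isOpen_induced_iff.1 hU
  obtain ⟨I, u, hu, hsub⟩ := isOpen_pi_iff.1 hW x.1 hx
  obtain ⟨L, hL⟩ := exists_le_finset I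
  refine ⟨L, fun y hy => hsub fun N hN => ?_⟩
  have h1 : y.1 N = x.1 N := by
    rw [← y.2 L N (hL N hN), ← x.2 L N (hL N hN)]
    exact congrArg _ hy
  rw [h1]
  exact (hu N hN).2

lemma denseRange_ofFree [Fact p.Prime] : DenseRange (ofFree p g) := by
  intro x
  rw [mem_closure_iff]
  intro U hU hx
  obtain ⟨N, hN⟩ := exists_proj_subset hU hx
  obtain ⟨γ, hγ⟩ := QuotientGroup.mk_surjective (proj N x)
  exact ⟨ofFree p g γ, hN _ hγ, γ, rfl⟩

lemma hom_ext [Fact p.Prime] {G : Type} [Group G] [TopologicalSpace G] [T2Space G]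
    {φ ψ : FreeProP p g →* G} (hφ : Continuous φ) (hψ : Continuous ψ)
    (h : ∀ i, φ (gen i) = ψ (gen i)) : φ = ψ := by
  have h1 : φ.comp (ofFree p g) = ψ.comp (ofFree p g) := FreeGroup.ext_hom _ _ h
  refine DFunLike.coe_injective (denseRange_ofFree.equalizer hφ hψ ?_)
  exact congrArg (fun f : FreeGroup (Fin g) →* G => (f : FreeGroup (Fin g) → G)) h1

variable (p g) in
lemma topGenerates [Fact p.Prime] :
    TopGenerates (FreeProP p g) (Set.range (gen : Fin g → FreeProP p g)) := by
  have h : Subgroup.closure (Set.range (gen : Fin g → FreeProP p g)) = (ofFree p g).range := by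
    have : Set.range (gen : Fin g → FreeProP p g) = ofFree p g '' Set.range FreeGroup.of := by
      rw [← Set.range_comp]; rfl
    rw [this, ← MonoidHom.map_closure, FreeGroup.closure_range_of, MonoidHom.range_eq_map]
  rw [TopGenerates, h]
  refine SetLike.coe_injective ?_
  rw [Subgroup.topologicalClosure_coe, MonoidHom.coe_range]
  exact denseRange_ofFree.closure_range

variable (p g) in
lemma isTopFG [Fact p.Prime] : IsTopFG (FreeProP p g) :=
  ⟨_, Set.finite_range _, topGenerates p g⟩

variable (p g) in
lemma isProP [Fact p.Prime] : IsProP p (FreeProP p g) := by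
  refine ⟨inferInstance, inferInstance, inferInstance, fun U _ hUo => ?_⟩
  obtain ⟨N, hN⟩ := exists_proj_subset hUo (one_mem U)
  have hle : (proj N).ker ≤ U := fun x hx => hN x (by rw [map_one]; exact hx)
  obtain ⟨k, hk⟩ := N.2.2
  have h1 : U.index ∣ p ^ k := by
    refine (Subgroup.index_dvd_of_le hle).trans ?_
    rw [Subgroup.index_ker, ← hk, Subgroup.index]
    exact Subgroup.card_subgroup_dvd_card _
  obtain ⟨k, _, hk⟩ := (Nat.dvd_prime_pow Fact.out).1 h1
  exact ⟨k, hk⟩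

/-- The universal property for homomorphisms to finite `p`-groups. -/
lemma exists_lift_finite [Fact p.Prime] {E : Type} [Group E] [Finite E] [TopologicalSpace E]
    [DiscreteTopology E] (hE : IsPGroup p E) (e : Fin g → E) :
    ∃ φ : FreeProP p g →* E, Continuous φ ∧ ∀ i, φ (gen i) = e i := by
  have hker : ∃ k : ℕ, (FreeGroup.lift e).ker.index = p ^ k := by
    rw [Subgroup.index_ker]
    exact (IsPGroup.iff_card.1 (hE.to_subgroup (FreeGroup.lift e).range))
  let N : PPowerNormal p g := ⟨(FreeGroup.lift e).ker, inferInstance, hker⟩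
  refine ⟨(QuotientGroup.kerLift (FreeGroup.lift e)).comp (proj N), ?_, fun i => ?_⟩
  · exact (continuous_of_discreteTopology (α := FreeGroup (Fin g) ⧸ N.1)).comp (continuous_proj N)
  · change FreeGroup.lift e (FreeGroup.of i) = e i
    exact FreeGroup.lift_apply_of

/-- The universal property: every tuple of elements of a pro-`p` group extends to a continuous
homomorphism.  The value at `x` is found by compactness in the intersection of the cosets
prescribed by the finite quotients. -/
lemma exists_lift [Fact p.Prime] {G : Type} [Group G] [TopologicalSpace G] [IsTopologicalGroup G]
    (hG : IsProP p G) (e : Fin g → G) :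
    ∃ φ : FreeProP p g →* G, Continuous φ ∧ ∀ i, φ (gen i) = e i := by
  have := hG.compact
  have := hG.t2
  have := hG.totallyDisconnected
  have hVo : ∀ V : OpenNormalSubgroup G, IsOpen ((V.toSubgroup : Subgroup G) : Set G) :=
    fun V => V.isOpen'
  have hd : ∀ V : OpenNormalSubgroup G, DiscreteTopology (G ⧸ V.toSubgroup) :=
    fun V => QuotientGroup.discreteTopology (hVo V)
  have hf : ∀ V : OpenNormalSubgroup G, Finite (G ⧸ V.toSubgroup) :=
    fun V => Subgroup.quotient_finite_of_isOpen _ (hVo V)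
  have hP : ∀ V : OpenNormalSubgroup G, IsPGroup p (G ⧸ V.toSubgroup) := fun V => by
    obtain ⟨k, hk⟩ := hG.index_eq V.toSubgroup inferInstance (hVo V)
    exact IsPGroup.of_card (n := k) hk
  choose f hfc hfg using fun V : OpenNormalSubgroup G =>
    exists_lift_finite (hP V) fun i => (e i : G ⧸ V.toSubgroup)
  have hcompat : ∀ (V W : OpenNormalSubgroup G) (h : V.toSubgroup ≤ W.toSubgroup) x,
      QuotientGroup.map _ _ (MonoidHom.id G) h (f V x) = f W x := by
    intro V W h x
    refine DFunLike.congr_fun (hom_ext (φ := (QuotientGroup.map _ _ (MonoidHom.id G) h).comp (f V))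
      (ψ := f W) ((continuous_of_discreteTopology (α := G ⧸ V.toSubgroup)).comp (hfc V))
      (hfc W) fun i => ?_) x
    rw [MonoidHom.comp_apply, hfg, hfg]
    rfl
  have hsep : ∀ a b : G, (∀ V : OpenNormalSubgroup G, (a : G ⧸ V.toSubgroup) = b) → a = b := by
    intro a b h
    by_contra hne
    obtain ⟨V, hV⟩ := ProfiniteGrp.exist_openNormalSubgroup_sub_open_nhds_of_one
      (isOpen_compl_singleton (x := a⁻¹ * b)) (by
        rw [Set.mem_compl_iff, Set.mem_singleton_iff, eq_comm, inv_mul_eq_one]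
        exact hne)
    exact hV (QuotientGroup.eq.1 (h V)) rfl
  have hex : ∀ x : FreeProP p g, ∃ y : G, ∀ V : OpenNormalSubgroup G,
      (y : G ⧸ V.toSubgroup) = f V x := by
    intro x
    let C : OpenNormalSubgroup G → Set G := fun V =>
      (fun y : G => (y : G ⧸ V.toSubgroup)) ⁻¹' {f V x}
    have hCc : ∀ V, IsClosed (C V) := fun V =>
      (isClosed_discrete _).preimage continuous_quotient_mk'
    have hne : (⋂ V, C V).Nonempty := by
      have : Nonempty (OpenNormalSubgroup G) :=
        ⟨(ProfiniteGrp.exist_openNormalSubgroup_sub_open_nhds_of_one (isOpen_univ (X := G))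
          trivial).choose⟩
      refine IsCompact.nonempty_iInter_of_directed_nonempty_isCompact_isClosed C ?_ ?_
        (fun V => (hCc V).isCompact) hCc
      · intro V W
        refine ⟨V ⊓ W, ?_, ?_⟩
        · intro y hy
          have hy' : (y : G ⧸ (V ⊓ W).toSubgroup) = f (V ⊓ W) x := hy
          have := hcompat (V ⊓ W) V (inf_le_left (a := V.toSubgroup) (b := W.toSubgroup)) x
          rw [← hy'] at this
          exact this
        · intro y hy
          have hy' : (y : G ⧸ (V ⊓ W).toSubgroup) = f (V ⊓ W) x := hy
          have := hcompat (V ⊓ W) W (inf_le_right (a := V.toSubgroup) (b := W.toSubgroup)) x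
          rw [← hy'] at this
          exact this
      · intro V
        exact QuotientGroup.mk_surjective (f V x)
    obtain ⟨y, hy⟩ := hne
    exact ⟨y, fun V => Set.mem_iInter.1 hy V⟩
  choose φ hφ using hex
  let Φ : FreeProP p g →* G :=
    { toFun := φ
      map_one' := hsep _ _ fun V => by rw [hφ, map_one]; rfl
      map_mul' := fun a b => hsep _ _ fun V => by
        rw [hφ, map_mul, QuotientGroup.mk_mul, hφ, hφ] }
  refine ⟨Φ, ?_, fun i => hsep _ _ fun V => by rw [← hfg V i]; exact hφ _ V⟩
  refine continuous_of_continuousAt_one Φ ?_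
  rw [ContinuousAt, map_one, tendsto_nhds]
  intro U hU h1
  obtain ⟨V, hV⟩ := ProfiniteGrp.exist_openNormalSubgroup_sub_open_nhds_of_one hU h1
  have h2 : IsOpen (f V ⁻¹' {1}) := (isOpen_discrete _).preimage (hfc V)
  refine Filter.mem_of_superset (h2.mem_nhds (map_one (f V))) fun x hx => hV ?_
  have h3 : f V x = 1 := hx
  exact (QuotientGroup.eq_one_iff (φ x)).1 ((hφ x V).trans h3)

/-! ### The automorphism `σ` of the free pro-`p` group -/

lemma continuous_freeSigma : Continuous (freeSigma p g) := by
  refine Continuous.subtype_mk (continuous_pi fun N => ?_) _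
  exact (continuous_of_discreteTopology (α := FreeGroup (Fin g) ⧸ N.comapInv.1)).comp
    (continuous_proj N.comapInv)

lemma freeSigma_gen (i : Fin g) : freeSigma p g (gen i) = (gen i)⁻¹ := by
  refine Subtype.ext (funext fun N => ?_)
  change ((freeInv g (FreeGroup.of i) : FreeGroup (Fin g)) : FreeGroup (Fin g) ⧸ N.1) =
    (((FreeGroup.of i)⁻¹ : FreeGroup (Fin g)) : FreeGroup (Fin g) ⧸ N.1)
  rw [freeInv, FreeGroup.lift_apply_of]

lemma freeSigma_freeSigma [Fact p.Prime] (x : FreeProP p g) :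
    freeSigma p g (freeSigma p g x) = x := by
  refine DFunLike.congr_fun (hom_ext (φ := (freeSigma p g).comp (freeSigma p g))
    (ψ := MonoidHom.id _) (continuous_freeSigma.comp continuous_freeSigma) continuous_id
    fun i => ?_) x
  rw [MonoidHom.comp_apply, freeSigma_gen, map_inv, freeSigma_gen, inv_inv, MonoidHom.id_apply]

variable (p g) in
/-- `σ` as an automorphism of the topological group `F_g`. -/
def sigmaEquiv [Fact p.Prime] : FreeProP p g ≃ₜ* FreeProP p g where
  toFun := freeSigma p g
  invFun := freeSigma p g
  left_inv := freeSigma_freeSigma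
  right_inv := freeSigma_freeSigma
  map_mul' := map_mul _
  continuous_toFun := continuous_freeSigma
  continuous_invFun := continuous_freeSigma

variable (p g) in
lemma isGI_sigmaEquiv [Fact p.Prime] : IsGI (sigmaEquiv p g) :=
  ⟨_, topGenerates p g, by rintro _ ⟨i, rfl⟩; exact freeSigma_gen i⟩

variable (p g) in
lemma isInvolutive_freeSigma [Fact p.Prime] : IsInvolutive p (freeSigma p g) :=
  (isGI_sigmaEquiv p g).isInvolutive

/-- A continuous homomorphism from `F_g` that inverts the images of the generators is
equivariant. -/
lemma equivariant [Fact p.Prime] {G : Type} [Group G] [TopologicalSpace G] [IsTopologicalGroup G]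
    [T2Space G] {φ : FreeProP p g →* G} (hφ : Continuous φ) {τ : G →* G} (hτ : Continuous τ)
    (h : ∀ i, τ (φ (gen i)) = (φ (gen i))⁻¹) (x : FreeProP p g) :
    φ (freeSigma p g x) = τ (φ x) := by
  refine DFunLike.congr_fun (hom_ext (φ := φ.comp (freeSigma p g)) (ψ := τ.comp φ)
    (hφ.comp continuous_freeSigma) (hτ.comp hφ) fun i => ?_) x
  rw [MonoidHom.comp_apply, freeSigma_gen, map_inv, MonoidHom.comp_apply, h]

lemma closure_range_eq_top [Fact p.Prime] {H : Type} [Group H] [TopologicalSpace H]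
    [DiscreteTopology H] {φ : FreeProP p g →* H} (hφ : Continuous φ)
    (hs : Function.Surjective φ) : Subgroup.closure (Set.range fun i => φ (gen i)) = ⊤ := by
  have h := (topGenerates p g).image φ hφ hs
  rw [TopGenerates, ← Set.range_comp] at h
  have h2 : (Subgroup.closure (Set.range (φ ∘ gen))).topologicalClosure =
      Subgroup.closure (Set.range (φ ∘ gen)) :=
    SetLike.coe_injective (by
      rw [Subgroup.topologicalClosure_coe, (isClosed_discrete _).closure_eq])
  rw [h2] at h
  exact h

end

end FreeProP

/-! ### The uniform distribution on the relators -/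

lemma odd_card_of_isPGroup {p : ℕ} (hp : Odd p) [Fact p.Prime] {H : Type} [Group H] [Finite H]
    (hH : IsPGroup p H) : Odd (Nat.card H) := by
  obtain ⟨k, hk⟩ := IsPGroup.iff_card.1 hH
  rw [hk]
  exact hp.pow

section Levels

variable {p g : ℕ} [Fact p.Prime]

instance (c : ℕ) : Finite (QuotClass p (FreeProP p g) c) :=
  finite_quotClass (FreeProP.isTopFG p g) c

instance (c : ℕ) : DiscreteTopology (QuotClass p (FreeProP p g) c) :=
  discreteTopology_quotClass (FreeProP.isTopFG p g) c

variable (p g) in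
lemma isPGroup_level (c : ℕ) : IsPGroup p (QuotClass p (FreeProP p g) c) :=
  isPGroup_quotClass (FreeProP.isProP p g) (FreeProP.isTopFG p g) c

/-- The endomorphism of `Q_c(G)` induced by a continuous endomorphism of `G`. -/
def quotClassMap {G : Type} [Group G] [TopologicalSpace G] [IsTopologicalGroup G] (p : ℕ)
    (σ : G →* G) (hσ : Continuous σ) (c : ℕ) : QuotClass p G c →* QuotClass p G c :=
  QuotientGroup.map _ _ σ fun _ hx => map_mem_lowerPCentral σ hσ c hx

lemma IsInvolutive.of_surjective {G H : Type} [Group G] [TopologicalSpace G]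
    [IsTopologicalGroup G] [Group H] [TopologicalSpace H] [IsTopologicalGroup H] {σ : G →* G}
    (hσ : IsInvolutive p σ) {τ : H →* H} (π : G →* H) (hπ : Continuous π)
    (hs : Function.Surjective π) (hτ : ∀ x, π (σ x) = τ (π x)) : IsInvolutive p τ := by
  constructor
  · intro y
    obtain ⟨x, rfl⟩ := hs y
    rw [← hτ, ← hτ, hσ.invol]
  · intro y
    obtain ⟨x, rfl⟩ := hs y
    rw [← hτ, ← map_mul]
    exact map_mem_lowerPCentral π hπ 1 (hσ.inv_mod x)

lemma IsInvolutive.quotClassMap {G : Type} [Group G] [TopologicalSpace G] [IsTopologicalGroup G]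
    {σ : G →* G} (h : IsInvolutive p σ) (hσ : Continuous σ) (c : ℕ) :
    IsInvolutive p (quotClassMap p σ hσ c) :=
  h.of_surjective (QuotientGroup.mk' _) continuous_quotient_mk' (QuotientGroup.mk'_surjective _)
    fun _ => rfl

/-- The automorphism induced by `σ` on `Q_c(F_g)`. -/
abbrev sigmaLevel (p g : ℕ) (c : ℕ) :
    QuotClass p (FreeProP p g) c →* QuotClass p (FreeProP p g) c :=
  quotClassMap p (freeSigma p g) FreeProP.continuous_freeSigma c

lemma isInvolutive_sigmaLevel (c : ℕ) : IsInvolutive p (sigmaLevel p g c) :=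
  (FreeProP.isInvolutive_freeSigma p g).quotClassMap _ c

/-- Inverted elements of the Frattini subgroup are equidistributed under equivariant
surjections. -/
lemma ncard_invFrattini_fiber {G H : Type} [Group G] [TopologicalSpace G] [IsTopologicalGroup G]
    [Finite G] [DiscreteTopology G] [Group H] [TopologicalSpace H] [IsTopologicalGroup H]
    [DiscreteTopology H] (hodd : Odd (Nat.card G)) {σ : G →* G} (hσ : IsInvolutive p σ)
    {τ : H →* H} (π : G →* H) (hs : Function.Surjective π) (hπ : ∀ x, π (σ x) = τ (π x)) {y : H}
    (hy : y ∈ invFrattini p τ) :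
    {x | x ∈ invFrattini p σ ∧ π x = y}.ncard = {x | x ∈ invFrattini p σ ∧ π x = 1}.ncard :=
  ncard_inv_fiber hodd σ hσ.invol π τ hπ (lowerPCentral p G 1)
    (fun _ hx => map_mem_lowerPCentral σ continuous_of_discreteTopology 1 hx)
    (by rw [map_lowerPCentral π continuous_of_discreteTopology hs]; exact hy.1) hy.2

lemma invFrattini_of_mem {G H : Type} [Group G] [TopologicalSpace G] [IsTopologicalGroup G]
    [Group H] [TopologicalSpace H] [IsTopologicalGroup H] {σ : G →* G} {τ : H →* H} {π : G →* H}
    (hπc : Continuous π) (hπ : ∀ x, π (σ x) = τ (π x)) {x : G} (hx : x ∈ invFrattini p σ) :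
    π x ∈ invFrattini p τ :=
  ⟨map_mem_lowerPCentral π hπc 1 hx.1, by rw [← hπ, hx.2, map_inv]⟩

lemma one_mem_invFrattini {G : Type} [Group G] [TopologicalSpace G] [IsTopologicalGroup G]
    (σ : G →* G) : (1 : G) ∈ invFrattini p σ := ⟨one_mem _, by simp⟩

/-- The image of `X` in `Q_c(F_g)` consists of all inverted elements of the Frattini subgroup: they
lift to inverted elements of `F_g`. -/
lemma range_level (hp : Odd p) (c : ℕ) :
    Set.range (Relator.level (p := p) (g := g) c) = invFrattini p (sigmaLevel p g c) := by
  ext y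
  constructor
  · rintro ⟨s, rfl⟩
    exact invFrattini_of_mem (π := QuotientGroup.mk' _) continuous_quotient_mk' (fun _ => rfl)
      (⟨s.2.1, s.2.2⟩ : s.1 ∈ invFrattini p (freeSigma p g))
  · rintro ⟨h1, h2⟩
    rw [← map_lowerPCentral (QuotientGroup.mk' (lowerPCentral p (FreeProP p g) c))
      continuous_quotient_mk' (QuotientGroup.mk'_surjective _)] at h1
    obtain ⟨x, hx, rfl⟩ := h1
    obtain ⟨z, hz, hz1, hz2⟩ := exists_inv_lift (odd_card_of_isPGroup hp (isPGroup_level p g c))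
      (freeSigma p g) FreeProP.freeSigma_freeSigma (QuotientGroup.mk' _) (sigmaLevel p g c)
      (fun _ => rfl) (lowerPCentral p (FreeProP p g) 1)
      (fun _ hx => map_mem_lowerPCentral _ FreeProP.continuous_freeSigma 1 hx) hx h2
    exact ⟨⟨z, hz, hz1⟩, hz2⟩

/-- The projection `Q_k(F_g) → Q_c(F_g)` for `c ≤ k`. -/
def levelMap (p g : ℕ) {c k : ℕ} (h : c ≤ k) :
    QuotClass p (FreeProP p g) k →* QuotClass p (FreeProP p g) c :=
  QuotientGroup.map _ _ (MonoidHom.id _) (lowerPCentral_antitone p _ h)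

/-- Elements of `X` are equidistributed over their images at level `c`: the set of images at level
`k` of those with image in `S` at level `c` has size proportional to the number of images in `S`.
-/
lemma exists_levelFiber (hp : Odd p) {c k : ℕ} (h : c ≤ k) :
    ∃ n : ℕ, 0 < n ∧ ∀ S : Set (QuotClass p (FreeProP p g) c),
      (Relator.level k '' (Relator.level c ⁻¹' S)).ncard =
        (S ∩ invFrattini p (sigmaLevel p g c)).ncard * n := by
  have heq : ∀ x, levelMap p g h (sigmaLevel p g k x) = sigmaLevel p g c (levelMap p g h x) := by
    intro x
    obtain ⟨x, rfl⟩ := QuotientGroup.mk_surjective x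
    rfl
  have hsurj : Function.Surjective (levelMap p g h) := by
    intro x
    obtain ⟨x, rfl⟩ := QuotientGroup.mk_surjective x
    exact ⟨(x : QuotClass p (FreeProP p g) k), rfl⟩
  refine ⟨{x | x ∈ invFrattini p (sigmaLevel p g k) ∧ levelMap p g h x = 1}.ncard, ?_, fun S => ?_⟩
  · rw [Set.ncard_pos]
    exact ⟨1, one_mem_invFrattini _, map_one _⟩
  · rw [← ncard_fiberwise (levelMap p g h) (invFrattini p (sigmaLevel p g k))
      (invFrattini p (sigmaLevel p g c)) _ (fun y hy => ncard_invFrattini_fiber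
        (odd_card_of_isPGroup hp (isPGroup_level p g k)) (isInvolutive_sigmaLevel k) _ hsurj heq
        hy) _ Set.inter_subset_right]
    congr 1
    ext y
    constructor
    · rintro ⟨s, hs, rfl⟩
      exact ⟨range_level hp k ▸ ⟨s, rfl⟩, hs, range_level hp c ▸ ⟨s, rfl⟩⟩
    · rintro ⟨h1, h2, -⟩
      rw [← range_level hp] at h1
      obtain ⟨s, rfl⟩ := h1
      exact ⟨s, h2, rfl⟩

/-- The proportion of the inverted elements of the Frattini subgroup of `Q_c(F_g)` in `S`. -/
def levelDensity (p g c : ℕ) (S : Set (QuotClass p (FreeProP p g) c)) : ℝ≥0∞ :=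
  ((S ∩ invFrattini p (sigmaLevel p g c)).ncard : ℝ≥0∞) /
    ((invFrattini p (sigmaLevel p g c)).ncard : ℝ≥0∞)

lemma ncard_invFrattini_pos {G : Type} [Group G] [TopologicalSpace G] [IsTopologicalGroup G]
    [Finite G] (σ : G →* G) : 0 < (invFrattini p σ).ncard := by
  rw [Set.ncard_pos]
  exact ⟨1, one_mem_invFrattini _⟩

lemma density_preimage (hp : Odd p) {c k : ℕ} (h : c ≤ k)
    (S : Set (QuotClass p (FreeProP p g) c)) :
    density p g k (Relator.level c ⁻¹' S) = levelDensity p g c S := by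
  obtain ⟨n, hn, hS⟩ := exists_levelFiber (g := g) hp h
  have huniv := hS Set.univ
  rw [Set.preimage_univ, Set.univ_inter] at huniv
  have hfin : ∀ T : Set (QuotClass p (FreeProP p g) k), ((T.encard : ℕ∞) : ℝ≥0∞) = T.ncard := by
    intro T
    rw [← (Set.toFinite T).cast_ncard_eq]
    rfl
  rw [density, hfin, hfin, hS, huniv, levelDensity, Nat.cast_mul, Nat.cast_mul,
    ENNReal.mul_div_mul_right _ _ (by exact_mod_cast hn.ne') (ENNReal.natCast_ne_top n)]

lemma levelDensity_univ (c : ℕ) : levelDensity p g c Set.univ = 1 := by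
  rw [levelDensity, Set.univ_inter]
  exact ENNReal.div_self (by exact_mod_cast (ncard_invFrattini_pos _).ne')
    (ENNReal.natCast_ne_top _)

lemma levelDensity_add_compl (c : ℕ) (S : Set (QuotClass p (FreeProP p g) c)) :
    levelDensity p g c S + levelDensity p g c Sᶜ = 1 := by
  rw [← levelDensity_univ (p := p) (g := g) c, levelDensity, levelDensity, levelDensity,
    ← ENNReal.add_div, ← Nat.cast_add, ← Set.ncard_union_eq, ← Set.union_inter_distrib_right,
    Set.union_compl_self]
  exact (disjoint_compl_right (a := S)).mono Set.inter_subset_left Set.inter_subset_left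

lemma limitDensity_preimage (hp : Odd p) (c : ℕ) (S : Set (QuotClass p (FreeProP p g) c)) :
    limitDensity p g (Relator.level c ⁻¹' S) = levelDensity p g c S := by
  rw [limitDensity]
  have : (fun k => density p g k (Relator.level c ⁻¹' S)) =ᶠ[atTop]
      fun _ => levelDensity p g c S :=
    eventually_atTop.2 ⟨c, fun k hk => density_preimage hp hk S⟩
  rw [liminf_congr this, liminf_const]

lemma levelDensity_image (hp : Odd p) (c : ℕ) (t : Set (Relator p g)) :
    levelDensity p g c (Relator.level c '' t) = density p g c t := by
  rw [← density_preimage hp le_rfl, density, density]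
  congr 3
  ext y
  constructor
  · rintro ⟨s, ⟨u, hu, hus⟩, rfl⟩
    exact ⟨u, hu, hus⟩
  · rintro ⟨s, hs, rfl⟩
    exact ⟨s, ⟨s, hs, rfl⟩, rfl⟩

lemma measurableSet_level (c : ℕ) (S : Set (QuotClass p (FreeProP p g) c)) :
    MeasurableSet (Relator.level (p := p) (g := g) c ⁻¹' S) := by
  have : Relator.level (p := p) (g := g) c ⁻¹' S = ⋃ y ∈ S, Relator.level c ⁻¹' {y} := by
    ext s
    simp
  rw [this]
  exact MeasurableSet.biUnion (Set.to_countable S) fun y _ =>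
    MeasurableSpace.measurableSet_generateFrom ⟨c, y, rfl⟩

lemma muX_le (hp : Odd p) (c : ℕ) (S : Set (QuotClass p (FreeProP p g) c)) :
    muX p g (Relator.level c ⁻¹' S) ≤ levelDensity p g c S := by
  rw [muX, toMeasure_apply _ _ (measurableSet_level c S), ← limitDensity_preimage hp]
  exact OuterMeasure.ofFunction_le _

/-- The compactness of `X` shows that the limit density does not lose mass when it is extended to
a measure. -/
lemma one_le_muX_univ (hp : Odd p) : 1 ≤ muX p g Set.univ := by
  rw [muX, toMeasure_apply _ _ MeasurableSet.univ, OuterMeasure.ofFunction_apply]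
  refine le_iInf₂ fun t ht => ?_
  by_contra hlt
  rw [not_le] at hlt
  obtain ⟨ε, hε, hsum⟩ := ENNReal.exists_pos_sum_of_countable' (tsub_pos_of_lt hlt).ne' ℕ
  have hne : ∀ n, limitDensity p g (t n) ≠ ⊤ := fun n =>
    ((ENNReal.le_tsum n).trans_lt (hlt.trans ENNReal.one_lt_top)).ne
  have hc : ∀ n, ∃ c, density p g c (t n) < limitDensity p g (t n) + ε n := by
    intro n
    have h1 : limitDensity p g (t n) < limitDensity p g (t n) + ε n :=
      ENNReal.lt_add_right (hne n) (hε n).ne'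
    exact (frequently_lt_of_liminf_lt (by isBoundedDefault) h1).exists
  choose c hc using hc
  -- the saturated neighbourhoods of the sets `t n` cover the compact set `X`
  let X : Set (FreeProP p g) := {s | s ∈ lowerPCentral p (FreeProP p g) 1 ∧ freeSigma p g s = s⁻¹}
  have hX : IsCompact X := by
    refine IsClosed.isCompact (IsClosed.inter (isClosed_lowerPCentral 1) ?_)
    exact isClosed_eq FreeProP.continuous_freeSigma continuous_inv
  obtain ⟨I, hI⟩ := hX.elim_finite_subcover
    (fun n => (QuotientGroup.mk : _ → QuotClass p (FreeProP p g) (c n)) ⁻¹'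
      (Relator.level (c n) '' t n))
    (fun n => (isOpen_discrete (α := QuotClass p (FreeProP p g) (c n)) _).preimage
      continuous_quotient_mk') (by
      intro s hs
      obtain ⟨n, hn⟩ := Set.mem_iUnion.1 (ht (Set.mem_univ (⟨s, hs⟩ : Relator p g)))
      exact Set.mem_iUnion.2 ⟨n, ⟨⟨s, hs⟩, hn, rfl⟩⟩)
  let k := I.sup c
  have hle : density p g k Set.univ ≤ ∑ n ∈ I, density p g (c n) (t n) := by
    have h1 : ∀ n ∈ I, density p g (c n) (t n) =
        density p g k (Relator.level (c n) ⁻¹' (Relator.level (c n) '' t n)) := fun n hn => by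
      rw [density_preimage hp (Finset.le_sup hn), levelDensity_image hp]
    rw [Finset.sum_congr rfl h1]
    unfold density
    simp only [div_eq_mul_inv]
    rw [← Finset.sum_mul]
    gcongr
    have hfin : ∀ T : Set (QuotClass p (FreeProP p g) k),
        ((T.encard : ℕ∞) : ℝ≥0∞) = T.ncard := by
      intro T
      rw [← (Set.toFinite T).cast_ncard_eq]
      rfl
    simp only [hfin]
    have hsub : Relator.level (p := p) (g := g) k '' Set.univ ⊆
        ⋃ n ∈ I, Relator.level k '' (Relator.level (c n) ⁻¹' (Relator.level (c n) '' t n)) := by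
      rintro _ ⟨s, -, rfl⟩
      obtain ⟨n, hn, hs⟩ := Set.mem_iUnion₂.1 (hI s.2)
      exact Set.mem_iUnion₂.2 ⟨n, hn, s, hs, rfl⟩
    have := (Set.ncard_le_ncard hsub (Set.toFinite _)).trans (Finset.set_ncard_biUnion_le I _)
    exact_mod_cast this
  have h1 : density p g k Set.univ = 1 := by
    have := density_preimage (p := p) (g := g) hp (le_refl k) Set.univ
    rwa [Set.preimage_univ, levelDensity_univ] at this
  rw [h1] at hle
  have h2 : ∑ n ∈ I, density p g (c n) (t n) ≤ ∑' n, limitDensity p g (t n) + ∑' n, ε n := by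
    rw [← ENNReal.tsum_add]
    exact (Finset.sum_le_sum fun n _ => (hc n).le).trans (ENNReal.sum_le_tsum I)
  have h3 : ∑' n, limitDensity p g (t n) + ∑' n, ε n < 1 := by
    have := ENNReal.add_lt_add_left (hlt.trans ENNReal.one_lt_top).ne hsum
    rwa [add_tsub_cancel_of_le hlt.le] at this
  exact absurd (hle.trans h2) (not_le.2 h3)

/-- The measure of a set of elements of `X` that is determined by their images in `Q_c(F_g)`. Both
the set and its complement have at most the expected measure, so equality follows from the total
mass. -/
lemma muX_level (hp : Odd p) (c : ℕ) (S : Set (QuotClass p (FreeProP p g) c)) :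
    muX p g (Relator.level c ⁻¹' S) = levelDensity p g c S := by
  refine le_antisymm (muX_le hp c S) ?_
  have h1 := one_le_muX_univ (p := p) (g := g) hp
  rw [← measure_add_measure_compl (measurableSet_level c S), ← Set.preimage_compl] at h1
  have h2 : 1 ≤ muX p g (Relator.level c ⁻¹' S) + levelDensity p g c Sᶜ :=
    h1.trans (by gcongr; exact muX_le hp c _)
  rw [← levelDensity_add_compl c S] at h2
  refine (ENNReal.add_le_add_iff_right ?_).1 h2
  have := levelDensity_add_compl c S
  intro htop
  rw [htop] at this
  simp at this

lemma isProbabilityMeasure_muX (hp : Odd p) : IsProbabilityMeasure (muX p g) :=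
  ⟨by rw [← Set.preimage_univ (f := Relator.level 0), muX_level hp, levelDensity_univ]⟩

/-- The law of `(r₁, …, r_g)`. -/
abbrev relLaw (p g : ℕ) : Measure (Fin g → Relator p g) := Measure.pi fun _ : Fin g => muX p g

lemma measurableSet_levels (c : ℕ) (S : Set (Fin g → QuotClass p (FreeProP p g) c)) :
    MeasurableSet {r : Fin g → Relator p g | (fun i => (r i).level c) ∈ S} := by
  have : {r : Fin g → Relator p g | (fun i => (r i).level c) ∈ S} =
      ⋃ s ∈ S, Set.univ.pi fun i => Relator.level c ⁻¹' {s i} := by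
    ext r
    simp only [Set.mem_iUnion, Set.mem_pi, Set.mem_univ, true_imp_iff, Set.mem_preimage,
      Set.mem_singleton_iff, exists_prop]
    constructor
    · intro h
      exact ⟨_, h, fun _ => rfl⟩
    · rintro ⟨s, hs, h⟩
      have : (fun i => (r i).level c) = s := funext h
      rw [Set.mem_ofPred_eq, this]
      exact hs
  rw [this]
  exact MeasurableSet.biUnion (Set.to_countable S) fun s _ =>
    MeasurableSet.univ_pi fun i => measurableSet_level c _

/-- The images of `r₁, …, r_g` in `Q_c(F_g)` are independent and uniformly distributed. -/
lemma relLaw_levels (hp : Odd p) (c : ℕ) (S : Set (Fin g → QuotClass p (FreeProP p g) c)) :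
    relLaw p g {r | (fun i => (r i).level c) ∈ S} =
      ({s | s ∈ S ∧ ∀ i, s i ∈ invFrattini p (sigmaLevel p g c)}.ncard : ℝ≥0∞) /
        ((invFrattini p (sigmaLevel p g c)).ncard : ℝ≥0∞) ^ g := by
  classical
  have := isProbabilityMeasure_muX (p := p) (g := g) hp
  set X := invFrattini p (sigmaLevel p g c) with hX
  set T := {s : Fin g → QuotClass p (FreeProP p g) c | s ∈ S ∧ ∀ i, s i ∈ X} with hT
  have hset : {r : Fin g → Relator p g | (fun i => (r i).level c) ∈ S} =
      ⋃ s ∈ (Set.toFinite T).toFinset, Set.univ.pi fun i => Relator.level c ⁻¹' {s i} := by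
    ext r
    simp only [Set.mem_iUnion, Set.mem_pi, Set.mem_univ, true_imp_iff, Set.mem_preimage,
      Set.mem_singleton_iff, exists_prop, Set.Finite.mem_toFinset]
    constructor
    · intro h
      exact ⟨_, ⟨h, fun i => hX ▸ range_level hp c ▸ ⟨r i, rfl⟩⟩, fun _ => rfl⟩
    · rintro ⟨s, hs, h⟩
      have : (fun i => (r i).level c) = s := funext h
      rw [Set.mem_ofPred_eq, this]
      exact hs.1
  rw [hset, measure_biUnion_finset]
  · have h1 : ∀ s ∈ (Set.toFinite T).toFinset,
        relLaw p g (Set.univ.pi fun i => Relator.level c ⁻¹' {s i}) =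
          ((X.ncard : ℝ≥0∞) ^ g)⁻¹ := by
      intro s hs
      rw [Set.Finite.mem_toFinset] at hs
      rw [relLaw, Measure.pi_pi]
      have h2 : ∀ i, muX p g (Relator.level c ⁻¹' {s i}) = (X.ncard : ℝ≥0∞)⁻¹ := by
        intro i
        rw [muX_level hp, levelDensity, Set.inter_eq_left.2 (Set.singleton_subset_iff.2 (hs.2 i)),
          Set.ncard_singleton, Nat.cast_one, one_div]
      rw [Finset.prod_congr rfl fun i _ => h2 i, Finset.prod_const, Finset.card_univ,
        Fintype.card_fin, ENNReal.inv_pow]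
    rw [Finset.sum_congr rfl h1, Finset.sum_const, nsmul_eq_mul, div_eq_mul_inv,
      Set.ncard_eq_toFinset_card T (Set.toFinite T)]
  · intro s _ t _ hst
    rw [Function.onFun, Set.disjoint_left]
    intro r hr hr'
    refine hst (funext fun i => ?_)
    exact (hr i trivial).symm.trans (hr' i trivial)
  · exact fun s _ => MeasurableSet.univ_pi fun i => measurableSet_level c _

lemma exists_factor {H : Type} [Group H] [TopologicalSpace H] [IsTopologicalGroup H] {G : Type}
    [Group G] [TopologicalSpace G] [IsTopologicalGroup G] {c : ℕ} (hH : lowerPCentral p H c = ⊥)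
    (φ : G →* H) (hφ : Continuous φ) :
    ∃ ψ : QuotClass p G c →* H, ∀ x : G, ψ (x : QuotClass p G c) = φ x := by
  refine ⟨QuotientGroup.lift _ φ fun x hx => ?_, fun x => rfl⟩
  have := map_mem_lowerPCentral φ hφ c hx
  rwa [hH, Subgroup.mem_bot] at this

section Push

variable {H : Type} [Group H] [TopologicalSpace H] [DiscreteTopology H] {c : ℕ}

lemma measurableSet_image (hH : lowerPCentral p H c = ⊥) (φ : FreeProP p g →* H)
    (hφ : Continuous φ) (S : Set (Fin g → H)) :
    MeasurableSet {r : Fin g → Relator p g | (fun i => φ (r i).1) ∈ S} := by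
  obtain ⟨ψ, hψ⟩ := exists_factor hH φ hφ
  have := measurableSet_levels (p := p) (g := g) c {s | (fun i => ψ (s i)) ∈ S}
  simp only [Set.mem_ofPred_eq, Relator.level, hψ] at this
  exact this

/-- The images of the random relators under an equivariant surjection to a finite `p`-group `H`
are independent and uniformly distributed in the inverted elements of the Frattini subgroup. -/
lemma relLaw_image [Finite H] (hp : Odd p) (hH : lowerPCentral p H c = ⊥)
    {τ : H →* H} (φ : FreeProP p g →* H) (hφ : Continuous φ) (hs : Function.Surjective φ)
    (heq : ∀ x, φ (freeSigma p g x) = τ (φ x)) (S : Set (Fin g → H)) :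
    relLaw p g {r | (fun i => φ (r i).1) ∈ S} =
      ({s | s ∈ S ∧ ∀ i, s i ∈ invFrattini p τ}.ncard : ℝ≥0∞) /
        ((invFrattini p τ).ncard : ℝ≥0∞) ^ g := by
  obtain ⟨ψ, hψ⟩ := exists_factor hH φ hφ
  have hψs : Function.Surjective ψ := fun y => by
    obtain ⟨x, rfl⟩ := hs y
    exact ⟨x, hψ x⟩
  have hψe : ∀ x, ψ (sigmaLevel p g c x) = τ (ψ x) := by
    intro x
    obtain ⟨x, rfl⟩ := QuotientGroup.mk_surjective x
    change ψ ((freeSigma p g x : FreeProP p g) : QuotClass p (FreeProP p g) c) = _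
    rw [hψ, hψ, heq]
  have h1 : {r : Fin g → Relator p g | (fun i => φ (r i).1) ∈ S} =
      {r | (fun i => (r i).level c) ∈
        {s : Fin g → QuotClass p (FreeProP p g) c | (fun i => ψ (s i)) ∈ S}} := by
    simp only [Set.mem_ofPred_eq, Relator.level, hψ]
  rw [h1, relLaw_levels hp]
  set n := {x | x ∈ invFrattini p (sigmaLevel p g c) ∧ ψ x = 1}.ncard with hn
  have hfib : ∀ y ∈ invFrattini p τ,
      {x | x ∈ invFrattini p (sigmaLevel p g c) ∧ ψ x = y}.ncard = n := fun y hy =>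
    ncard_invFrattini_fiber (odd_card_of_isPGroup hp (isPGroup_level p g c))
      (isInvolutive_sigmaLevel c) ψ hψs hψe hy
  have hnpos : 0 < n := by
    rw [hn, Set.ncard_pos]
    exact ⟨1, one_mem_invFrattini _, map_one _⟩
  have hmem : ∀ x ∈ invFrattini p (sigmaLevel p g c), ψ x ∈ invFrattini p τ := fun x hx =>
    invFrattini_of_mem continuous_of_discreteTopology hψe hx
  have h2 : (invFrattini p (sigmaLevel p g c)).ncard = (invFrattini p τ).ncard * n := by
    rw [← ncard_fiberwise ψ _ _ n hfib _ subset_rfl]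
    congr 1
    ext x
    exact ⟨fun hx => ⟨hx, hmem x hx⟩, fun hx => hx.1⟩
  have h3 : {s : Fin g → QuotClass p (FreeProP p g) c |
      s ∈ {s : Fin g → _ | (fun i => ψ (s i)) ∈ S} ∧
        ∀ i, s i ∈ invFrattini p (sigmaLevel p g c)}.ncard =
      {s | s ∈ S ∧ ∀ i, s i ∈ invFrattini p τ}.ncard * n ^ g := by
    have := ncard_tuples (ι := Fin g) ψ _ _ n hfib {s | s ∈ S ∧ ∀ i, s i ∈ invFrattini p τ}
      fun t ht => ht.2
    rw [Fintype.card_fin] at this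
    rw [← this]
    congr 1
    ext s
    exact ⟨fun hx => ⟨hx.2, hx.1, fun i => hmem _ (hx.2 i)⟩, fun hx => ⟨hx.2.1, hx.1⟩⟩
  rw [h2, h3, Nat.cast_mul, Nat.cast_mul, mul_pow, Nat.cast_pow, ENNReal.mul_div_mul_right]
  · exact pow_ne_zero _ (by exact_mod_cast hnpos.ne')
  · exact ENNReal.pow_ne_top (ENNReal.natCast_ne_top n)

end Push

end Levels

/-! ### The second cohomology group of a quotient of a free pro-`p` group -/

/-- `Hom(N, ℤ/p)^G`: the continuous homomorphisms from a normal subgroup `N` of `G` to `ℤ/p` that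
are invariant under conjugation by `G`. -/
def invHom (p : ℕ) {G : Type} [Group G] [TopologicalSpace G] (N : Subgroup G) [N.Normal] :
    Submodule (ZMod p) (N → ZMod p) where
  carrier := {f | Continuous f ∧ (∀ a b, f (a * b) = f a + f b) ∧
    ∀ (x : G) (a : N), f ⟨x * a * x⁻¹, Subgroup.Normal.conj_mem inferInstance a.1 a.2 x⟩ = f a}
  zero_mem' := ⟨continuous_const, by simp, by simp⟩
  add_mem' := by
    rintro a b ⟨ha, ha', ha''⟩ ⟨hb, hb', hb''⟩
    refine ⟨ha.add hb, fun g h => ?_, fun x g => ?_⟩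
    · simp only [Pi.add_apply, ha', hb']
      ring
    · simp only [Pi.add_apply, ha'', hb'']
  smul_mem' := by
    rintro r a ⟨ha, ha', ha''⟩
    refine ⟨ha.const_smul r, fun g h => ?_, fun x g => ?_⟩
    · simp only [Pi.smul_apply, ha', smul_eq_mul]
      ring
    · simp only [Pi.smul_apply, ha'']

section Cocycles

variable {p : ℕ} {Q : Type} [Group Q]

lemma cocycle_one_left {z : Q × Q → ZMod p}
    (hz : ∀ g h k, z (h, k) - z (g * h, k) + z (g, h * k) - z (g, h) = 0) (k : Q) :
    z (1, k) = z (1, 1) := by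
  have := hz 1 1 k
  simp only [one_mul, sub_self, zero_add] at this
  exact sub_eq_zero.1 this

lemma cocycle_one_right {z : Q × Q → ZMod p}
    (hz : ∀ g h k, z (h, k) - z (g * h, k) + z (g, h * k) - z (g, h) = 0) (k : Q) :
    z (k, 1) = z (1, 1) := by
  have := hz k 1 1
  simp only [mul_one, sub_add_cancel] at this
  exact (sub_eq_zero.1 this).symm

/-- The underlying type of the central extension of `Q` by `ℤ/p` attached to a `2`-cocycle. -/
@[ext]
structure CocycleExt (p : ℕ) (Q : Type) where
  /-- the component in `Q` -/
  base : Q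
  /-- the component in `ℤ/p` -/
  fibre : ZMod p

/-- The central extension of `Q` by `ℤ/p` attached to a `2`-cocycle. -/
abbrev CocycleExt.group (z : Q × Q → ZMod p)
    (hz : ∀ g h k, z (h, k) - z (g * h, k) + z (g, h * k) - z (g, h) = 0) :
    Group (CocycleExt p Q) :=
  let _ : Mul (CocycleExt p Q) :=
    ⟨fun x y => ⟨x.base * y.base, x.fibre + y.fibre + z (x.base, y.base)⟩⟩
  let _ : One (CocycleExt p Q) := ⟨⟨1, -z (1, 1)⟩⟩
  let _ : Inv (CocycleExt p Q) :=
    ⟨fun x => ⟨x.base⁻¹, -x.fibre - z (x.base⁻¹, x.base) - z (1, 1)⟩⟩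
  Group.ofLeftAxioms
    (fun a b c => CocycleExt.ext (mul_assoc _ _ _) (by
      change a.fibre + b.fibre + z (a.base, b.base) + c.fibre + z (a.base * b.base, c.base) =
        a.fibre + (b.fibre + c.fibre + z (b.base, c.base)) + z (a.base, b.base * c.base)
      linear_combination -hz a.base b.base c.base))
    (fun a => CocycleExt.ext (one_mul _) (by
      change -z (1, 1) + a.fibre + z (1, a.base) = a.fibre
      rw [cocycle_one_left hz a.base]
      have h : ∀ u v : ZMod p, -u + v + u = v := fun u v => by ring
      exact h _ _))
    (fun a => CocycleExt.ext (inv_mul_cancel _) (by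
      have h : ∀ u v w : ZMod p, -u - v - w + u + v = -w := fun u v w => by ring
      exact h a.fibre (z (a.base⁻¹, a.base)) (z (1, 1))))

end Cocycles

section FreeCohomology

variable {p g : ℕ} [Fact p.Prime]

/-- A continuous `2`-cochain comes from a finite quotient of the free group. -/
lemma FreeProP.exists_factor_proj₂ {f : FreeProP p g × FreeProP p g → ZMod p}
    (hf : Continuous f) : ∃ N : PPowerNormal p g, ∀ x y x' y',
      FreeProP.proj N x = FreeProP.proj N x' →
      FreeProP.proj N y = FreeProP.proj N y' → f (x, y) = f (x', y') := by
  have hloc : ∀ a : FreeProP p g × FreeProP p g, ∃ N : PPowerNormal p g, ∀ x y,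
      FreeProP.proj N x = FreeProP.proj N a.1 → FreeProP.proj N y = FreeProP.proj N a.2 →
        f (x, y) = f a := by
    rintro ⟨a, b⟩
    have hop : IsOpen (f ⁻¹' {f (a, b)}) := (isOpen_discrete _).preimage hf
    obtain ⟨u, v, hu, hv, ha, hb, hsub⟩ := isOpen_prod_iff.1 hop a b rfl
    obtain ⟨N, hN⟩ := FreeProP.exists_proj_subset hu ha
    obtain ⟨M, hM⟩ := FreeProP.exists_proj_subset hv hb
    obtain ⟨L, hLN, hLM⟩ := FreeProP.exists_le_inf N M
    have hdown : ∀ (K : PPowerNormal p g) (h : L.1 ≤ K.1) (x y : FreeProP p g),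
        FreeProP.proj L x = FreeProP.proj L y → FreeProP.proj K x = FreeProP.proj K y := by
      intro K h x y hxy
      have h1 := x.2 L K h
      have h2 := y.2 L K h
      change x.1 K = y.1 K
      rw [← h1, ← h2]
      exact congrArg _ hxy
    exact ⟨L, fun x y hx hy => hsub ⟨hN x (hdown N hLN _ _ hx), hM y (hdown M hLM _ _ hy)⟩⟩
  choose N hN using hloc
  obtain ⟨I, hI⟩ := (isCompact_univ (X := FreeProP p g × FreeProP p g)).elim_finite_subcover
    (fun a => {b | FreeProP.proj (N a) b.1 = FreeProP.proj (N a) a.1 ∧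
      FreeProP.proj (N a) b.2 = FreeProP.proj (N a) a.2})
    (fun a => by
      refine IsOpen.inter ?_ ?_
      · exact (isOpen_discrete {FreeProP.proj (N a) a.1}).preimage
          ((FreeProP.continuous_proj (N a)).comp continuous_fst)
      · exact (isOpen_discrete {FreeProP.proj (N a) a.2}).preimage
          ((FreeProP.continuous_proj (N a)).comp continuous_snd))
    (fun a _ => Set.mem_iUnion.2 ⟨a, rfl, rfl⟩)
  classical
  obtain ⟨L, hL⟩ := FreeProP.exists_le_finset (I.image N)
  refine ⟨L, fun x y x' y' hx hy => ?_⟩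
  obtain ⟨a, ha, h1, h2⟩ := Set.mem_iUnion₂.1 (hI (Set.mem_univ (x, y)))
  have hle := hL (N a) (Finset.mem_image_of_mem N ha)
  have hdown : ∀ (x y : FreeProP p g),
      FreeProP.proj L x = FreeProP.proj L y → FreeProP.proj (N a) x = FreeProP.proj (N a) y := by
    intro x y hxy
    have h1 := x.2 L (N a) hle
    have h2 := y.2 L (N a) hle
    change x.1 (N a) = y.1 (N a)
    rw [← h1, ← h2]
    exact congrArg _ hxy
  rw [hN a x y h1 h2, hN a x' y' ((hdown _ _ hx).symm.trans h1) ((hdown _ _ hy).symm.trans h2)]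

/-- `H²(F_g, ℤ/p) = 0`: the extension attached to a cocycle, which comes from a finite quotient,
splits over the free pro-`p` group. -/
lemma FreeProP.Z2_le_B2 : Z2 p (FreeProP p g) ≤ B2 p (FreeProP p g) := by
  rintro z ⟨hzc, hz⟩
  obtain ⟨N, hN⟩ := FreeProP.exists_factor_proj₂ hzc
  have hsurj : Function.Surjective (FreeProP.proj N) := by
    intro q
    obtain ⟨γ, rfl⟩ := QuotientGroup.mk_surjective q
    exact ⟨FreeProP.ofFree p g γ, rfl⟩
  let s := Function.surjInv hsurj
  have hs : ∀ q, FreeProP.proj N (s q) = q := Function.surjInv_eq hsurj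
  let zb : (FreeGroup (Fin g) ⧸ N.1) × (FreeGroup (Fin g) ⧸ N.1) → ZMod p :=
    fun q => z (s q.1, s q.2)
  have hzb : ∀ x y, zb (FreeProP.proj N x, FreeProP.proj N y) = z (x, y) := fun x y =>
    hN _ _ _ _ (hs _) (hs _)
  have hcoc : ∀ a b c, zb (b, c) - zb (a * b, c) + zb (a, b * c) - zb (a, b) = 0 := by
    intro a b c
    obtain ⟨a, rfl⟩ := hsurj a
    obtain ⟨b, rfl⟩ := hsurj b
    obtain ⟨c, rfl⟩ := hsurj c
    rw [← map_mul, ← map_mul, hzb, hzb, hzb, hzb, hz]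
  let _ : Group (CocycleExt p (FreeGroup (Fin g) ⧸ N.1)) := CocycleExt.group zb hcoc
  let _ : TopologicalSpace (CocycleExt p (FreeGroup (Fin g) ⧸ N.1)) := ⊥
  have : DiscreteTopology (CocycleExt p (FreeGroup (Fin g) ⧸ N.1)) := ⟨rfl⟩
  let e : CocycleExt p (FreeGroup (Fin g) ⧸ N.1) ≃ (FreeGroup (Fin g) ⧸ N.1) × ZMod p :=
    { toFun := fun x => (x.base, x.fibre)
      invFun := fun x => ⟨x.1, x.2⟩
      left_inv := fun _ => rfl
      right_inv := fun _ => rfl }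
  have : Finite (CocycleExt p (FreeGroup (Fin g) ⧸ N.1)) := Finite.of_equiv _ e.symm
  have hP : IsPGroup p (CocycleExt p (FreeGroup (Fin g) ⧸ N.1)) := by
    obtain ⟨k, hk⟩ := N.2.2
    refine IsPGroup.of_card (n := k + 1) ?_
    rw [Nat.card_congr e, Nat.card_prod, Nat.card_zmod, pow_succ, ← hk]
    rfl
  obtain ⟨φ, hφ, hgen⟩ := FreeProP.exists_lift_finite hP
    fun i => ⟨FreeProP.proj N (FreeProP.gen i), 0⟩
  let pr : CocycleExt p (FreeGroup (Fin g) ⧸ N.1) →* FreeGroup (Fin g) ⧸ N.1 :=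
    { toFun := fun x => x.base
      map_one' := rfl
      map_mul' := fun _ _ => rfl }
  have hpr : ∀ x, (φ x).base = FreeProP.proj N x := by
    intro x
    refine DFunLike.congr_fun (FreeProP.hom_ext (φ := pr.comp φ) (ψ := FreeProP.proj N)
      ((continuous_of_discreteTopology (f := pr)).comp hφ) (FreeProP.continuous_proj N)
      fun i => ?_) x
    rw [MonoidHom.comp_apply, hgen]
    rfl
  refine ⟨fun x => -(φ x).fibre, ?_, fun x y => ?_⟩
  · exact (continuous_of_discreteTopology (f := fun a : CocycleExt p _ => -a.fibre)).comp hφ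
  · have h1 : (φ (x * y)).fibre = (φ x).fibre + (φ y).fibre + zb ((φ x).base, (φ y).base) := by
      rw [map_mul]
      rfl
    rw [hpr, hpr, hzb] at h1
    simp only [h1]
    ring

/-- Continuous homomorphisms to `ℤ/p` vanish on the Frattini subgroup. -/
lemma H1_apply_eq_zero {G : Type} [Group G] [TopologicalSpace G] [IsTopologicalGroup G]
    {f : G → ZMod p} (hf : f ∈ H1 p G) {x : G} (hx : x ∈ lowerPCentral p G 1) : f x = 0 := by
  obtain ⟨hc, hm⟩ := hf
  let φ : G →* Multiplicative (ZMod p) := MonoidHom.mk' (fun x => Multiplicative.ofAdd (f x))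
    fun a b => by rw [hm]; rfl
  have hker : IsClosed ((φ.ker : Subgroup G) : Set G) := by
    have : ((φ.ker : Subgroup G) : Set G) = f ⁻¹' {0} := rfl
    rw [this]
    exact isClosed_singleton.preimage hc
  have hle : lowerPCentral p G 1 ≤ φ.ker := by
    refine lowerPCentral_succ_le hker (fun a b _ => ?_) fun a _ => ?_
    · rw [MonoidHom.mem_ker, map_commutatorElement, commutatorElement_eq_one_iff_mul_comm,
        mul_comm]
    · rw [MonoidHom.mem_ker, map_pow]
      change Multiplicative.ofAdd (p • f a) = 1
      rw [nsmul_eq_mul, CharP.cast_eq_zero, zero_mul]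
      rfl
  exact hle hx

section Transgression

variable {G : Type} [Group G] [TopologicalSpace G] [IsTopologicalGroup G] [T2Space G]
  (π : FreeProP p g →* G) (hπ : Continuous π)

/-- `b` is a cochain on `F_g` whose coboundary is the inflation of `z`. -/
def IsCobounding (z : G × G → ZMod p) (b : FreeProP p g → ZMod p) : Prop :=
  Continuous b ∧ ∀ x y, z (π x, π y) = b y - b (x * y) + b x

include hπ in
lemma exists_isCobounding (z : Z2 p G) : ∃ b, IsCobounding π z.1 b := by
  obtain ⟨b, hb, hb'⟩ := FreeProP.Z2_le_B2 (p := p) (g := g)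
    (show (fun x : FreeProP p g × FreeProP p g => z.1 (π x.1, π x.2)) ∈ Z2 p (FreeProP p g) from
      ⟨z.2.1.comp ((hπ.comp continuous_fst).prodMk (hπ.comp continuous_snd)), fun a b c => by
        simp only [map_mul]
        exact z.2.2 _ _ _⟩)
  exact ⟨b, hb, fun x y => hb' x y⟩

variable {π}

lemma IsCobounding.eq_on_ker (hR : π.ker ≤ lowerPCentral p (FreeProP p g) 1)
    {z : G × G → ZMod p} {b b' : FreeProP p g → ZMod p} (hb : IsCobounding π z b)
    (hb' : IsCobounding π z b') {x : FreeProP p g} (hx : x ∈ π.ker) : b x = b' x := by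
  have : (fun x => b x - b' x) ∈ H1 p (FreeProP p g) := by
    refine ⟨hb.1.sub hb'.1, fun x y => ?_⟩
    have h1 := hb.2 x y
    have h2 := hb'.2 x y
    linear_combination h1 - h2
  exact sub_eq_zero.1 (H1_apply_eq_zero this (hR hx))

lemma IsCobounding.mul_of_mem {z : Z2 p G} {b : FreeProP p g → ZMod p}
    (hb : IsCobounding π z.1 b) {r : FreeProP p g} (hr : r ∈ π.ker) (y : FreeProP p g) :
    b (r * y) = b r + b y - z.1 (1, 1) := by
  have h := hb.2 r y
  rw [MonoidHom.mem_ker.1 hr, cocycle_one_left z.2.2] at h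
  linear_combination h

lemma IsCobounding.mul_of_mem' {z : Z2 p G} {b : FreeProP p g → ZMod p}
    (hb : IsCobounding π z.1 b) {r : FreeProP p g} (hr : r ∈ π.ker) (y : FreeProP p g) :
    b (y * r) = b r + b y - z.1 (1, 1) := by
  have h := hb.2 y r
  rw [MonoidHom.mem_ker.1 hr, cocycle_one_right z.2.2] at h
  linear_combination h

lemma IsCobounding.mem_invHom {z : Z2 p G} {b : FreeProP p g → ZMod p}
    (hb : IsCobounding π z.1 b) : (fun r : π.ker => b r - z.1 (1, 1)) ∈ invHom p π.ker := by
  refine ⟨(hb.1.comp continuous_subtype_val).sub continuous_const, fun r s => ?_, fun x r => ?_⟩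
  · simp only [Subgroup.coe_mul, hb.mul_of_mem r.2]
    ring
  · have h1 := hb.mul_of_mem ((inferInstance : π.ker.Normal).conj_mem r.1 r.2 x) x
    rw [inv_mul_cancel_right, hb.mul_of_mem' r.2] at h1
    simp only
    linear_combination -h1

variable (π) in
/-- The map `Z²(G, ℤ/p) → Hom(R, ℤ/p)^F` inverse to the transgression, where `G = F / R`: a
cocycle `z` becomes a coboundary on `F`, and the cochain that cobounds it, less the constant
`z(1, 1)`, restricts to an invariant homomorphism on `R`.  Since `R` is contained in the Frattini
subgroup, this does not depend on the choice of the cochain. -/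
def cobound (hR : π.ker ≤ lowerPCentral p (FreeProP p g) 1) (hπ : Continuous π) :
    Z2 p G →ₗ[ZMod p] invHom p π.ker where
  toFun z := ⟨_, (exists_isCobounding π hπ z).choose_spec.mem_invHom⟩
  map_add' z w := by
    refine Subtype.ext (funext fun r => ?_)
    have h1 := (exists_isCobounding π hπ z).choose_spec
    have h2 := (exists_isCobounding π hπ w).choose_spec
    have h3 := (exists_isCobounding π hπ (z + w)).choose_spec
    have h4 : IsCobounding π (z + w).1 ((exists_isCobounding π hπ z).choose +
        (exists_isCobounding π hπ w).choose) := by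
      refine ⟨h1.1.add h2.1, fun x y => ?_⟩
      change z.1 _ + w.1 _ = _
      rw [h1.2, h2.2]
      simp only [Pi.add_apply]
      ring
    change _ - (z.1 (1, 1) + w.1 (1, 1)) = (_ - z.1 (1, 1)) + (_ - w.1 (1, 1))
    rw [h3.eq_on_ker hR h4 r.2, Pi.add_apply]
    ring
  map_smul' c z := by
    refine Subtype.ext (funext fun r => ?_)
    have h1 := (exists_isCobounding π hπ z).choose_spec
    have h3 := (exists_isCobounding π hπ (c • z)).choose_spec
    have h4 : IsCobounding π (c • z).1 (c • (exists_isCobounding π hπ z).choose) := by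
      refine ⟨h1.1.const_smul c, fun x y => ?_⟩
      change c * z.1 _ = _
      rw [h1.2]
      simp only [Pi.smul_apply, smul_eq_mul]
      ring
    change _ - c * z.1 (1, 1) = c * (_ - z.1 (1, 1))
    rw [h3.eq_on_ker hR h4 r.2, Pi.smul_apply, smul_eq_mul]
    ring

lemma cobound_apply (hR : π.ker ≤ lowerPCentral p (FreeProP p g) 1) (hπ : Continuous π)
    {z : Z2 p G} {b : FreeProP p g → ZMod p} (hb : IsCobounding π z.1 b) (r : π.ker) :
    (cobound π hR hπ z).1 r = b r - z.1 (1, 1) := by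
  change _ - _ = _
  rw [(exists_isCobounding π hπ z).choose_spec.eq_on_ker hR hb r.2]

lemma ker_cobound (hR : π.ker ≤ lowerPCentral p (FreeProP p g) 1) (hπ : Continuous π)
    (hs : Function.Surjective π) :
    LinearMap.ker (cobound π hR hπ) = (B2 p G).submoduleOf (Z2 p G) := by
  have hq : Topology.IsQuotientMap π := hπ.isClosedMap.isQuotientMap hπ hs
  ext z
  rw [LinearMap.mem_ker, Submodule.submoduleOf, Submodule.mem_comap]
  constructor
  · intro h
    obtain ⟨b, hb⟩ := exists_isCobounding π hπ z
    have h0 : ∀ r ∈ π.ker, b r = z.1 (1, 1) := by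
      intro r hr
      have := congrFun (congrArg Subtype.val h) ⟨r, hr⟩
      rw [cobound_apply hR hπ hb] at this
      exact sub_eq_zero.1 this
    have hfac : ∀ x y, π x = π y → b x = b y := by
      intro x y hxy
      have hr : x * y⁻¹ ∈ π.ker := by rw [MonoidHom.mem_ker, map_mul, map_inv, hxy, mul_inv_cancel]
      have := hb.mul_of_mem hr y
      rw [inv_mul_cancel_right, h0 _ hr] at this
      rw [this]
      ring
    let c : G → ZMod p := fun y => b (Function.surjInv hs y)
    have hc : ∀ x, c (π x) = b x := fun x => hfac _ _ (Function.surjInv_eq hs _)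
    refine ⟨c, hq.continuous_iff.2 ?_, fun u v => ?_⟩
    · have : c ∘ π = b := funext hc
      rw [this]
      exact hb.1
    · obtain ⟨x, rfl⟩ := hs u
      obtain ⟨y, rfl⟩ := hs v
      rw [← map_mul, hc, hc, hc]
      exact hb.2 x y
  · rintro ⟨c, hc, hz⟩
    have hb : IsCobounding π z.1 (c ∘ π) := ⟨hc.comp hπ, fun x y => by
      simp only [Function.comp, map_mul]
      exact hz _ _⟩
    refine Subtype.ext (funext fun r => ?_)
    rw [cobound_apply hR hπ hb, Function.comp, MonoidHom.mem_ker.1 r.2]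
    have := hz 1 1
    rw [mul_one] at this
    change c 1 - z.1 (1, 1) = 0
    change z.1 (1, 1) = _ at this
    rw [this]
    ring

/-- An invariant homomorphism on `R` extends to a continuous cochain on `F`, by means of
representatives for the cosets of `R` in a finite quotient of `F`. -/
lemma exists_extension {R : Subgroup (FreeProP p g)} [R.Normal] {f : R → ZMod p}
    (hf : f ∈ invHom p R) : ∃ b : FreeProP p g → ZMod p, Continuous b ∧
      ∀ (r : R) (y : FreeProP p g), b (r * y) = f r + b y := by
  obtain ⟨hc, hm, -⟩ := hf
  have h1 : f 1 = 0 := by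
    have := hm 1 1
    rw [one_mul] at this
    simpa using this
  have hinv : ∀ a, f a⁻¹ = -f a := fun a => by
    have := hm a⁻¹ a
    rw [inv_mul_cancel, h1] at this
    exact (neg_eq_of_add_eq_zero_left this.symm).symm
  obtain ⟨W, hW, hWf⟩ := isOpen_induced_iff.1 ((isOpen_discrete {(0 : ZMod p)}).preimage hc)
  obtain ⟨N, hN⟩ := FreeProP.exists_proj_subset hW (x := 1) (by
    have : (1 : R) ∈ f ⁻¹' {0} := h1
    rw [← hWf] at this
    exact this)
  have hker : ∀ r : R, FreeProP.proj N r.1 = 1 → f r = 0 := by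
    intro r hr
    have : r ∈ Subtype.val ⁻¹' W := hN r.1 (by rw [hr, map_one])
    rw [hWf] at this
    exact this
  have hdep : ∀ r s : R, FreeProP.proj N r.1 = FreeProP.proj N s.1 → f r = f s := by
    intro r s hrs
    have := hker (r * s⁻¹) (by rw [Subgroup.coe_mul, Subgroup.coe_inv, map_mul, map_inv, hrs,
      mul_inv_cancel])
    rw [hm, hinv, ← sub_eq_add_neg] at this
    exact sub_eq_zero.1 this
  have hsurj : Function.Surjective (FreeProP.proj N) := by
    intro q
    obtain ⟨γ, rfl⟩ := QuotientGroup.mk_surjective q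
    exact ⟨FreeProP.ofFree p g γ, rfl⟩
  let Rb := R.map (FreeProP.proj N)
  have hRb : Rb.Normal := (inferInstance : R.Normal).map _ hsurj
  let t : FreeGroup (Fin g) ⧸ N.1 → FreeGroup (Fin g) ⧸ N.1 := fun q =>
    Quotient.out (q : (FreeGroup (Fin g) ⧸ N.1) ⧸ Rb)
  have ht : ∀ q, ∃ r : R, FreeProP.proj N r.1 = q * (t q)⁻¹ := by
    intro q
    have h2 : ((t q : FreeGroup (Fin g) ⧸ N.1) : (FreeGroup (Fin g) ⧸ N.1) ⧸ Rb) = q :=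
      Quotient.out_eq' _
    have h3 : (t q)⁻¹ * q ∈ Rb := QuotientGroup.eq.1 h2
    obtain ⟨r, hr, hr'⟩ := hRb.mem_comm h3
    exact ⟨⟨r, hr⟩, hr'⟩
  choose ρ hρ using ht
  refine ⟨fun y => f (ρ (FreeProP.proj N y)), ?_, fun r y => ?_⟩
  · exact (continuous_of_discreteTopology (f := fun q => f (ρ q))).comp
      (FreeProP.continuous_proj N)
  · have ht' : t (FreeProP.proj N (r * y)) = t (FreeProP.proj N y) := by
      have : ((FreeProP.proj N (r * y) : FreeGroup (Fin g) ⧸ N.1) :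
          (FreeGroup (Fin g) ⧸ N.1) ⧸ Rb) = (FreeProP.proj N y : FreeGroup (Fin g) ⧸ N.1) := by
        rw [map_mul, QuotientGroup.mk_mul, (QuotientGroup.eq_one_iff (N := Rb) _).2
          (Subgroup.mem_map_of_mem _ r.2), one_mul]
      simp only [t, this]
    rw [← hm]
    refine hdep _ _ ?_
    rw [hρ, ht', Subgroup.coe_mul, map_mul, map_mul, hρ, mul_assoc]

/-- The coboundary of an extension of `f ∈ Hom(R, ℤ/p)^F` to `F` is constant on the cosets of `R`,
and so descends to a cocycle on `G`. -/
lemma cobound_surjective (hR : π.ker ≤ lowerPCentral p (FreeProP p g) 1) (hπ : Continuous π)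
    (hs : Function.Surjective π) : Function.Surjective (cobound π hR hπ) := by
  intro f
  obtain ⟨b, hbc, hb⟩ := exists_extension f.2
  have hprod : Topology.IsQuotientMap (Prod.map π π) := by
    have hc : Continuous (Prod.map π π) := hπ.prodMap hπ
    exact hc.isClosedMap.isQuotientMap hc (hs.prodMap hs)
  let B : FreeProP p g → FreeProP p g → ZMod p := fun x y => b y - b (x * y) + b x
  have hBl : ∀ (r : π.ker) x y, B (r * x) y = B x y := by
    intro r x y
    simp only [B, mul_assoc, hb]
    ring
  have hBr : ∀ (r : π.ker) x y, B x (r * y) = B x y := by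
    intro r x y
    have h1 : x * (r * y) = (⟨x * r * x⁻¹,
      Subgroup.Normal.conj_mem inferInstance r.1 r.2 x⟩ : π.ker).1 * (x * y) := by group
    simp only [B]
    rw [h1, hb, hb, f.2.2.2]
    ring
  have hBπ : ∀ x y x' y', π x = π x' → π y = π y' → B x y = B x' y' := by
    intro x y x' y' hx hy
    have h1 : x = (⟨x * x'⁻¹, by rw [MonoidHom.mem_ker, map_mul, map_inv, hx, mul_inv_cancel]⟩ :
      π.ker).1 * x' := by simp
    have h2 : y = (⟨y * y'⁻¹, by rw [MonoidHom.mem_ker, map_mul, map_inv, hy, mul_inv_cancel]⟩ :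
      π.ker).1 * y' := by simp
    rw [h1, hBl, h2, hBr]
  let z : G × G → ZMod p := fun u => B (Function.surjInv hs u.1) (Function.surjInv hs u.2)
  have hz : ∀ x y, z (π x, π y) = B x y := fun x y =>
    hBπ _ _ _ _ (Function.surjInv_eq hs _) (Function.surjInv_eq hs _)
  have hzmem : z ∈ Z2 p G := by
    refine ⟨hprod.continuous_iff.2 ?_, fun u v w => ?_⟩
    · have : z ∘ Prod.map π π = fun a => b a.2 - b (a.1 * a.2) + b a.1 :=
        funext fun a => hz a.1 a.2
      rw [this]
      exact ((hbc.comp continuous_snd).sub (hbc.comp continuous_mul)).add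
        (hbc.comp continuous_fst)
    · obtain ⟨u, rfl⟩ := hs u
      obtain ⟨v, rfl⟩ := hs v
      obtain ⟨w, rfl⟩ := hs w
      rw [← map_mul, ← map_mul, hz, hz, hz, hz]
      simp only [B, mul_assoc]
      ring
  refine ⟨⟨z, hzmem⟩, Subtype.ext (funext fun r => ?_)⟩
  rw [cobound_apply hR hπ (b := b) ⟨hbc, hz⟩]
  have h1 : z (1, 1) = b 1 := by
    rw [← map_one π, hz]
    simp [B]
  have h2 := hb r 1
  rw [mul_one] at h2
  simp only
  rw [h1, h2]
  ring

/-- `dim H²(G, ℤ/p) = dim Hom(R, ℤ/p)^F` when `G = F / R` is a minimal presentation. -/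
lemma rank_H2 (hR : π.ker ≤ lowerPCentral p (FreeProP p g) 1) (hπ : Continuous π)
    (hs : Function.Surjective π) :
    Module.rank (ZMod p) (H2 p G) = Module.rank (ZMod p) (invHom p π.ker) := by
  have e := (cobound π hR hπ).quotKerEquivOfSurjective (cobound_surjective hR hπ hs)
  rw [ker_cobound hR hπ hs] at e
  exact e.rank_eq

lemma rank_H1 (hR : π.ker ≤ lowerPCentral p (FreeProP p g) 1) (hπ : Continuous π)
    (hs : Function.Surjective π) : Module.rank (ZMod p) (H1 p G) = g := by
  have hq : Topology.IsQuotientMap π := hπ.isClosedMap.isQuotientMap hπ hs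
  let ev : H1 p G →ₗ[ZMod p] (Fin g → ZMod p) :=
    { toFun := fun f i => f.1 (π (FreeProP.gen i))
      map_add' := fun _ _ => rfl
      map_smul' := fun _ _ => rfl }
  let hom : H1 p G → (FreeProP p g →* Multiplicative (ZMod p)) := fun f =>
    MonoidHom.mk' (fun x => Multiplicative.ofAdd (f.1 (π x))) fun a b => by
      rw [map_mul, f.2.2]; rfl
  have hcont : ∀ f, Continuous (hom f) := fun f => continuous_ofAdd.comp (f.2.1.comp hπ)
  have hbij : Function.Bijective ev := by
    constructor
    · intro f f' h
      have h1 : hom f = hom f' := FreeProP.hom_ext (hcont f) (hcont f') fun i =>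
        congrArg Multiplicative.ofAdd (congrFun h i)
      refine Subtype.ext (funext fun y => ?_)
      obtain ⟨x, rfl⟩ := hs y
      exact Multiplicative.ofAdd.injective (DFunLike.congr_fun h1 x)
    · intro e
      have hP : IsPGroup p (Multiplicative (ZMod p)) :=
        IsPGroup.of_card (n := 1) (by rw [pow_one]; exact Nat.card_zmod p)
      have : Finite (Multiplicative (ZMod p)) := inferInstanceAs (Finite (ZMod p))
      obtain ⟨φ, hφ, hgen⟩ := FreeProP.exists_lift_finite hP fun i => Multiplicative.ofAdd (e i)
      let b : FreeProP p g → ZMod p := fun x => (φ x).toAdd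
      have hb : b ∈ H1 p (FreeProP p g) :=
        ⟨continuous_toAdd.comp hφ, fun x y => by simp only [b, map_mul]; rfl⟩
      have hfac : ∀ x y, π x = π y → b x = b y := by
        intro x y hxy
        have hr : x * y⁻¹ ∈ π.ker := by
          rw [MonoidHom.mem_ker, map_mul, map_inv, hxy, mul_inv_cancel]
        have := H1_apply_eq_zero hb (hR hr)
        have h2 := hb.2 (x * y⁻¹) y
        rw [inv_mul_cancel_right, this, zero_add] at h2
        exact h2
      let c : G → ZMod p := fun y => b (Function.surjInv hs y)
      have hc : ∀ x, c (π x) = b x := fun x => hfac _ _ (Function.surjInv_eq hs _)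
      refine ⟨⟨c, hq.continuous_iff.2 ?_, fun u v => ?_⟩, funext fun i => ?_⟩
      · have : c ∘ π = b := funext hc
        rw [this]
        exact hb.1
      · obtain ⟨x, rfl⟩ := hs u
        obtain ⟨y, rfl⟩ := hs v
        rw [← map_mul, hc, hc, hc]
        exact hb.2 x y
      · change c (π (FreeProP.gen i)) = e i
        rw [hc]
        simp only [b, hgen]
        rfl
  rw [(LinearEquiv.ofBijective ev hbij).rank_eq, rank_fun', Fintype.card_fin]

end Transgression

end FreeCohomology

/-! ### Abelianizations -/

section AbelianPowers

variable {p : ℕ} {C : Type} [CommGroup C] [TopologicalSpace C] [IsTopologicalGroup C]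

lemma lowerPCentral_eq_range_pow [CompactSpace C] [T2Space C] (n : ℕ) :
    lowerPCentral p C n = (powMonoidHom (p ^ n) : C →* C).range := by
  induction n with
  | zero =>
    refine (eq_top_iff.2 fun x _ => ⟨x, ?_⟩).symm
    simp
  | succ n ih =>
    apply le_antisymm
    · refine lowerPCentral_succ_le ?_ (fun a b _ => ?_) fun a ha => ?_
      · rw [MonoidHom.coe_range]
        exact (isCompact_range (continuous_pow _)).isClosed
      · rw [commutatorElement_eq_one_iff_mul_comm.2 (mul_comm a b)]
        exact one_mem _
      · rw [ih] at ha
        obtain ⟨y, rfl⟩ := ha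
        exact ⟨y, by simp [pow_succ, pow_mul]⟩
    · rintro _ ⟨y, rfl⟩
      have h : y ^ p ^ n ∈ lowerPCentral p C n := by
        rw [ih]
        exact ⟨y, rfl⟩
      have := pow_mem_lowerPCentral_succ h
      rwa [← pow_mul, ← pow_succ] at this

/-- In an abelian pro-`p` group, a subgroup of powers that consists of higher powers is
trivial. -/
lemma pow_eq_one_of_forall_pow [Fact p.Prime] (hC : IsProP p C) {n : ℕ}
    (h : ∀ c : C, ∃ d : C, c ^ p ^ n = d ^ p ^ (n + 1)) (c : C) : c ^ p ^ n = 1 := by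
  have := hC.compact
  have := hC.t2
  have := hC.totallyDisconnected
  have hj : ∀ j : ℕ, ∀ c : C, ∃ d : C, c ^ p ^ n = d ^ p ^ (n + j) := by
    intro j
    induction j with
    | zero => exact fun c => ⟨c, rfl⟩
    | succ j ih =>
      intro c
      obtain ⟨d, hd⟩ := h c
      obtain ⟨e, he⟩ := ih d
      refine ⟨e, ?_⟩
      rw [hd, pow_succ, pow_mul, he, ← pow_mul, ← pow_succ, add_assoc]
  by_contra hne
  obtain ⟨V, hV⟩ := ProfiniteGrp.exist_openNormalSubgroup_sub_open_nhds_of_one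
    (isOpen_compl_singleton (x := c ^ p ^ n)) (Ne.symm hne)
  have hVo : IsOpen ((V.toSubgroup : Subgroup C) : Set C) := V.isOpen'
  obtain ⟨k, hk⟩ := hC.index_eq V.toSubgroup inferInstance hVo
  obtain ⟨d, hd⟩ := hj k c
  refine hV (show c ^ p ^ n ∈ V.toSubgroup from ?_) rfl
  rw [hd, pow_add, pow_mul, ← hk]
  exact Subgroup.pow_index_mem _ _

end AbelianPowers

section AbQuot

variable {p g m : ℕ} [Fact p.Prime]

/-- The group `(ℤ/pᵐ)^g`, the largest abelian quotient of exponent `pᵐ` of the free pro-`p`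
group. -/
abbrev AbQuot (p g m : ℕ) : Type := Fin g → Multiplicative (ZMod (p ^ m))

/-- The standard generators of `(ℤ/pᵐ)^g`. -/
def AbQuot.gen (i : Fin g) : AbQuot p g m := Pi.mulSingle i (Multiplicative.ofAdd 1)

lemma card_mulZMod (p m : ℕ) : Nat.card (Multiplicative (ZMod (p ^ m))) = p ^ m :=
  Nat.card_zmod (p ^ m)

instance (p m : ℕ) : IsCyclic (Multiplicative (ZMod (p ^ m))) := inferInstance

lemma card_abQuot : Nat.card (AbQuot p g m) = p ^ (m * g) := by
  rw [Nat.card_fun, card_mulZMod, Nat.card_fin, pow_mul]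

lemma isPGroup_abQuot : IsPGroup p (AbQuot p g m) := IsPGroup.of_card card_abQuot

lemma pow_abQuot (a : AbQuot p g m) : a ^ p ^ m = 1 := by
  funext i
  have := pow_card_eq_one' (x := a i)
  rwa [card_mulZMod] at this

/-- `(ℤ/pᵐ)^g` is free on its generators among the abelian groups of exponent `pᵐ`. -/
lemma AbQuot.exists_lift {C : Type} [CommGroup C] (hC : ∀ x : C, x ^ p ^ m = 1) (c : Fin g → C) :
    ∃ ψ : AbQuot p g m →* C, ∀ i, ψ (AbQuot.gen i) = c i := by
  have hmod : ∀ (x : C) (k : ℕ), x ^ (k % p ^ m) = x ^ k := fun x k =>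
    (pow_eq_pow_mod k (hC x)).symm
  let f : C → Multiplicative (ZMod (p ^ m)) →* C := fun x =>
    { toFun := fun a => x ^ (Multiplicative.toAdd a).val
      map_one' := by simp
      map_mul' := fun a b => by
        rw [toAdd_mul, ZMod.val_add, hmod, pow_add] }
  have hf1 : ∀ x, f x (Multiplicative.ofAdd 1) = x := by
    intro x
    change x ^ (1 : ZMod (p ^ m)).val = x
    rw [ZMod.val_one_eq_one_mod, hmod, pow_one]
  refine ⟨MonoidHom.mk' (fun a => ∏ i, f (c i) (a i)) fun a b => ?_, fun i => ?_⟩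
  · simp only [Pi.mul_apply, map_mul, Finset.prod_mul_distrib]
  · change ∏ j, f (c j) ((Pi.mulSingle i (Multiplicative.ofAdd 1) : AbQuot p g m) j) = c i
    rw [Finset.prod_eq_single i]
    · rw [Pi.mulSingle_eq_same, hf1]
    · intro j _ hj
      rw [Pi.mulSingle_eq_of_ne hj, map_one]
    · exact fun h => absurd (Finset.mem_univ i) h

lemma AbQuot.eq_prod (a : AbQuot p g m) :
    a = ∏ i, (AbQuot.gen i : AbQuot p g m) ^ (Multiplicative.toAdd (a i)).val := by
  conv_lhs => rw [← Finset.univ_prod_mulSingle a]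
  refine Finset.prod_congr rfl fun i _ => ?_
  rw [AbQuot.gen, ← Pi.mulSingle_pow]
  congr 1
  have := ZMod.natCast_zmod_val (Multiplicative.toAdd (a i))
  conv_lhs => rw [← ofAdd_toAdd (a i), ← this]
  rw [← ofAdd_nsmul, nsmul_eq_mul, mul_one]

lemma AbQuot.closure_gen :
    Subgroup.closure (Set.range (AbQuot.gen : Fin g → AbQuot p g m)) = ⊤ := by
  rw [eq_top_iff]
  intro a _
  rw [AbQuot.eq_prod a]
  exact prod_mem fun i _ => pow_mem (Subgroup.subset_closure (Set.mem_range_self i)) _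

lemma card_ker_pow_abQuot (hm : 0 < m) :
    Nat.card (powMonoidHom p : AbQuot p g m →* AbQuot p g m).ker = p ^ g := by
  let e : (powMonoidHom p : AbQuot p g m →* AbQuot p g m).ker ≃
      (Fin g → (powMonoidHom p : Multiplicative (ZMod (p ^ m)) →* _).ker) :=
    { toFun := fun a i => ⟨a.1 i, congrFun a.2 i⟩
      invFun := fun a => ⟨fun i => (a i).1, funext fun i => (a i).2⟩
      left_inv := fun _ => rfl
      right_inv := fun _ => rfl }
  rw [Nat.card_congr e, Nat.card_fun, IsCyclic.card_powMonoidHom_ker, card_mulZMod, Nat.card_fin,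
    Nat.gcd_eq_right (dvd_pow_self p hm.ne')]

lemma card_range_pow (C : Type) [CommGroup C] [Finite C] (n : ℕ) :
    Nat.card (powMonoidHom n : C →* C).range * Nat.card (powMonoidHom n : C →* C).ker =
      Nat.card C := by
  rw [← Subgroup.index_ker, Subgroup.index_mul_card]

lemma card_lowerPCentral_one_abQuot (n : ℕ) :
    Nat.card (lowerPCentral p (AbQuot p g (n + 1)) 1) = p ^ (n * g) := by
  rw [lowerPCentral_eq_range_pow, pow_one]
  have h := card_range_pow (AbQuot p g (n + 1)) p
  rw [card_ker_pow_abQuot (Nat.succ_pos n), card_abQuot, Nat.succ_mul, pow_add p (n * g) g] at h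
  exact Nat.eq_of_mul_eq_mul_right (pow_pos (Fact.out : p.Prime).pos _) h

lemma exists_pow_of_pow_eq_one {n : ℕ} {a : AbQuot p g (n + 1)} (ha : a ^ p = 1) :
    ∃ b : AbQuot p g (n + 1), a = b ^ p ^ n := by
  have h : ∀ i, ∃ b : ZMod (p ^ (n + 1)), Multiplicative.toAdd (a i) = p ^ n • b := by
    intro i
    have h1 : p • Multiplicative.toAdd (a i) = 0 := congrFun ha i
    have h2 : ((p * (Multiplicative.toAdd (a i)).val : ℕ) : ZMod (p ^ (n + 1))) = 0 := by
      rw [Nat.cast_mul, ZMod.natCast_zmod_val, ← nsmul_eq_mul, h1]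
    rw [ZMod.natCast_eq_zero_iff] at h2
    obtain ⟨k, hk⟩ := (Nat.mul_dvd_mul_iff_left (Fact.out : p.Prime).pos).1
      ((dvd_of_eq (pow_succ' p n).symm).trans h2)
    refine ⟨k, ?_⟩
    rw [← ZMod.natCast_zmod_val (Multiplicative.toAdd (a i)), hk, nsmul_eq_mul, Nat.cast_mul]
  choose b hb using h
  exact ⟨fun i => Multiplicative.ofAdd (b i), funext fun i => hb i⟩

variable (p g m) in
/-- The map `F_g → (ℤ/pᵐ)^g`. -/
def abMap : FreeProP p g →* AbQuot p g m :=
  (FreeProP.exists_lift_finite isPGroup_abQuot AbQuot.gen).choose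

variable (p g m) in
lemma continuous_abMap : Continuous (abMap p g m) :=
  (FreeProP.exists_lift_finite isPGroup_abQuot AbQuot.gen).choose_spec.1

lemma abMap_gen (i : Fin g) : abMap p g m (FreeProP.gen i) = AbQuot.gen i :=
  (FreeProP.exists_lift_finite isPGroup_abQuot AbQuot.gen).choose_spec.2 i

variable (p g m) in
lemma abMap_surjective : Function.Surjective (abMap p g m) := by
  rw [← MonoidHom.range_eq_top, eq_top_iff, ← AbQuot.closure_gen, Subgroup.closure_le]
  rintro _ ⟨i, rfl⟩
  exact ⟨_, abMap_gen i⟩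

lemma abMap_freeSigma (x : FreeProP p g) : abMap p g m (freeSigma p g x) = (abMap p g m x)⁻¹ :=
  FreeProP.equivariant (continuous_abMap p g m) (τ := (MulEquiv.inv (AbQuot p g m)).toMonoidHom)
    continuous_of_discreteTopology (fun _ => rfl) x

lemma lowerPCentral_abQuot : lowerPCentral p (AbQuot p g m) m = ⊥ := by
  rw [lowerPCentral_eq_range_pow, eq_bot_iff]
  rintro _ ⟨a, rfl⟩
  exact pow_abQuot a

/-! ### Finiteness of the abelianization -/

/-- The image of a subgroup `R` in `(ℤ/pⁿ⁺¹)^g` contains all `pⁿ`-th powers.  For a closed normal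
subgroup this says that the abelianization of `F_g / R` has exponent dividing `pⁿ`. -/
def IsFullAt (n : ℕ) (R : Subgroup (FreeProP p g)) : Prop :=
  ∀ a : AbQuot p g (n + 1), a ^ p ^ n ∈ R.map (abMap p g (n + 1))

section Presentation

variable {G : Type} [Group G] [TopologicalSpace G] [IsTopologicalGroup G] [T2Space G]
  {π : FreeProP p g →* G} (hπ : Continuous π) (hs : Function.Surjective π)

/-- The map from `F_g` to the abelianization of a quotient of `F_g`. -/
def toAb (π : FreeProP p g →* G) : FreeProP p g →* TopologicalAbelianization G :=
  (QuotientGroup.mk' _).comp π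

include hπ in
lemma continuous_toAb : Continuous (toAb π) := continuous_quotient_mk'.comp hπ

include hs in
lemma toAb_surjective : Function.Surjective (toAb π) := (QuotientGroup.mk'_surjective _).comp hs

instance : T2Space (TopologicalAbelianization G) := by
  have : IsClosed ((commutator G).topologicalClosure : Set G) :=
    Subgroup.isClosed_topologicalClosure _
  infer_instance

include hπ hs in
lemma isProP_of_surjective : IsProP p G := by
  have hq : Topology.IsQuotientMap π := hπ.isClosedMap.isQuotientMap hπ hs
  have hcl : IsClosed (π.ker : Set (FreeProP p g)) := by
    have : (π.ker : Set (FreeProP p g)) = π ⁻¹' {1} := rfl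
    rw [this]
    exact isClosed_singleton.preimage hπ
  have hQ := (FreeProP.isProP p g).quotient π.ker hcl
  have := hQ.compact
  have := hQ.totallyDisconnected
  let e : (FreeProP p g ⧸ π.ker) ≃* G := QuotientGroup.quotientKerEquivOfSurjective π hs
  have hec : Continuous e := by
    rw [(QuotientGroup.isQuotientMap_mk (N := π.ker)).continuous_iff]
    exact hπ
  let h : (FreeProP p g ⧸ π.ker) ≃ₜ G := Continuous.homeoOfEquivCompactToT2 (f := e.toEquiv) hec
  refine ⟨h.compactSpace, inferInstance, h.totallyDisconnectedSpace, fun U hU hUo => ?_⟩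
  obtain ⟨k, hk⟩ := hQ.index_eq (U.comap e.toMonoidHom) (hU.comap _) (hUo.preimage hec)
  exact ⟨k, (Subgroup.index_comap_of_surjective U (f := e.toMonoidHom) e.surjective).symm.trans hk⟩

include hπ hs in
lemma isProP_ab : IsProP p (TopologicalAbelianization G) :=
  (isProP_of_surjective hπ hs).quotient _ (Subgroup.isClosed_topologicalClosure _)

include hπ hs in
/-- The universal property of the abelianization. -/
lemma eq_one_of_toAb_eq_one {H : Type} [CommGroup H] [TopologicalSpace H] [IsTopologicalGroup H]
    [T2Space H] (φ : FreeProP p g →* H) (hφ : Continuous φ) (hR : π.ker ≤ φ.ker)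
    {x : FreeProP p g} (hx : toAb π x = 1) : φ x = 1 := by
  have hq : Topology.IsQuotientMap π := hπ.isClosedMap.isQuotientMap hπ hs
  let ψ : G →* H := π.liftOfSurjective hs ⟨φ, hR⟩
  have hψ : ∀ x, ψ (π x) = φ x := fun x => MonoidHom.liftOfRightInverse_comp_apply _ _ _ ⟨φ, hR⟩ x
  have hψc : Continuous ψ := by
    rw [hq.continuous_iff]
    exact (funext hψ : ψ ∘ π = φ) ▸ hφ
  have hle : (commutator G).topologicalClosure ≤ ψ.ker := by
    refine Subgroup.topologicalClosure_minimal _ (Abelianization.commutator_subset_ker ψ) ?_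
    have : (ψ.ker : Set G) = ψ ⁻¹' {1} := rfl
    rw [this]
    exact isClosed_singleton.preimage hψc
  rw [← hψ]
  exact hle ((QuotientGroup.eq_one_iff _).1 hx)

include hπ hs in
/-- If the abelianization has exponent `pᵐ`, it is the quotient of `(ℤ/pᵐ)^g` by the image of the
relations. -/
lemma nonempty_ab_equiv (hC : ∀ c : TopologicalAbelianization G, c ^ p ^ m = 1) :
    Nonempty (TopologicalAbelianization G ≃* AbQuot p g m ⧸ π.ker.map (abMap p g m)) := by
  obtain ⟨Ψ, hΨ⟩ := AbQuot.exists_lift (m := m) hC fun i => toAb π (FreeProP.gen i)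
  have hcomp : ∀ x, Ψ (abMap p g m x) = toAb π x := by
    intro x
    refine DFunLike.congr_fun (FreeProP.hom_ext (φ := Ψ.comp (abMap p g m)) (ψ := toAb π)
      ((continuous_of_discreteTopology (f := Ψ)).comp (continuous_abMap p g m))
      (continuous_toAb hπ) fun i => ?_) x
    rw [MonoidHom.comp_apply, abMap_gen, hΨ]
  have hker : Ψ.ker = π.ker.map (abMap p g m) := by
    ext a
    obtain ⟨x, rfl⟩ := abMap_surjective p g m a
    rw [MonoidHom.mem_ker, hcomp]
    constructor
    · intro hx
      have := eq_one_of_toAb_eq_one hπ hs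
        ((QuotientGroup.mk' (π.ker.map (abMap p g m))).comp (abMap p g m))
        ((continuous_of_discreteTopology (f := QuotientGroup.mk' (π.ker.map (abMap p g m)))).comp
          (continuous_abMap p g m)) (fun r hr => by
            rw [MonoidHom.mem_ker, MonoidHom.comp_apply, QuotientGroup.mk'_apply,
              QuotientGroup.eq_one_iff]
            exact ⟨r, hr, rfl⟩) hx
      rwa [MonoidHom.comp_apply, QuotientGroup.mk'_apply, QuotientGroup.eq_one_iff] at this
    · rintro ⟨r, hr, hrx⟩
      rw [← hcomp, ← hrx, hcomp, toAb, MonoidHom.comp_apply, MonoidHom.mem_ker.1 hr, map_one]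
  have hsurj : Function.Surjective Ψ := fun c => by
    obtain ⟨x, rfl⟩ := toAb_surjective hs c
    exact ⟨_, hcomp x⟩
  rw [← hker]
  exact ⟨(QuotientGroup.quotientKerEquivOfSurjective Ψ hsurj).symm⟩

include hπ hs in
/-- Modulo `pⁿ⁺¹`-st powers every `pⁿ`-th power in the abelianization is trivial, so by
`pow_eq_one_of_forall_pow` all of them are trivial. -/
lemma pow_ab_eq_one_of_isFullAt {n : ℕ} (hfull : IsFullAt n π.ker)
    (c : TopologicalAbelianization G) : c ^ p ^ n = 1 := by
  have hP := isProP_ab hπ hs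
  have := hP.compact
  refine pow_eq_one_of_forall_pow hP (fun c => ?_) c
  obtain ⟨x, rfl⟩ := toAb_surjective hs c
  -- modulo `pⁿ⁺¹`-st powers the abelianization is a quotient of `(ℤ/pⁿ⁺¹)^g`
  let N := lowerPCentral p (TopologicalAbelianization G) (n + 1)
  have hNc : IsClosed (N : Set (TopologicalAbelianization G)) := isClosed_lowerPCentral _
  have hexp : ∀ y : TopologicalAbelianization G ⧸ N, y ^ p ^ (n + 1) = 1 := by
    intro y
    obtain ⟨y, rfl⟩ := QuotientGroup.mk_surjective y
    rw [← QuotientGroup.mk_pow, QuotientGroup.eq_one_iff]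
    simp only [N, lowerPCentral_eq_range_pow]
    exact ⟨y, rfl⟩
  obtain ⟨Ψ, hΨ⟩ := AbQuot.exists_lift (m := n + 1) hexp
    fun i => (toAb π (FreeProP.gen i) : TopologicalAbelianization G ⧸ N)
  have hcomp : ∀ x, Ψ (abMap p g (n + 1) x) = (toAb π x : TopologicalAbelianization G ⧸ N) := by
    intro x
    refine DFunLike.congr_fun (FreeProP.hom_ext (φ := Ψ.comp (abMap p g (n + 1)))
      (ψ := (QuotientGroup.mk' N).comp (toAb π))
      ((continuous_of_discreteTopology (f := Ψ)).comp (continuous_abMap p g _))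
      (continuous_quotient_mk'.comp (continuous_toAb hπ)) fun i => ?_) x
    rw [MonoidHom.comp_apply, abMap_gen, hΨ]
    rfl
  obtain ⟨r, hr, hrx⟩ := hfull (abMap p g (n + 1) x)
  have h1 := hcomp r
  rw [hrx, map_pow, hcomp, ← QuotientGroup.mk_pow, toAb, MonoidHom.comp_apply,
    MonoidHom.comp_apply, MonoidHom.mem_ker.1 hr, map_one, QuotientGroup.mk_one,
    QuotientGroup.eq_one_iff] at h1
  simp only [N, lowerPCentral_eq_range_pow] at h1
  obtain ⟨d, hd⟩ := h1
  exact ⟨d, hd.symm⟩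

include hπ hs in
lemma isFullAt_of_pow_ab_eq_one {n : ℕ} (h : ∀ c : TopologicalAbelianization G, c ^ p ^ n = 1) :
    IsFullAt n π.ker := by
  intro a
  obtain ⟨x, rfl⟩ := abMap_surjective p g (n + 1) a
  have hx : toAb π (x ^ p ^ n) = 1 := by rw [map_pow, h]
  have := eq_one_of_toAb_eq_one hπ hs
    ((QuotientGroup.mk' (π.ker.map (abMap p g (n + 1)))).comp (abMap p g (n + 1)))
    ((continuous_of_discreteTopology (f := QuotientGroup.mk' (π.ker.map (abMap p g _)))).comp
      (continuous_abMap p g _)) (fun r hr => by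
        rw [MonoidHom.mem_ker, MonoidHom.comp_apply, QuotientGroup.mk'_apply,
          QuotientGroup.eq_one_iff]
        exact ⟨r, hr, rfl⟩) hx
  rwa [MonoidHom.comp_apply, QuotientGroup.mk'_apply, QuotientGroup.eq_one_iff, map_pow] at this

include hπ hs in
lemma finite_ab_of_isFullAt {n : ℕ} (hfull : IsFullAt n π.ker) :
    Finite (TopologicalAbelianization G) := by
  obtain ⟨e⟩ := nonempty_ab_equiv hπ hs (pow_ab_eq_one_of_isFullAt hπ hs hfull)
  exact Finite.of_equiv _ e.symm.toEquiv

include hπ hs in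
lemma exists_isFullAt [Finite (TopologicalAbelianization G)] : ∃ n, IsFullAt n π.ker := by
  have hP := isProP_ab hπ hs
  have : DiscreteTopology (TopologicalAbelianization G) := inferInstance
  obtain ⟨n, hn⟩ := hP.index_eq ⊥ inferInstance (isOpen_discrete _)
  rw [Subgroup.index_bot] at hn
  exact ⟨n, isFullAt_of_pow_ab_eq_one hπ hs fun c => by rw [← hn, pow_card_eq_one']⟩

include hπ hs in
lemma finite_ab_iff : Finite (TopologicalAbelianization G) ↔ ∃ n, IsFullAt n π.ker :=
  ⟨fun _ => exists_isFullAt hπ hs, fun ⟨_, h⟩ => finite_ab_of_isFullAt hπ hs h⟩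

end Presentation

/-! ### The relation rank of a quotient with finite abelianization -/

/-- A subgroup `M` of `(ℤ/pⁿ⁺¹)^g` that contains the `pⁿ`-th powers contains the whole `p`-torsion,
so it has rank `g`. -/
lemma IsFullAt.card_quotient {n : ℕ} {M : Subgroup (AbQuot p g (n + 1))}
    (h : ∀ a : AbQuot p g (n + 1), a ^ p ^ n ∈ M) : Nat.card (QuotClass p M 1) = p ^ g := by
  have hker : Nat.card (powMonoidHom p : M →* M).ker = p ^ g := by
    rw [← card_ker_pow_abQuot (p := p) (g := g) (Nat.succ_pos n)]
    refine Nat.card_congr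
      { toFun := fun a => ⟨a.1.1, congrArg Subtype.val a.2⟩
        invFun := fun a => ⟨⟨a.1, ?_⟩, Subtype.ext a.2⟩
        left_inv := fun _ => rfl
        right_inv := fun _ => rfl }
    obtain ⟨b, hb⟩ := exists_pow_of_pow_eq_one a.2
    rw [hb]
    exact h b
  have h1 := card_range_pow M p
  have h2 : Nat.card (lowerPCentral p M 1) * Nat.card (QuotClass p M 1) = Nat.card M :=
    Subgroup.card_mul_index _
  have h3 : lowerPCentral p M 1 = (powMonoidHom p : M →* M).range := by
    simpa using lowerPCentral_eq_range_pow (p := p) (C := M) 1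
  rw [congrArg (fun K : Subgroup M => Nat.card K) h3, ← h1, hker] at h2
  exact Nat.eq_of_mul_eq_mul_left Nat.card_pos h2

/-- If the abelianization of `F_g / R` is finite, then the homomorphisms `R → ℤ/p` that factor
through the image of `R` in `(ℤ/pⁿ⁺¹)^g` form a space of dimension `g`, on which `σ` acts by `-1`.
-/
lemma exists_dual_injection {n : ℕ} {R : Subgroup (FreeProP p g)} [R.Normal]
    (hfull : IsFullAt n R) :
    ∃ (V : Type) (_ : AddCommGroup V) (_ : Module (ZMod p) V)
      (T : Module.Dual (ZMod p) V →ₗ[ZMod p] invHom p R),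
      Finite V ∧ Module.finrank (ZMod p) (Module.Dual (ZMod p) V) = g ∧
        Function.Injective T ∧ ∀ χ (r : R) (hr : freeSigma p g r.1 ∈ R),
          (T χ).1 ⟨freeSigma p g r.1, hr⟩ = -(T χ).1 r := by
  let M := R.map (abMap p g (n + 1))
  let V := Additive (QuotClass p M 1)
  have hcard : Nat.card (QuotClass p M 1) = p ^ g := IsFullAt.card_quotient hfull
  let _ : Module (ZMod p) V :=
    AddCommGroup.zmodModule (n := p) fun x => pow_quotClass_one (G := M) x
  have hfr : Module.finrank (ZMod p) V = g := by
    have h1 : Nat.card V = Nat.card (ZMod p) ^ Module.finrank (ZMod p) V :=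
      Module.natCard_eq_pow_finrank
    have h2 : Nat.card V = Nat.card (QuotClass p M 1) := rfl
    rw [h2, hcard, Nat.card_zmod] at h1
    exact (Nat.pow_right_injective (Fact.out : p.Prime).two_le h1).symm
  let q : R →* QuotClass p M 1 := (QuotientGroup.mk' _).comp ((abMap p g (n + 1)).subgroupMap R)
  have hq : Function.Surjective q :=
    (QuotientGroup.mk'_surjective _).comp (MonoidHom.subgroupMap_surjective _ R)
  have hqc : Continuous q := by
    refine (continuous_of_discreteTopology (f := QuotientGroup.mk' (lowerPCentral p M 1))).comp ?_
    exact ((continuous_abMap p g (n + 1)).comp continuous_subtype_val).subtype_mk _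
  have hconj : ∀ (x : FreeProP p g) (a : R),
      q ⟨x * a * x⁻¹, Subgroup.Normal.conj_mem inferInstance a.1 a.2 x⟩ = q a := by
    intro x a
    refine congrArg (QuotientGroup.mk' (lowerPCentral p M 1)) (Subtype.ext ?_)
    change abMap p g (n + 1) (x * a * x⁻¹) = abMap p g (n + 1) a
    rw [map_mul, map_mul, mul_right_comm, ← map_mul, mul_inv_cancel, map_one, one_mul]
  have hqσ : ∀ (r : R) (hr : freeSigma p g r.1 ∈ R), q ⟨freeSigma p g r.1, hr⟩ = q r⁻¹ := by
    intro r hr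
    refine congrArg (QuotientGroup.mk' (lowerPCentral p M 1)) (Subtype.ext ?_)
    change abMap p g (n + 1) (freeSigma p g r.1) = abMap p g (n + 1) (r.1)⁻¹
    rw [abMap_freeSigma, map_inv]
  let T : Module.Dual (ZMod p) V →ₗ[ZMod p] invHom p R :=
    { toFun := fun χ => ⟨fun r => χ (Additive.ofMul (q r)),
        (continuous_of_discreteTopology (f := fun a : QuotClass p M 1 =>
          χ (Additive.ofMul a))).comp hqc,
        fun a b => by simp only [map_mul, ofMul_mul, map_add],
        fun x a => congrArg (fun a => χ (Additive.ofMul a)) (hconj x a)⟩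
      map_add' := fun _ _ => rfl
      map_smul' := fun _ _ => rfl }
  refine ⟨V, inferInstance, inferInstance, T, inferInstanceAs (Finite (QuotClass p M 1)),
    ?_, ?_, ?_⟩
  · rw [Subspace.dual_finrank_eq, hfr]
  · intro χ χ' h
    refine LinearMap.ext fun v => ?_
    obtain ⟨r, hr⟩ := hq (Additive.toMul v)
    have := congrFun (congrArg Subtype.val h) r
    change χ (Additive.ofMul (q r)) = χ' (Additive.ofMul (q r)) at this
    rwa [hr] at this
  · intro χ r hr
    change χ (Additive.ofMul (q _)) = -χ (Additive.ofMul (q r))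
    rw [← map_neg, ← ofMul_inv, ← map_inv, hqσ]

lemma le_rank_invHom {n : ℕ} {R : Subgroup (FreeProP p g)} [R.Normal] (hfull : IsFullAt n R) :
    (g : Cardinal) ≤ Module.rank (ZMod p) (invHom p R) := by
  obtain ⟨V, _, _, T, _, hV, hT, -⟩ := exists_dual_injection hfull
  have := T.rank_le_of_injective hT
  rwa [← Module.finrank_eq_rank, hV] at this

/-- If `Hom(R, ℤ/p)^F` has dimension `g` and `F_g / R` has finite abelianization, then `σ` inverts
`R` modulo `[F, R] Rᵖ`: all of `Hom(R, ℤ/p)^F` comes from the image of `R` in `(ℤ/pⁿ⁺¹)^g`. -/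
lemma invHom_freeSigma {n : ℕ} {R : Subgroup (FreeProP p g)} [R.Normal] (hfull : IsFullAt n R)
    (hrank : Module.rank (ZMod p) (invHom p R) = g) {f : R → ZMod p} (hf : f ∈ invHom p R) (r : R)
    (hr : freeSigma p g r.1 ∈ R) : f ⟨freeSigma p g r.1, hr⟩ = -f r := by
  obtain ⟨V, _, _, T, _, hV, hT, hσ⟩ := exists_dual_injection hfull
  have hfr : Module.finrank (ZMod p) (invHom p R) = g := by
    rw [Module.finrank, hrank, Cardinal.toNat_natCast]
  have : Module.Finite (ZMod p) (invHom p R) := by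
    rw [← Module.rank_lt_aleph0_iff, hrank]
    exact Cardinal.natCast_lt_aleph0
  have hsurj : Function.Surjective T :=
    (LinearMap.injective_iff_surjective_of_finrank_eq_finrank (by rw [hV, hfr])).1 hT
  obtain ⟨χ, hχ⟩ := hsurj ⟨f, hf⟩
  have h1 : (T χ).1 = f := by rw [hχ]
  rw [← h1]
  exact hσ χ r hr

/-- An invariant homomorphism on `R` is determined by its values on normal generators. -/
lemma rank_invHom_le {ι : Type} [Fintype ι] {R : Subgroup (FreeProP p g)} [R.Normal]
    (r : ι → FreeProP p g)
    (hR : R = (Subgroup.normalClosure (Set.range r)).topologicalClosure) :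
    Module.rank (ZMod p) (invHom p R) ≤ Fintype.card ι := by
  have hmem : ∀ i, r i ∈ R := fun i => hR ▸
    Subgroup.le_topologicalClosure _ (Subgroup.subset_normalClosure ⟨i, rfl⟩)
  have hRc : IsClosed (R : Set (FreeProP p g)) := by
    rw [hR]
    exact Subgroup.isClosed_topologicalClosure _
  let ev : invHom p R →ₗ[ZMod p] (ι → ZMod p) :=
    { toFun := fun f i => f.1 ⟨r i, hmem i⟩
      map_add' := fun _ _ => rfl
      map_smul' := fun _ _ => rfl }
  have hinj : Function.Injective ev := by
    rw [injective_iff_map_eq_zero]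
    rintro ⟨f, hfc, hfm, hfi⟩ hf
    let φ : R →* Multiplicative (ZMod p) := MonoidHom.mk' (fun a => Multiplicative.ofAdd (f a))
      fun a b => by rw [hfm]; rfl
    let K := φ.ker.map R.subtype
    have hKn : K.Normal := by
      refine ⟨?_⟩
      rintro _ ⟨a, ha, rfl⟩ x
      refine ⟨⟨x * a * x⁻¹, Subgroup.Normal.conj_mem inferInstance a.1 a.2 x⟩, ?_, rfl⟩
      have : f a = 0 := ha
      change f _ = 0
      rw [hfi, this]
    have hKc : IsClosed (K : Set (FreeProP p g)) := by
      have h1 : IsClosed (f ⁻¹' {0}) := isClosed_singleton.preimage hfc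
      exact hRc.isClosedEmbedding_subtypeVal.isClosedMap _ h1
    have hle : R ≤ K := by
      conv_lhs => rw [hR]
      refine Subgroup.topologicalClosure_minimal _ (Subgroup.normalClosure_le_normal ?_) hKc
      rintro _ ⟨i, rfl⟩
      exact ⟨⟨r i, hmem i⟩, congrFun hf i, rfl⟩
    refine Subtype.ext (funext fun a => ?_)
    obtain ⟨b, hb, hba⟩ := hle a.2
    have : b = a := Subtype.ext hba
    rw [← this]
    exact hb
  have := ev.rank_le_of_injective hinj
  rwa [rank_fun'] at this

end AbQuot

/-! ### Isomorphisms of the quotients `Q_c` -/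

section QuotClassIso

variable {p : ℕ} {G G' : Type} [Group G] [TopologicalSpace G] [IsTopologicalGroup G]
  [Group G'] [TopologicalSpace G'] [IsTopologicalGroup G']

/-- The isomorphism `Q_c(G) ≅ Q_c(G')` induced by an isomorphism of topological groups. -/
def quotClassCongr (p : ℕ) (e : G ≃ₜ* G') (c : ℕ) : QuotClass p G c ≃* QuotClass p G' c :=
  QuotientGroup.congr _ _ e.toMulEquiv (by
    ext x
    constructor
    · rintro ⟨y, hy, rfl⟩
      exact map_mem_lowerPCentral (e : G →* G') e.continuous_toFun c hy
    · intro hx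
      refine ⟨e.symm x, ?_, e.apply_symm_apply x⟩
      exact map_mem_lowerPCentral (e.symm : G' →* G) e.symm.continuous_toFun c hx)

/-- If `G` is the quotient of `E` by `R`, then `Q_c(G)` is the quotient of `E` by `R P_c(E)`. -/
lemma ker_mk'_comp {E : Type} [Group E] [TopologicalSpace E] [IsTopologicalGroup E]
    [CompactSpace E] [T2Space G] (π : E →* G) (hπ : Continuous π) (hs : Function.Surjective π)
    (c : ℕ) :
    ((QuotientGroup.mk' (lowerPCentral p G c)).comp π).ker = π.ker ⊔ lowerPCentral p E c := by
  rw [← MonoidHom.comap_ker, QuotientGroup.ker_mk', ← map_lowerPCentral π hπ hs c,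
    Subgroup.comap_map_eq, sup_comm]

lemma nonempty_quotClass_equiv {E H : Type} [Group E] [TopologicalSpace E] [IsTopologicalGroup E]
    [CompactSpace E] [T2Space G] [Group H] (π : E →* G) (hπ : Continuous π)
    (hs : Function.Surjective π) (φ : E →* H) (hφ : Function.Surjective φ) {c : ℕ}
    (hker : φ.ker = π.ker ⊔ lowerPCentral p E c) : Nonempty (QuotClass p G c ≃* H) :=
  ⟨(QuotientGroup.quotientKerEquivOfSurjective _
      ((QuotientGroup.mk'_surjective (lowerPCentral p G c)).comp hs :
        Function.Surjective ((QuotientGroup.mk' (lowerPCentral p G c)).comp π))).symm.trans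
    ((QuotientGroup.quotientMulEquivOfEq ((ker_mk'_comp π hπ hs c).trans hker.symm)).trans
      (QuotientGroup.quotientKerEquivOfSurjective φ hφ))⟩

lemma mem_quotClassSet_mk {p c : ℕ} {P : Type} [Group P] (G : SchurSigmaGrp p) :
    SchurClass.mk G ∈ quotClassSet p c P ↔ Nonempty (QuotClass p G.carrier c ≃* P) := by
  constructor
  · rintro ⟨G', h, ⟨e⟩⟩
    obtain ⟨f⟩ := Quotient.exact h
    exact ⟨(quotClassCongr p f c).symm.trans e⟩
  · exact fun h => ⟨G, rfl, h⟩

end QuotClassIso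

/-! ### Groups presented by relations in `X` -/

section Relations

variable {p g : ℕ} [Fact p.Prime] (r : Fin g → Relator p g)

instance isClosed_relSubgroup : IsClosed (relSubgroup r : Set (FreeProP p g)) :=
  Subgroup.isClosed_topologicalClosure _

lemma mem_relSubgroup (i : Fin g) : (r i).1 ∈ relSubgroup r :=
  Subgroup.le_topologicalClosure _ (Subgroup.subset_normalClosure ⟨i, rfl⟩)

lemma relSubgroup_le {K : Subgroup (FreeProP p g)} [K.Normal]
    (hK : IsClosed (K : Set (FreeProP p g))) (h : ∀ i, (r i).1 ∈ K) : relSubgroup r ≤ K := by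
  refine Subgroup.topologicalClosure_minimal _ (Subgroup.normalClosure_le_normal ?_) hK
  rintro _ ⟨i, rfl⟩
  exact h i

lemma relSubgroup_le_frattini : relSubgroup r ≤ lowerPCentral p (FreeProP p g) 1 :=
  relSubgroup_le r (isClosed_lowerPCentral 1) fun i => (r i).2.1

lemma freeSigma_mem_relSubgroup {x : FreeProP p g} (hx : x ∈ relSubgroup r) :
    freeSigma p g x ∈ relSubgroup r := by
  have hn : ((relSubgroup r).comap (freeSigma p g)).Normal := inferInstance
  refine (relSubgroup_le r (K := (relSubgroup r).comap (freeSigma p g))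
    ((isClosed_relSubgroup r).preimage FreeProP.continuous_freeSigma) fun i => ?_) hx
  change freeSigma p g (r i).1 ∈ relSubgroup r
  rw [(r i).2.2]
  exact inv_mem (mem_relSubgroup r i)

lemma map_relSubgroup {H : Type} [Group H] [TopologicalSpace H] [DiscreteTopology H]
    (φ : FreeProP p g →* H) (hφ : Continuous φ) (hs : Function.Surjective φ) :
    (relSubgroup r).map φ = Subgroup.normalClosure (Set.range fun i => φ (r i).1) := by
  refine le_antisymm ?_ ?_
  · rw [Subgroup.map_le_iff_le_comap]
    exact relSubgroup_le r (K := (Subgroup.normalClosure (Set.range fun i => φ (r i).1)).comap φ)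
      ((isClosed_discrete (Subgroup.normalClosure (Set.range fun i => φ (r i).1) : Set H)).preimage
        hφ) fun i =>
      Subgroup.subset_normalClosure ⟨i, rfl⟩
  · have : ((relSubgroup r).map φ).Normal := Subgroup.Normal.map inferInstance φ hs
    refine Subgroup.normalClosure_le_normal ?_
    rintro _ ⟨i, rfl⟩
    exact ⟨_, mem_relSubgroup r i, rfl⟩

/-- The presented group `F_g / ⟨⟨r₁, …, r_g⟩⟩` inherits the GI-automorphism of `F_g`. -/
lemma exists_isGI_quotient {R : Subgroup (FreeProP p g)} [R.Normal]
    (hR : ∀ x ∈ R, freeSigma p g x ∈ R) :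
    ∃ σ : (FreeProP p g ⧸ R) ≃ₜ* (FreeProP p g ⧸ R), IsGI σ ∧
      ∀ x : FreeProP p g, σ (x : FreeProP p g ⧸ R) = freeSigma p g x := by
  have hmap : R.map ((FreeProP.sigmaEquiv p g).toMulEquiv : FreeProP p g →* FreeProP p g) = R := by
    ext x
    constructor
    · rintro ⟨y, hy, rfl⟩
      exact hR y hy
    · exact fun hx => ⟨freeSigma p g x, hR x hx, FreeProP.freeSigma_freeSigma x⟩
  let e := QuotientGroup.congr R R (FreeProP.sigmaEquiv p g).toMulEquiv hmap
  have hc : Continuous e := by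
    refine continuous_quot_lift _ ?_
    exact continuous_quotient_mk'.comp FreeProP.continuous_freeSigma
  have he : ∀ x : FreeProP p g, e (x : FreeProP p g ⧸ R) = freeSigma p g x := fun _ => rfl
  have hee : ∀ x, e (e x) = x := by
    intro x
    obtain ⟨y, rfl⟩ := QuotientGroup.mk_surjective x
    rw [he, he, FreeProP.freeSigma_freeSigma]
  have hsymm : ∀ x, e.symm x = e x := fun x => (MulEquiv.symm_apply_eq e).2 (hee x).symm
  let σ : (FreeProP p g ⧸ R) ≃ₜ* (FreeProP p g ⧸ R) :=
    { e with
      continuous_toFun := hc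
      continuous_invFun := by
        change Continuous e.symm
        exact (funext hsymm : (e.symm : _ → _) = e) ▸ hc }
  exact ⟨σ, (FreeProP.isGI_sigmaEquiv p g).of_surjective (QuotientGroup.mk' R)
    continuous_quotient_mk' (QuotientGroup.mk'_surjective R) σ fun _ => rfl, fun _ => rfl⟩

/-- `g` relations in `X` present a Schur `σ`-group as soon as the abelianization is finite: the
relation rank is at most `g` because there are `g` relations, and at least `g` because the
abelianization is finite. -/
lemma isSchurSigma_iff :
    IsSchurSigma p (FreeProP p g ⧸ relSubgroup r) ↔ ∃ n, IsFullAt n (relSubgroup r) := by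
  have hπ : Continuous (QuotientGroup.mk' (relSubgroup r)) := continuous_quotient_mk'
  have hs := QuotientGroup.mk'_surjective (relSubgroup r)
  have hk : (QuotientGroup.mk' (relSubgroup r)).ker = relSubgroup r := QuotientGroup.ker_mk' _
  constructor
  · intro h
    have h' := (finite_ab_iff hπ hs).1 h.finite_ab
    simpa only [hk] using h'
  · rintro ⟨n, hn⟩
    have hle : (QuotientGroup.mk' (relSubgroup r)).ker ≤ lowerPCentral p (FreeProP p g) 1 :=
      hk.trans_le (relSubgroup_le_frattini r)
    obtain ⟨σ, hσ, -⟩ := exists_isGI_quotient fun _ => freeSigma_mem_relSubgroup r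
    refine ⟨isProP_of_surjective hπ hs, (FreeProP.isTopFG p g).of_surjective _ hπ hs,
      (finite_ab_iff hπ hs).2 ⟨n, by rwa [hk]⟩, ?_, σ, hσ⟩
    have h1 : Module.rank (ZMod p) (invHom p (relSubgroup r)) = g := by
      refine le_antisymm ?_ (le_rank_invHom hn)
      simpa using rank_invHom_le (fun i => (r i).1) (R := relSubgroup r) rfl
    have h2 : Module.rank (ZMod p) (invHom p (QuotientGroup.mk' (relSubgroup r)).ker) = g := by
      have : ∀ (K : Subgroup (FreeProP p g)) [K.Normal], K = relSubgroup r →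
          Module.rank (ZMod p) (invHom p K) = g := by
        rintro K _ rfl
        exact h1
      exact this _ hk
    rw [rank_H1 hle hπ hs, rank_H2 hle hπ hs, h2]

/-- Finiteness of the abelianization is a condition on the images of the relations in the finite
groups `(ℤ/pⁿ⁺¹)^g`. -/
lemma isFullAt_relSubgroup_iff (n : ℕ) : IsFullAt n (relSubgroup r) ↔
    ∀ a : AbQuot p g (n + 1), a ^ p ^ n ∈
      Subgroup.closure (Set.range fun i => abMap p g (n + 1) (r i).1) := by
  have : (relSubgroup r).map (abMap p g (n + 1)) =
      Subgroup.closure (Set.range fun i => abMap p g (n + 1) (r i).1) := by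
    rw [map_relSubgroup r _ (continuous_abMap p g _) (abMap_surjective p g _)]
    refine le_antisymm (Subgroup.normalClosure_le_normal Subgroup.subset_closure)
      ((Subgroup.closure_le _).2 Subgroup.subset_normalClosure)
  unfold IsFullAt
  rw [this]

/-- `Q_c` of the presented group, computed in `Q_c(F_g)`. -/
lemma nonempty_quotClass_relSubgroup (c : ℕ) :
    Nonempty (QuotClass p (FreeProP p g ⧸ relSubgroup r) c ≃*
      QuotClass p (FreeProP p g) c ⧸
        Subgroup.normalClosure (Set.range fun i => (r i).level c)) := by
  have hq : Function.Surjective (QuotientGroup.mk' (lowerPCentral p (FreeProP p g) c)) :=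
    QuotientGroup.mk'_surjective _
  refine nonempty_quotClass_equiv (QuotientGroup.mk' (relSubgroup r)) continuous_quotient_mk'
    (QuotientGroup.mk'_surjective _)
    ((QuotientGroup.mk' (Subgroup.normalClosure (Set.range fun i => (r i).level c))).comp
      (QuotientGroup.mk' (lowerPCentral p (FreeProP p g) c)))
    ((QuotientGroup.mk'_surjective _).comp hq) ?_
  rw [← MonoidHom.comap_ker, QuotientGroup.ker_mk', QuotientGroup.ker_mk']
  have := map_relSubgroup r (QuotientGroup.mk' (lowerPCentral p (FreeProP p g) c))
    continuous_quotient_mk' hq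
  have h2 : Subgroup.normalClosure (Set.range fun i => (r i).level c) =
      (relSubgroup r).map (QuotientGroup.mk' (lowerPCentral p (FreeProP p g) c)) := this.symm
  rw [h2, Subgroup.comap_map_eq, QuotientGroup.ker_mk']

end Relations

/-! ### Measurability of the events -/

section Measurability

variable {p g : ℕ} [Fact p.Prime]

lemma mem_relEvent_univ (r : Fin g → Relator p g) :
    r ∈ relEvent p g Set.univ ↔ ∃ n, IsFullAt n (relSubgroup r) := by
  rw [← isSchurSigma_iff]
  exact ⟨fun ⟨h, _⟩ => h, fun h => ⟨h, trivial⟩⟩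

lemma measurableSet_isFullAt (n : ℕ) :
    MeasurableSet {r : Fin g → Relator p g | IsFullAt n (relSubgroup r)} := by
  simp only [isFullAt_relSubgroup_iff]
  exact measurableSet_image lowerPCentral_abQuot (abMap p g (n + 1)) (continuous_abMap p g _)
    {s | ∀ a : AbQuot p g (n + 1), a ^ p ^ n ∈ Subgroup.closure (Set.range s)}

lemma measurableSet_relEvent_univ : MeasurableSet (relEvent p g Set.univ) := by
  have : relEvent p g Set.univ = ⋃ n, {r | IsFullAt n (relSubgroup r)} := by
    ext r
    rw [mem_relEvent_univ, Set.mem_iUnion]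
    rfl
  rw [this]
  exact MeasurableSet.iUnion measurableSet_isFullAt

lemma relEvent_quotClassSet (c : ℕ) (P : Type) [Group P] :
    relEvent p g (quotClassSet p c P) = relEvent p g Set.univ ∩
      {r | Nonempty (QuotClass p (FreeProP p g ⧸ relSubgroup r) c ≃* P)} := by
  ext r
  constructor
  · rintro ⟨h, hr⟩
    exact ⟨⟨h, trivial⟩, (mem_quotClassSet_mk _).1 hr⟩
  · rintro ⟨⟨h, -⟩, hr⟩
    exact ⟨h, (mem_quotClassSet_mk _).2 hr⟩

lemma measurableSet_nonempty_quotClass (c : ℕ) (P : Type) [Group P] :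
    MeasurableSet {r : Fin g → Relator p g |
      Nonempty (QuotClass p (FreeProP p g ⧸ relSubgroup r) c ≃* P)} := by
  convert measurableSet_levels (p := p) (g := g) c
    {s | Nonempty (QuotClass p (FreeProP p g) c ⧸
      Subgroup.normalClosure (Set.range s) ≃* P)} using 1
  ext r
  obtain ⟨e⟩ := nonempty_quotClass_relSubgroup r c
  exact ⟨fun ⟨f⟩ => ⟨e.symm.trans f⟩, fun ⟨f⟩ => ⟨e.trans f⟩⟩

lemma relEvent_iUnion {ι : Type*} (A : ι → Set (SchurClass p)) :
    relEvent p g (⋃ n, A n) = ⋃ n, relEvent p g (A n) := by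
  ext r
  simp only [relEvent, Set.mem_iUnion, Set.mem_ofPred_eq]
  exact ⟨fun ⟨h, n, hn⟩ => ⟨n, h, hn⟩, fun ⟨n, h, hn⟩ => ⟨h, n, hn⟩⟩

lemma relEvent_empty : relEvent p g (∅ : Set (SchurClass p)) = ∅ := by
  ext r
  simp [relEvent]

lemma relEvent_compl (A : Set (SchurClass p)) :
    relEvent p g Aᶜ = relEvent p g Set.univ \ relEvent p g A := by
  ext r
  constructor
  · rintro ⟨h, hr⟩
    exact ⟨⟨h, trivial⟩, fun ⟨_, hr'⟩ => hr hr'⟩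
  · rintro ⟨⟨h, -⟩, hr⟩
    exact ⟨h, fun hr' => hr ⟨h, hr'⟩⟩

lemma disjoint_relEvent {A B : Set (SchurClass p)} (h : Disjoint A B) :
    Disjoint (relEvent p g A) (relEvent p g B) := by
  rw [Set.disjoint_left] at h ⊢
  rintro r ⟨_, ha⟩ ⟨_, hb⟩
  exact h ha hb

/-- Whether `F_g / ⟨⟨r₁, …, r_g⟩⟩` is a Schur `σ`-group with a given `Q_c` is decided by the images
of the relations in finite quotients of `F_g`. -/
theorem measurableSet_relEvent {A : Set (SchurClass p)} (hA : MeasurableSet A) :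
    MeasurableSet (relEvent p g A) := by
  induction A, hA using MeasurableSpace.generateFrom_induction with
  | hC A hA =>
    obtain ⟨c, P, _, _, _, rfl⟩ := hA
    rw [relEvent_quotClassSet]
    exact measurableSet_relEvent_univ.inter (measurableSet_nonempty_quotClass c P)
  | empty => rw [relEvent_empty]; exact MeasurableSet.empty
  | compl A _ hA => rw [relEvent_compl]; exact measurableSet_relEvent_univ.diff hA
  | iUnion A _ hA => rw [relEvent_iUnion]; exact MeasurableSet.iUnion hA

end Measurability

/-! ### Counting lemmas -/

section Counting

/-- Double counting for a relation between two finite sets. -/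
lemma ncard_mul_eq_ncard_mul {α β : Type*} [Finite α] [Finite β] (s : Set α) (t : Set β)
    (R : α → β → Prop) (m n : ℕ) (hm : ∀ a ∈ s, {b | b ∈ t ∧ R a b}.ncard = m)
    (hn : ∀ b ∈ t, {a | a ∈ s ∧ R a b}.ncard = n) : s.ncard * m = t.ncard * n := by
  classical
  have := Fintype.ofFinite α
  have := Fintype.ofFinite β
  rw [Set.ncard_eq_toFinset_card', Set.ncard_eq_toFinset_card']
  refine Finset.card_mul_eq_card_mul R (fun a ha => ?_) fun b hb => ?_
  · rw [← hm a (by simpa using ha), Set.ncard_eq_toFinset_card']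
    congr 1
    ext b
    simp [Finset.bipartiteAbove]
  · rw [← hn b (by simpa using hb), Set.ncard_eq_toFinset_card']
    congr 1
    ext b
    simp [Finset.bipartiteBelow]

instance finite_monoidHom {G H : Type} [Group G] [Group H] [Finite G] [Finite H] :
    Finite (G →* H) := DFunLike.finite _

lemma exists_aut_of_ker_eq {G H : Type} [Group G] [Group H] {φ ψ : G →* H}
    (hφ : Function.Surjective φ) (hψ : Function.Surjective ψ) (h : φ.ker = ψ.ker) :
    ∃ γ : MulAut H, ∀ x, γ (φ x) = ψ x := by
  refine ⟨(QuotientGroup.quotientKerEquivOfSurjective φ hφ).symm.trans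
    ((QuotientGroup.quotientMulEquivOfEq h).trans
      (QuotientGroup.quotientKerEquivOfSurjective ψ hψ)), fun x => ?_⟩
  have : (QuotientGroup.quotientKerEquivOfSurjective φ hφ).symm (φ x) = (x : G ⧸ φ.ker) := by
    rw [MulEquiv.symm_apply_eq]
    rfl
  change QuotientGroup.quotientKerEquivOfSurjective ψ hψ (QuotientGroup.quotientMulEquivOfEq h
    ((QuotientGroup.quotientKerEquivOfSurjective φ hφ).symm (φ x))) = ψ x
  rw [this]
  rfl

lemma card_quotient_ker {G H : Type} [Group G] [Group H] {φ : G →* H}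
    (hφ : Function.Surjective φ) : Nat.card (G ⧸ φ.ker) = Nat.card H :=
  Nat.card_congr (QuotientGroup.quotientKerEquivOfSurjective φ hφ).toEquiv

/-- A surjection between groups of the same rank has its kernel in the Frattini subgroup. -/
lemma ker_le_lowerPCentral_one {p : ℕ} {E G : Type} [Group E] [TopologicalSpace E]
    [IsTopologicalGroup E] [CompactSpace E] [Group G] [TopologicalSpace G] [IsTopologicalGroup G]
    [T2Space G] [Finite (QuotClass p E 1)] (π : E →* G) (hπ : Continuous π)
    (hs : Function.Surjective π) (h : Nat.card (QuotClass p E 1) ≤ Nat.card (QuotClass p G 1)) :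
    π.ker ≤ lowerPCentral p E 1 := by
  have h1 := card_quotient_ker (φ := (QuotientGroup.mk' (lowerPCentral p G 1)).comp π)
    ((QuotientGroup.mk'_surjective (lowerPCentral p G 1)).comp hs :
      Function.Surjective ((QuotientGroup.mk' (lowerPCentral p G 1)).comp π))
  rw [ker_mk'_comp π hπ hs 1, ← Subgroup.index_eq_card] at h1
  rw [← h1, ← Subgroup.index_eq_card] at h
  have h2 := Subgroup.relIndex_mul_index
    (le_sup_right : lowerPCentral p E 1 ≤ π.ker ⊔ lowerPCentral p E 1)
  have h3 : 0 < (lowerPCentral p E 1).index := by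
    rw [Subgroup.index_eq_card]
    exact Nat.card_pos
  have h4 : (lowerPCentral p E 1).relIndex (π.ker ⊔ lowerPCentral p E 1) = 1 := by
    refine le_antisymm ?_ (Nat.pos_of_ne_zero fun h0 => ?_)
    · by_contra! hlt
      nlinarith
    · rw [h0, zero_mul] at h2
      omega
  exact le_sup_left.trans (Subgroup.relIndex_eq_one.1 h4)

lemma ker_equiv_comp {G H K : Type} [Group G] [Group H] [Group K] (e : H ≃* K) (φ : G →* H) :
    (e.toMonoidHom.comp φ).ker = φ.ker := by
  ext x
  simp [MonoidHom.mem_ker]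

lemma genCount_eq_zero {p g d : ℕ} (h : g < d) : genCount p g d = 0 :=
  Finset.prod_eq_zero (Finset.mem_range.2 h) (Nat.sub_self _)

lemma genCount_pos {p g d : ℕ} (hp : 1 < p) (h : d ≤ g) : 0 < genCount p g d :=
  Finset.prod_pos fun _ hi => Nat.sub_pos_of_lt
    (Nat.pow_lt_pow_right hp ((Finset.mem_range.1 hi).trans_le h))

lemma closure_range_coe {G : Type} [Group G] (K : Subgroup G) {g : ℕ} (v : Fin g → K) :
    Subgroup.closure (Set.range fun i => (v i : G)) =
      (Subgroup.closure (Set.range v)).map K.subtype := by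
  rw [MonoidHom.map_closure, ← Set.range_comp]
  rfl

lemma ncard_closure_range_eq {G : Type} [Group G] (K : Subgroup G) (g : ℕ) :
    {s : Fin g → G | Subgroup.closure (Set.range s) = K}.ncard =
      {v : Fin g → K | Subgroup.closure (Set.range v) = ⊤}.ncard := by
  symm
  refine Set.ncard_congr (fun v _ i => (v i : G)) (fun v hv => ?_) (fun v v' _ _ h => ?_)
    fun s hs => ?_
  · have hv' : Subgroup.closure (Set.range v) = ⊤ := hv
    rw [Set.mem_ofPred_eq, closure_range_coe, hv', ← MonoidHom.range_eq_map,
      Subgroup.range_subtype]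
  · exact funext fun i => Subtype.ext (congrFun h i)
  · have hs' : Subgroup.closure (Set.range s) = K := hs
    have hmem : ∀ i, s i ∈ K := fun i => hs'.le (Subgroup.subset_closure ⟨i, rfl⟩)
    refine ⟨fun i => ⟨s i, hmem i⟩, ?_, rfl⟩
    refine Subgroup.map_injective K.subtype_injective ?_
    rw [← closure_range_coe, ← MonoidHom.range_eq_map, Subgroup.range_subtype]
    exact hs'

end Counting

/-! ### Counting presentations of finite abelian `p`-groups -/

section AbelianCount

variable {p g : ℕ} [Fact p.Prime]

section Comm

variable {A : Type} [CommGroup A] [Finite A] [TopologicalSpace A] [DiscreteTopology A]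

lemma isInvolutive_inv : IsInvolutive p (invMonoidHom : A →* A) where
  invol x := inv_inv x
  inv_mod x := by simp

omit [Finite A] [Fact p.Prime] in
lemma invFrattini_inv : invFrattini p (invMonoidHom : A →* A) = lowerPCentral p A 1 := by
  ext x
  simp [invFrattini]

/-- The number of generating tuples of a finite abelian `p`-group, where inversion is a
generator-inverting involution. -/
lemma ncard_generators (hp : Odd p) (hA : IsPGroup p A) {d : ℕ}
    (hd : Nat.card (QuotClass p A 1) = p ^ d) (g : ℕ) :
    {v : Fin g → A | Subgroup.closure (Set.range v) = ⊤}.ncard =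
      genCount p g d * Nat.card (lowerPCentral p A 1) ^ g := by
  have := ncard_inverted_generators hA (odd_card_of_isPGroup hp hA) isInvolutive_inv hd g
  rw [invFrattini_inv, ← Nat.card_coe_set_eq (lowerPCentral p A 1 : Set A)] at this
  refine Eq.trans (congrArg Set.ncard (Set.ext fun v => ?_)) this
  simp

lemma exists_card_quotClass_one (hA : IsPGroup p A) :
    ∃ d, Nat.card (QuotClass p A 1) = p ^ d :=
  (IsPGroup.iff_card.1 (hA.to_quotient _))

lemma card_quotClass_one (hp : Odd p) (hA : IsPGroup p A) :
    Nat.card (QuotClass p A 1) = p ^ Group.rank A := by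
  classical
  obtain ⟨d, hd⟩ := exists_card_quotClass_one hA
  rw [hd]
  congr 1
  refine le_antisymm ?_ ?_
  · obtain ⟨S, hS, hcl⟩ := Group.rank_spec A
    by_contra! hlt
    have h0 := ncard_generators hp hA hd (Group.rank A)
    rw [genCount_eq_zero hlt, zero_mul, Set.ncard_eq_zero] at h0
    let e := S.equivFinOfCardEq hS
    have : (fun i => (e.symm i : A)) ∈ (∅ : Set (Fin (Group.rank A) → A)) := by
      rw [← h0]
      change Subgroup.closure (Set.range fun i => (e.symm i : A)) = ⊤
      rw [← hcl]
      congr 1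
      ext x
      constructor
      · rintro ⟨i, rfl⟩
        exact (e.symm i).2
      · exact fun hx => ⟨e ⟨x, hx⟩, by simp⟩
    exact this
  · have h0 := ncard_generators hp hA hd d
    have hpos : 0 < genCount p d d * Nat.card (lowerPCentral p A 1) ^ d :=
      Nat.mul_pos (genCount_pos (Fact.out : p.Prime).one_lt le_rfl) (pow_pos Nat.card_pos _)
    rw [← h0] at hpos
    obtain ⟨v, hv⟩ := (Set.ncard_pos).1 hpos
    have hv' : Subgroup.closure (Set.range v) = ⊤ := hv
    refine (Group.rank_le (S := Finset.univ.image v) (by simpa using hv')).trans ?_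
    exact Finset.card_image_le.trans (by simp)

omit [Finite A] [Fact p.Prime] in
lemma card_lowerPCentral_one_mul :
    Nat.card (lowerPCentral p A 1) * Nat.card (QuotClass p A 1) = Nat.card A := by
  rw [mul_comm]
  exact (Subgroup.card_eq_card_quotient_mul_card_subgroup _).symm

/-- The surjections `(ℤ/pᵐ)^g → A` correspond to the generating `g`-tuples of `A`. -/
lemma ncard_surjective {m : ℕ} (hm : ∀ a : A, a ^ p ^ m = 1) :
    {ψ : AbQuot p g m →* A | Function.Surjective ψ}.ncard =
      {v : Fin g → A | Subgroup.closure (Set.range v) = ⊤}.ncard := by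
  have hrange : ∀ ψ : AbQuot p g m →* A,
      Subgroup.closure (Set.range fun i => ψ (AbQuot.gen i)) = ψ.range := by
    intro ψ
    rw [MonoidHom.range_eq_map, ← AbQuot.closure_gen, MonoidHom.map_closure, ← Set.range_comp]
    rfl
  refine Set.ncard_congr (fun ψ _ i => ψ (AbQuot.gen i)) (fun ψ hψ => ?_) (fun ψ ψ' _ _ h => ?_)
    fun v hv => ?_
  · exact (hrange ψ).trans (MonoidHom.range_eq_top.2 hψ)
  · refine MonoidHom.eq_of_eqOn_dense AbQuot.closure_gen ?_
    rintro _ ⟨i, rfl⟩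
    exact congrFun h i
  · obtain ⟨ψ, hψ⟩ := AbQuot.exists_lift hm v
    refine ⟨ψ, ?_, funext hψ⟩
    rw [Set.mem_ofPred_eq, ← MonoidHom.range_eq_top, ← hrange]
    simp only [hψ]
    exact hv

end Comm

variable {A : Type} [CommGroup A] [Finite A] [TopologicalSpace A] [DiscreteTopology A] {n : ℕ}

omit [Finite A] in
lemma ker_le_of_rank (hrank : Nat.card (QuotClass p A 1) = p ^ g)
    {ψ : AbQuot p g (n + 1) →* A} (hψ : Function.Surjective ψ) :
    ψ.ker ≤ lowerPCentral p (AbQuot p g (n + 1)) 1 := by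
  refine ker_le_lowerPCentral_one ψ continuous_of_discreteTopology hψ ?_
  rw [hrank]
  have h := card_lowerPCentral_one_mul (p := p) (A := AbQuot p g (n + 1))
  rw [card_lowerPCentral_one_abQuot, card_abQuot] at h
  refine (Nat.eq_of_mul_eq_mul_left (pow_pos (Fact.out : p.Prime).pos (n * g)) (h.trans ?_)).le
  ring

/-- The number of `g`-tuples of relations in the Frattini subgroup of `(ℤ/pⁿ⁺¹)^g` that present the
group `A` of rank `g`, weighted by the automorphisms of `A`.  The pairs of such a tuple `s` and a
surjection `ψ` onto `A` with kernel generated by `s` are counted in two ways: `s` admits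
`|Aut A|` surjections, and the kernel of `ψ`, again of rank `g`, has
`genCount p g g * |P₁(ker ψ)| ^ g` generating tuples. -/
lemma ncard_presentations (hp : Odd p) (hA : IsPGroup p A)
    (hrank : Nat.card (QuotClass p A 1) = p ^ g) (hn : ∀ a : A, a ^ p ^ n = 1) :
    {s : Fin g → AbQuot p g (n + 1) | Nonempty (AbQuot p g (n + 1) ⧸
        Subgroup.closure (Set.range s) ≃* A) ∧
        ∀ i, s i ∈ lowerPCentral p (AbQuot p g (n + 1)) 1}.ncard *
      Nat.card (MulAut A) * (p ^ g) ^ g = genCount p g g ^ 2 * (p ^ (n * g)) ^ g := by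
  have hn1 : ∀ a : A, a ^ p ^ (n + 1) = 1 := fun a => by rw [pow_succ, pow_mul, hn, one_pow]
  have hMcard : ∀ ψ : AbQuot p g (n + 1) →* A, Function.Surjective ψ →
      Nat.card (lowerPCentral p A 1) * Nat.card (lowerPCentral p ψ.ker 1) * p ^ g =
        p ^ (n * g) ∧ Nat.card (QuotClass p ψ.ker 1) = p ^ g := by
    intro ψ hψ
    have hfull : ∀ a : AbQuot p g (n + 1), a ^ p ^ n ∈ ψ.ker := fun a => by
      rw [MonoidHom.mem_ker, map_pow, hn]
    have h1 := IsFullAt.card_quotient hfull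
    have h2 := card_lowerPCentral_one_mul (p := p) (A := ψ.ker)
    have h3 := card_lowerPCentral_one_mul (p := p) (A := A)
    have h4 := Subgroup.card_eq_card_quotient_mul_card_subgroup ψ.ker
    have h5 : Nat.card (AbQuot p g (n + 1) ⧸ ψ.ker) = Nat.card A :=
      Nat.card_congr (QuotientGroup.quotientKerEquivOfSurjective ψ hψ).toEquiv
    refine ⟨?_, h1⟩
    rw [h5, ← h2, ← h3, h1, hrank, card_abQuot, add_mul, one_mul, pow_add] at h4
    refine Nat.eq_of_mul_eq_mul_right (pow_pos (Fact.out : p.Prime).pos g) ?_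
    rw [h4]
    ring
  set N := Nat.card (lowerPCentral p A 1) with hN
  have hNpos : 0 < N := Nat.card_pos
  have key := ncard_mul_eq_ncard_mul
    {s : Fin g → AbQuot p g (n + 1) | Nonempty (AbQuot p g (n + 1) ⧸
        Subgroup.closure (Set.range s) ≃* A) ∧
        ∀ i, s i ∈ lowerPCentral p (AbQuot p g (n + 1)) 1}
    {ψ : AbQuot p g (n + 1) →* A | Function.Surjective ψ}
    (fun s ψ => ψ.ker = Subgroup.closure (Set.range s)) (Nat.card (MulAut A))
    (genCount p g g * (p ^ (n * g) / (N * p ^ g)) ^ g) ?_ ?_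
  · rw [key, ncard_surjective hn1, ncard_generators hp hA hrank, ← hN]
    have hdvd : N * p ^ g ∣ p ^ (n * g) := by
      by_cases h : ∃ ψ : AbQuot p g (n + 1) →* A, Function.Surjective ψ
      · obtain ⟨ψ, hψ⟩ := h
        rw [← (hMcard ψ hψ).1]
        exact ⟨Nat.card (lowerPCentral p ψ.ker 1), by ring⟩
      · exfalso
        have h0 := ncard_surjective (g := g) hn1
        rw [ncard_generators hp hA hrank] at h0
        have hpos : 0 < genCount p g g * Nat.card (lowerPCentral p A 1) ^ g :=
          Nat.mul_pos (genCount_pos (Fact.out : p.Prime).one_lt le_rfl) (pow_pos Nat.card_pos _)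
        rw [← h0] at hpos
        exact h ((Set.ncard_pos).1 hpos)
    obtain ⟨k, hk⟩ := hdvd
    rw [hk, Nat.mul_div_cancel_left _ (Nat.mul_pos hNpos (pow_pos (Fact.out : p.Prime).pos g))]
    ring
  · rintro s ⟨⟨e⟩, -⟩
    let ψ₀ : AbQuot p g (n + 1) →* A :=
      e.toMonoidHom.comp (QuotientGroup.mk' (Subgroup.closure (Set.range s)))
    have hψ₀ : Function.Surjective ψ₀ := e.surjective.comp (QuotientGroup.mk'_surjective _)
    have hker : ψ₀.ker = Subgroup.closure (Set.range s) := by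
      rw [ker_equiv_comp, QuotientGroup.ker_mk']
    rw [← Set.ncard_univ]
    symm
    refine Set.ncard_congr (fun γ _ => γ.toMonoidHom.comp ψ₀) (fun γ _ => ⟨?_, ?_⟩)
      (fun γ γ' _ _ h => ?_) fun ψ hψ => ?_
    · exact γ.surjective.comp hψ₀
    · rw [ker_equiv_comp, hker]
    · refine MulEquiv.ext fun a => ?_
      obtain ⟨b, rfl⟩ := hψ₀ a
      exact DFunLike.congr_fun h b
    · obtain ⟨γ, hγ⟩ := exists_aut_of_ker_eq hψ₀ hψ.1 (hker.trans hψ.2.symm)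
      exact ⟨γ, trivial, MonoidHom.ext hγ⟩
  · intro ψ hψ
    obtain ⟨h1, h2⟩ := hMcard ψ hψ
    have hle := ker_le_of_rank hrank hψ
    have hk : p ^ (n * g) / (N * p ^ g) = Nat.card (lowerPCentral p ψ.ker 1) := by
      rw [← h1, mul_right_comm]
      exact Nat.mul_div_cancel_left _ (Nat.mul_pos hNpos (pow_pos (Fact.out : p.Prime).pos g))
    rw [hk, ← ncard_generators hp (isPGroup_abQuot.to_subgroup _) h2, ← ncard_closure_range_eq]
    congr 1
    ext s
    refine ⟨fun h => h.2.symm, fun h => ⟨⟨⟨?_⟩, fun i => hle ?_⟩, Eq.symm h⟩⟩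
    · exact (QuotientGroup.quotientMulEquivOfEq h).trans
        (QuotientGroup.quotientKerEquivOfSurjective ψ hψ)
    · have h' : Subgroup.closure (Set.range s) = ψ.ker := h
      exact h'.le (Subgroup.subset_closure ⟨i, rfl⟩)

end AbelianCount

/-! ### Finiteness of the abelianization of the random group -/

section FiniteAbelianization

variable {p g : ℕ} [Fact p.Prime]

lemma card_range_mul_card_ker {G H : Type} [Group G] [Group H] (f : G →* H) :
    Nat.card f.range * Nat.card f.ker = Nat.card G := by
  rw [Subgroup.card_eq_card_quotient_mul_card_subgroup f.ker]
  congr 1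
  exact (Nat.card_congr (QuotientGroup.quotientKerEquivRange f).toEquiv).symm

lemma card_comap {G H : Type} [Group G] [Group H] (f : G →* H) (K : Subgroup H) :
    Nat.card (K.comap f) = Nat.card (f.range ⊓ K : Subgroup H) * Nat.card f.ker := by
  rw [← card_range_mul_card_ker (f.comp (K.comap f).subtype)]
  congr 1
  · rw [MonoidHom.range_eq_map, ← Subgroup.map_map, ← MonoidHom.range_eq_map,
      Subgroup.range_subtype, Subgroup.map_comap_eq]
  · have : (f.comp (K.comap f).subtype).ker = f.ker.subgroupOf (K.comap f) := rfl
    rw [this]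
    refine Nat.card_congr (Subgroup.subgroupOfEquivOfLe fun x hx => ?_).toEquiv
    rw [Subgroup.mem_comap, (MonoidHom.mem_ker).1 hx]
    exact one_mem K

/-- If `g` elements of `(ℤ/pⁿ⁺¹)^g` generate a subgroup that does not contain all `pⁿ`-th powers,
then they satisfy a relation in which some exponent is `1`: otherwise all relations would be `p`-th
powers, and the subgroup generated would contain the `p`-torsion of the whole group. -/
lemma exists_relation {n : ℕ} (s : Fin g → AbQuot p g (n + 1))
    (hs : ¬ ∀ a : AbQuot p g (n + 1), a ^ p ^ n ∈ Subgroup.closure (Set.range s)) :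
    ∃ (i₀ : Fin g) (c : Fin g → Fin (p ^ (n + 1))), (c i₀ : ℕ) = 1 ∧
      ∏ i, s i ^ (c i : ℕ) = 1 := by
  by_contra! hno
  refine hs fun a => ?_
  obtain ⟨Θ, hΘ⟩ := AbQuot.exists_lift (pow_abQuot (p := p) (g := g) (m := n + 1)) s
  have h1p : 1 < p ^ (n + 1) := Nat.one_lt_pow (by simp) (Fact.out : p.Prime).one_lt
  have : Fact (1 < p ^ (n + 1)) := ⟨h1p⟩
  have : NeZero (p ^ (n + 1)) := ⟨by omega⟩
  have hΘprod : ∀ b, Θ b = ∏ i, s i ^ (Multiplicative.toAdd (b i)).val := by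
    intro b
    conv_lhs => rw [AbQuot.eq_prod b]
    simp only [map_prod, map_pow, hΘ]
  set P : AbQuot p g (n + 1) →* AbQuot p g (n + 1) := powMonoidHom p with hP
  have hker : Θ.ker ≤ P.range := by
    intro b hb
    by_cases hdiv : ∀ i, p ∣ (Multiplicative.toAdd (b i)).val
    · choose k hk using hdiv
      refine ⟨∏ i, AbQuot.gen i ^ k i, ?_⟩
      rw [AbQuot.eq_prod b]
      simp only [hP, powMonoidHom_apply, ← Finset.prod_pow, ← pow_mul, hk, mul_comm]
    · push Not at hdiv
      obtain ⟨i₀, hi₀⟩ := hdiv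
      exfalso
      have hunit : IsUnit (Multiplicative.toAdd (b i₀)) := by
        rw [← ZMod.natCast_zmod_val (Multiplicative.toAdd (b i₀)), ZMod.isUnit_iff_coprime]
        exact (((Fact.out : p.Prime).coprime_iff_not_dvd.2 hi₀).pow_left (n + 1)).symm
      obtain ⟨u, hu⟩ := hunit.exists_left_inv
      set b' := b ^ u.val with hb'
      have hb'1 : Multiplicative.toAdd (b' i₀) = 1 := by
        rw [hb', Pi.pow_apply, toAdd_pow, nsmul_eq_mul, ZMod.natCast_zmod_val, hu]
      refine hno i₀ (fun i => ⟨(Multiplicative.toAdd (b' i)).val, ZMod.val_lt _⟩) ?_ ?_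
      · simp only [hb'1, ZMod.val_one]
      · have : Θ b' = 1 := by rw [hb', map_pow, (MonoidHom.mem_ker).1 hb, one_pow]
        rw [hΘprod] at this
        exact this
  -- compare `|ker (Θ P)|` with `|ker (P Θ)|`
  have hcomm : Θ.comp P = P.comp Θ := by
    refine MonoidHom.ext fun b => ?_
    simp [hP]
  have h1 : (Θ.comp P).ker = Θ.ker.comap P := (MonoidHom.comap_ker _ _).symm
  have h2 : (P.comp Θ).ker = P.ker.comap Θ := (MonoidHom.comap_ker _ _).symm
  have h3 := card_comap P Θ.ker
  have h4 := card_comap Θ P.ker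
  rw [← h1, hcomm, h2, h4, inf_eq_right.2 hker, mul_comm] at h3
  have h5 : Nat.card (Θ.range ⊓ P.ker : Subgroup _) = Nat.card P.ker :=
    Nat.eq_of_mul_eq_mul_left Nat.card_pos h3
  have h6 : Θ.range ⊓ P.ker = P.ker := Subgroup.eq_of_le_of_card_ge inf_le_right h5.ge
  have h7 : a ^ p ^ n ∈ P.ker := by
    rw [MonoidHom.mem_ker, hP, powMonoidHom_apply, ← pow_mul, ← pow_succ, pow_abQuot]
  have h8 : Θ.range = Subgroup.closure (Set.range s) := by
    rw [MonoidHom.range_eq_map, ← AbQuot.closure_gen, MonoidHom.map_closure, ← Set.range_comp]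
    congr 2
    exact funext hΘ
  rw [← h8]
  rw [← h6] at h7
  exact h7.1

/-- A bound for the number of such tuples: in the relation of `exists_relation`, the element with
exponent `1` is determined by the other elements and exponents. -/
lemma ncard_not_full (g n : ℕ) :
    {s : Fin (g + 1) → AbQuot p (g + 1) (n + 1) |
      (¬ ∀ a : AbQuot p (g + 1) (n + 1), a ^ p ^ n ∈ Subgroup.closure (Set.range s)) ∧
        ∀ i, s i ∈ lowerPCentral p (AbQuot p (g + 1) (n + 1)) 1}.ncard ≤
      (g + 1) * ((p ^ (n + 1)) ^ g * (p ^ (n * (g + 1))) ^ g) := by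
  let F : Fin (g + 1) × (Fin g → Fin (p ^ (n + 1))) ×
      (Fin g → lowerPCentral p (AbQuot p (g + 1) (n + 1)) 1) →
      (Fin (g + 1) → AbQuot p (g + 1) (n + 1)) := fun x =>
    x.1.insertNth (∏ j, (x.2.2 j : AbQuot p (g + 1) (n + 1)) ^ (x.2.1 j : ℕ))⁻¹
      fun j => (x.2.2 j : AbQuot p (g + 1) (n + 1))
  have hsub : {s : Fin (g + 1) → AbQuot p (g + 1) (n + 1) |
      (¬ ∀ a : AbQuot p (g + 1) (n + 1), a ^ p ^ n ∈ Subgroup.closure (Set.range s)) ∧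
        ∀ i, s i ∈ lowerPCentral p (AbQuot p (g + 1) (n + 1)) 1} ⊆ F '' Set.univ := by
    rintro s ⟨hs, hmem⟩
    obtain ⟨i₀, c, hc, hprod⟩ := exists_relation s hs
    refine ⟨⟨i₀, fun j => c (i₀.succAbove j), fun j => ⟨s (i₀.succAbove j), hmem _⟩⟩, trivial, ?_⟩
    rw [Fin.prod_univ_succAbove _ i₀, hc, pow_one] at hprod
    refine (Fin.insertNth_eq_iff).2 ⟨(eq_inv_of_mul_eq_one_left hprod).symm, rfl⟩
  refine (Set.ncard_le_ncard hsub (Set.toFinite _)).trans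
    ((Set.ncard_image_le (Set.toFinite _)).trans ?_)
  rw [Set.ncard_univ, Nat.card_prod, Nat.card_prod, Nat.card_fun, Nat.card_fun,
    card_lowerPCentral_one_abQuot]
  simp

variable {n : ℕ}

/-- The images of the random relations in `(ℤ/pⁿ⁺¹)^g` are independent and uniformly distributed in
the Frattini subgroup, because `σ` acts on `(ℤ/pⁿ⁺¹)^g` by inversion. -/
lemma relLaw_abMap (hp : Odd p) (S : Set (Fin g → AbQuot p g (n + 1))) :
    relLaw p g {r | (fun i => abMap p g (n + 1) (r i).1) ∈ S} =
      ({s | s ∈ S ∧ ∀ i, s i ∈ lowerPCentral p (AbQuot p g (n + 1)) 1}.ncard : ℝ≥0∞) /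
        ((p ^ (n * g) : ℕ) : ℝ≥0∞) ^ g := by
  rw [relLaw_image hp lowerPCentral_abQuot (abMap p g (n + 1)) (continuous_abMap p g _)
    (abMap_surjective p g _) (τ := invMonoidHom) abMap_freeSigma, invFrattini_inv,
    ← card_lowerPCentral_one_abQuot (p := p), ← Nat.card_coe_set_eq
      (lowerPCentral p (AbQuot p g (n + 1)) 1 : Set (AbQuot p g (n + 1)))]
  rfl

lemma relLaw_not_full (hp : Odd p) (n : ℕ) :
    relLaw p (g + 1) {r | ¬ IsFullAt n (relSubgroup r)} ≤
      ((g + 1) * p ^ g : ℕ) * ((p : ℝ≥0∞)⁻¹) ^ n := by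
  simp only [isFullAt_relSubgroup_iff]
  refine (relLaw_abMap hp {s : Fin (g + 1) → AbQuot p (g + 1) (n + 1) |
    ¬ ∀ a : AbQuot p (g + 1) (n + 1), a ^ p ^ n ∈ Subgroup.closure (Set.range s)}).trans_le ?_
  have hp0 : (p : ℝ≥0∞) ≠ 0 := by exact_mod_cast (Fact.out : p.Prime).ne_zero
  have h := ncard_not_full (p := p) g n
  refine ENNReal.div_le_of_le_mul ?_
  refine (Nat.cast_le.2 h).trans_eq ?_
  rw [← ENNReal.inv_pow]
  push_cast
  have h2 : (p : ℝ≥0∞) ^ n ≠ 0 := pow_ne_zero _ hp0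
  have h3 : (p : ℝ≥0∞) ^ n ≠ ⊤ := ENNReal.pow_ne_top (ENNReal.natCast_ne_top p)
  have h4 : ((p : ℝ≥0∞) ^ (n * (g + 1))) ^ (g + 1) =
      (p : ℝ≥0∞) ^ n * ((p : ℝ≥0∞) ^ (n * g) * ((p : ℝ≥0∞) ^ (n * (g + 1))) ^ g) := by
    ring
  rw [h4, mul_assoc _ ((p : ℝ≥0∞) ^ n)⁻¹, ← mul_assoc ((p : ℝ≥0∞) ^ n)⁻¹,
    ENNReal.inv_mul_cancel h2 h3]
  ring

lemma eq_zero_of_forall_le {x K : ℝ≥0∞} (hK : K ≠ ⊤) {q : ℝ≥0∞} (hq : q < 1)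
    (h : ∀ n : ℕ, x ≤ K * q ^ n) : x = 0 := by
  have h1 := ENNReal.Tendsto.const_mul (ENNReal.tendsto_pow_atTop_nhds_zero_of_lt_one hq)
    (Or.inr hK)
  rw [mul_zero] at h1
  exact le_antisymm (ge_of_tendsto' h1 h) bot_le

/-- Almost surely, `g` random relations present a Schur `σ`-group: the probability that the
abelianization has exponent larger than `pⁿ` tends to `0`. -/
theorem relLaw_relEvent_univ (hp : Odd p) : relLaw p g (relEvent p g Set.univ) = 1 := by
  have := isProbabilityMeasure_muX (p := p) (g := g) hp
  rw [prob_compl_eq_zero_iff measurableSet_relEvent_univ |>.symm]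
  cases g with
  | zero =>
    refine measure_mono_null (t := ∅) (fun r hr => hr ?_) measure_empty
    rw [mem_relEvent_univ]
    refine ⟨0, fun a => ?_⟩
    rw [Subsingleton.elim (a ^ p ^ 0) 1]
    exact one_mem _
  | succ g =>
    refine eq_zero_of_forall_le (K := ((g + 1) * p ^ g : ℕ)) (ENNReal.natCast_ne_top _)
      (q := (p : ℝ≥0∞)⁻¹) ?_ fun n => (measure_mono fun r hr => ?_).trans (relLaw_not_full hp n)
    · rw [ENNReal.inv_lt_one]
      exact_mod_cast (Fact.out : p.Prime).one_lt
    · intro hf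
      exact hr ((mem_relEvent_univ r).2 ⟨n, hf⟩)

end FiniteAbelianization

/-! ### The distribution of the abelianization, and the Cohen-Lenstra weights -/

section CohenLenstra

variable {p g : ℕ} [Fact p.Prime]

/-- The event that the presented group has abelianization `A`. -/
def abEvent (p g : ℕ) (A : Type) [CommGroup A] : Set (Fin g → Relator p g) :=
  {r | Nonempty (TopologicalAbelianization (FreeProP p g ⧸ relSubgroup r) ≃* A)}

lemma map_relSubgroup_abMap (r : Fin g → Relator p g) (m : ℕ) :
    (QuotientGroup.mk' (relSubgroup r)).ker.map (abMap p g m) =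
      Subgroup.closure (Set.range fun i => abMap p g m (r i).1) := by
  rw [QuotientGroup.ker_mk', map_relSubgroup r _ (continuous_abMap p g _) (abMap_surjective p g _)]
  exact le_antisymm (Subgroup.normalClosure_le_normal Subgroup.subset_closure)
    ((Subgroup.closure_le _).2 Subgroup.subset_normalClosure)

/-- If `A` has exponent dividing `pⁿ`, then `(ℤ/pⁿ⁺¹)^g` suffices to recognize `A`, as an
abelianization whose quotient by the `pⁿ⁺¹`-st powers has exponent `pⁿ` has itself exponent `pⁿ`.
-/
lemma mem_abEvent_iff {A : Type} [CommGroup A] {n : ℕ} (hn : ∀ a : A, a ^ p ^ n = 1)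
    (r : Fin g → Relator p g) : r ∈ abEvent p g A ↔
      Nonempty (AbQuot p g (n + 1) ⧸
        Subgroup.closure (Set.range fun i => abMap p g (n + 1) (r i).1) ≃* A) := by
  have hπ : Continuous (QuotientGroup.mk' (relSubgroup r)) := continuous_quotient_mk'
  have hs := QuotientGroup.mk'_surjective (relSubgroup r)
  rw [← map_relSubgroup_abMap]
  constructor
  · rintro ⟨e⟩
    obtain ⟨f⟩ := nonempty_ab_equiv (m := n + 1) hπ hs fun c => e.injective (by
      rw [map_pow, map_one, pow_succ, pow_mul, hn, one_pow])
    exact ⟨f.symm.trans e⟩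
  · rintro ⟨e⟩
    have hfull : IsFullAt n (QuotientGroup.mk' (relSubgroup r)).ker := by
      intro a
      rw [← QuotientGroup.eq_one_iff]
      refine e.injective ?_
      rw [QuotientGroup.mk_pow, map_pow, map_one, hn]
    obtain ⟨f⟩ := nonempty_ab_equiv (m := n + 1) hπ hs fun c => by
      rw [pow_succ, pow_mul, pow_ab_eq_one_of_isFullAt hπ hs hfull, one_pow]
    exact ⟨f.trans e⟩

lemma exists_pow_eq_one {A : Type} [CommGroup A] [Finite A] (hA : IsPGroup p A) :
    ∃ n, ∀ a : A, a ^ p ^ n = 1 := by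
  obtain ⟨n, hn⟩ := IsPGroup.iff_card.1 hA
  exact ⟨n, fun a => by rw [← hn]; exact pow_card_eq_one'⟩

lemma measurableSet_abEvent {A : Type} [CommGroup A] [Finite A] (hA : IsPGroup p A) :
    MeasurableSet (abEvent p g A) := by
  obtain ⟨n, hn⟩ := exists_pow_eq_one hA
  convert measurableSet_image lowerPCentral_abQuot (abMap p g (n + 1)) (continuous_abMap p g _)
    {s | Nonempty (AbQuot p g (n + 1) ⧸ Subgroup.closure (Set.range s) ≃* A)} using 1
  ext r
  exact mem_abEvent_iff hn r

/-- The factor `c_g` such that `g` random relations present a group with abelianization `A`, of rank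
`g`, with probability `c_g / |Aut A|`. -/
def presConst (p g : ℕ) : ℝ≥0∞ := (genCount p g g : ℝ≥0∞) ^ 2 / ((p : ℝ≥0∞) ^ g) ^ g

lemma presConst_ne_zero : presConst p g ≠ 0 := by
  refine (ENNReal.div_pos (pow_ne_zero _ ?_) ?_).ne'
  · exact_mod_cast (genCount_pos (Fact.out : p.Prime).one_lt le_rfl).ne'
  · exact ENNReal.pow_ne_top (ENNReal.pow_ne_top (ENNReal.natCast_ne_top p))

lemma presConst_ne_top : presConst p g ≠ ⊤ := by
  refine ENNReal.div_ne_top (ENNReal.pow_ne_top (ENNReal.natCast_ne_top _)) ?_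
  exact pow_ne_zero _ (pow_ne_zero _ (by exact_mod_cast (Fact.out : p.Prime).ne_zero))

lemma relLaw_abEvent (hp : Odd p) {A : Type} [CommGroup A] [Finite A] (hA : IsPGroup p A)
    (hrank : Group.rank A = g) :
    relLaw p g (abEvent p g A) = presConst p g * (Nat.card (MulAut A) : ℝ≥0∞)⁻¹ := by
  let _ : TopologicalSpace A := ⊥
  have : DiscreteTopology A := ⟨rfl⟩
  obtain ⟨n, hn⟩ := exists_pow_eq_one hA
  have h1 := card_quotClass_one hp hA
  rw [hrank] at h1
  have h2 := ncard_presentations hp hA h1 hn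
  have h3 := relLaw_abMap (g := g) (n := n) hp
    {s | Nonempty (AbQuot p g (n + 1) ⧸ Subgroup.closure (Set.range s) ≃* A)}
  have h4 : abEvent p g A = {r | (fun i => abMap p g (n + 1) (r i).1) ∈
      {s | Nonempty (AbQuot p g (n + 1) ⧸ Subgroup.closure (Set.range s) ≃* A)}} :=
    Set.ext fun r => mem_abEvent_iff hn r
  rw [h4, h3]
  have h5 : (({s : Fin g → AbQuot p g (n + 1) | Nonempty (AbQuot p g (n + 1) ⧸
        Subgroup.closure (Set.range s) ≃* A) ∧
        ∀ i, s i ∈ lowerPCentral p (AbQuot p g (n + 1)) 1}.ncard : ℕ) : ℝ≥0∞) *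
      (Nat.card (MulAut A) : ℝ≥0∞) * ((p : ℝ≥0∞) ^ g) ^ g =
      (genCount p g g : ℝ≥0∞) ^ 2 * ((p ^ (n * g) : ℕ) : ℝ≥0∞) ^ g := by
    exact_mod_cast congrArg (Nat.cast : ℕ → ℝ≥0∞) h2
  have hp0 : (p : ℝ≥0∞) ≠ 0 := by exact_mod_cast (Fact.out : p.Prime).ne_zero
  have ha0 : (Nat.card (MulAut A) : ℝ≥0∞) ≠ 0 := by exact_mod_cast Nat.card_pos.ne'
  have hq0 : ((p : ℝ≥0∞) ^ g) ^ g ≠ 0 := pow_ne_zero _ (pow_ne_zero _ hp0)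
  have hqt : ((p : ℝ≥0∞) ^ g) ^ g ≠ ⊤ :=
    ENNReal.pow_ne_top (ENNReal.pow_ne_top (ENNReal.natCast_ne_top p))
  have hn0 : ((p ^ (n * g) : ℕ) : ℝ≥0∞) ^ g ≠ 0 := by
    push_cast
    exact pow_ne_zero _ (pow_ne_zero _ hp0)
  have hnt : ((p ^ (n * g) : ℕ) : ℝ≥0∞) ^ g ≠ ⊤ := ENNReal.pow_ne_top (ENNReal.natCast_ne_top _)
  refine ((ENNReal.eq_div_iff hn0 hnt).2 ?_).symm
  rw [← ENNReal.mul_left_inj (c := (Nat.card (MulAut A) : ℝ≥0∞) * ((p : ℝ≥0∞) ^ g) ^ g)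
    (mul_ne_zero ha0 hq0) (ENNReal.mul_ne_top (ENNReal.natCast_ne_top _) hqt),
    presConst]
  refine Eq.trans ?_ ((mul_assoc _ _ _).symm.trans h5).symm
  rw [ENNReal.div_eq_inv_mul]
  calc _ = (((p : ℝ≥0∞) ^ g) ^ g)⁻¹ * ((p : ℝ≥0∞) ^ g) ^ g *
      ((Nat.card (MulAut A) : ℝ≥0∞)⁻¹ * (Nat.card (MulAut A) : ℝ≥0∞)) *
      ((genCount p g g : ℝ≥0∞) ^ 2 * ((p ^ (n * g) : ℕ) : ℝ≥0∞) ^ g) := by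
        ring
    _ = _ := by
        rw [ENNReal.inv_mul_cancel hq0 hqt,
          ENNReal.inv_mul_cancel ha0 (ENNReal.natCast_ne_top _), one_mul, one_mul]

lemma disjoint_abEvent {A B : Quotient (finAbSetoid p)} (h : A ≠ B) :
    Disjoint (abEvent p g A.out.carrier) (abEvent p g B.out.carrier) := by
  rw [Set.disjoint_left]
  rintro r ⟨e⟩ ⟨f⟩
  exact h (Quotient.out_equiv_out.1 ⟨e.symm.trans f⟩)

/-- The abelianization of the presented group has rank `g`, since the relations lie in the Frattini
subgroup. -/
lemma relEvent_univ_subset (hp : Odd p) : relEvent p g Set.univ ⊆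
    ⋃ A : {A : Quotient (finAbSetoid p) // Group.rank A.out.carrier = g},
      abEvent p g A.1.out.carrier := by
  intro r hr
  obtain ⟨h, -⟩ := hr
  obtain ⟨n, hn⟩ := (mem_relEvent_univ r).1 ⟨h, trivial⟩
  have hπ : Continuous (QuotientGroup.mk' (relSubgroup r)) := continuous_quotient_mk'
  have hs := QuotientGroup.mk'_surjective (relSubgroup r)
  have := h.finite_ab
  have hfull : IsFullAt n (QuotientGroup.mk' (relSubgroup r)).ker := by
    rwa [QuotientGroup.ker_mk']
  have hpow := pow_ab_eq_one_of_isFullAt hπ hs hfull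
  let B : FinAbPGrp p :=
    { carrier := TopologicalAbelianization (FreeProP p g ⧸ relSubgroup r)
      isPGroup := fun x => ⟨n, hpow x⟩ }
  obtain ⟨e⟩ : Nonempty ((Quotient.mk (finAbSetoid p) B).out.carrier ≃* B.carrier) :=
    Quotient.mk_out B
  refine Set.mem_iUnion.2 ⟨⟨Quotient.mk _ B, ?_⟩, ⟨e.symm⟩⟩
  set A := (Quotient.mk (finAbSetoid p) B).out.carrier
  have hA : IsPGroup p A := (Quotient.mk (finAbSetoid p) B).out.isPGroup
  let _ : TopologicalSpace A := ⊥
  have : DiscreteTopology A := ⟨rfl⟩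
  have hpowA : ∀ a : A, a ^ p ^ n = 1 := fun a => e.injective (by
    rw [map_pow, map_one]; exact hpow _)
  obtain ⟨f⟩ := (mem_abEvent_iff hpowA r).1 ⟨e.symm⟩
  let ψ : AbQuot p g (n + 1) →* A := f.toMonoidHom.comp (QuotientGroup.mk' _)
  have hψ : Function.Surjective ψ := f.surjective.comp (QuotientGroup.mk'_surjective _)
  have hψk : ψ.ker ≤ lowerPCentral p (AbQuot p g (n + 1)) 1 := by
    rw [ker_equiv_comp, QuotientGroup.ker_mk', Subgroup.closure_le]
    rintro _ ⟨i, rfl⟩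
    exact map_mem_lowerPCentral _ (continuous_abMap p g _) 1 (r i).2.1
  obtain ⟨t⟩ := nonempty_quotClass_equiv (p := p) (c := 1) ψ continuous_of_discreteTopology hψ
    (QuotientGroup.mk' (lowerPCentral p (AbQuot p g (n + 1)) 1))
    (QuotientGroup.mk'_surjective _) (by rw [QuotientGroup.ker_mk', sup_eq_right.2 hψk])
  have h1 := card_quotClass_one hp hA
  rw [Nat.card_congr t.toEquiv] at h1
  have h := card_lowerPCentral_one_mul (p := p) (A := AbQuot p g (n + 1))
  rw [card_lowerPCentral_one_abQuot, card_abQuot, h1, ← pow_add] at h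
  have := Nat.pow_right_injective (Fact.out : p.Prime).two_le h
  have h3 : n * g + Group.rank A = (n + 1) * g := this
  have h4 : (n + 1) * g = n * g + g := by ring
  exact Nat.add_left_cancel (h3.trans h4)

/-- The total Cohen-Lenstra weight of the groups of rank `g`: the probabilities `c_g / |Aut A|` of
the abelianizations of rank `g` add up to `1`. -/
theorem tsum_clWeight_rank (hp : Odd p) (g : ℕ) :
    ∑' A : {A : Quotient (finAbSetoid p) // Group.rank A.out.carrier = g}, clWeight A.1 =
      (presConst p g)⁻¹ := by
  have := isProbabilityMeasure_muX (p := p) (g := g) hp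
  have hmeas : ∀ A : {A : Quotient (finAbSetoid p) // Group.rank A.out.carrier = g},
      MeasurableSet (abEvent p g A.1.out.carrier) :=
    fun A => measurableSet_abEvent A.1.out.isPGroup
  have hlaw : ∀ A : {A : Quotient (finAbSetoid p) // Group.rank A.out.carrier = g},
      relLaw p g (abEvent p g A.1.out.carrier) = presConst p g * clWeight A.1 :=
    fun A => relLaw_abEvent hp A.1.out.isPGroup A.2
  have hdisj : Pairwise (Function.onFun Disjoint
      fun A : {A : Quotient (finAbSetoid p) // Group.rank A.out.carrier = g} =>
        abEvent p g A.1.out.carrier) :=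
    fun A B h => disjoint_abEvent fun h' => h (Subtype.ext h')
  have hcount : Countable {A : Quotient (finAbSetoid p) // Group.rank A.out.carrier = g} := by
    have h := Measure.countable_meas_pos_of_disjoint_iUnion (μ := relLaw p g) hmeas hdisj
    rw [← Set.countable_univ_iff]
    refine h.mono fun A _ => ?_
    rw [Set.mem_ofPred_eq, hlaw]
    exact ENNReal.mul_pos presConst_ne_zero (ENNReal.inv_ne_zero.2 (ENNReal.natCast_ne_top _))
  have h1 := measure_iUnion (μ := relLaw p g) hdisj hmeas
  have h2 : relLaw p g (⋃ A : {A : Quotient (finAbSetoid p) // Group.rank A.out.carrier = g},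
      abEvent p g A.1.out.carrier) = 1 :=
    le_antisymm prob_le_one
      ((relLaw_relEvent_univ hp).symm.trans_le (measure_mono (relEvent_univ_subset hp)))
  simp only [h2, hlaw, ENNReal.tsum_mul_left] at h1
  exact ENNReal.eq_inv_of_mul_eq_one_left (by rw [mul_comm]; exact h1.symm)

end CohenLenstra

/-! ### A `q`-series identity -/

section QSeries

/-- The `q`-Pochhammer symbol `(q)ₙ = ∏_{1 ≤ i ≤ n} (1 - qⁱ)`. -/
def qPoch (q : ℝ) (n : ℕ) : ℝ := ∏ i ∈ Finset.range n, (1 - q ^ (i + 1))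

lemma qPoch_zero (q : ℝ) : qPoch q 0 = 1 := Finset.prod_range_zero _

lemma qPoch_succ (q : ℝ) (n : ℕ) : qPoch q (n + 1) = qPoch q n * (1 - q ^ (n + 1)) :=
  Finset.prod_range_succ _ _

/-- The `m`-th term of the series `∑ₘ q^{m(m+d)} / ((q)ₘ (q)ₘ₊d)`, whose sum is independent
of `d`. -/
def qTerm (q : ℝ) (d m : ℕ) : ℝ := q ^ (m * (m + d)) / (qPoch q m * qPoch q (m + d))

variable {q : ℝ} (hq0 : 0 < q) (hq : q ≤ 1 / 3)
include hq0 hq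

lemma one_sub_pow_pos (n : ℕ) : 0 < 1 - q ^ (n + 1) := by
  have : q ^ (n + 1) ≤ q := by
    simpa using pow_le_pow_of_le_one hq0.le (by linarith) (Nat.le_add_left 1 n)
  linarith

lemma qPoch_pos (n : ℕ) : 0 < qPoch q n := Finset.prod_pos fun i _ => one_sub_pow_pos hq0 hq i

lemma half_le_qPoch (n : ℕ) : 1 / 2 ≤ qPoch q n := by
  -- the sharper bound `1 / 2 + qⁿ / 2` is stable under multiplication by `1 - qⁿ⁺¹`
  have key : ∀ n, 1 / 2 + q ^ n / 2 ≤ qPoch q n := by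
    intro n
    induction n with
    | zero => norm_num [qPoch_zero]
    | succ n ih =>
      rw [qPoch_succ]
      have h1 := one_sub_pow_pos hq0 hq n
      have h2 : 0 < q ^ n := pow_pos hq0 n
      have h3 : q ^ n ≤ 1 := pow_le_one₀ hq0.le (by linarith)
      refine le_trans ?_ (mul_le_mul_of_nonneg_right ih h1.le)
      rw [pow_succ]
      nlinarith [mul_pos h2 hq0, mul_nonneg h2.le (sub_nonneg.2 hq)]
  have h2 : 0 < q ^ n := pow_pos hq0 n
  linarith [key n]

lemma qTerm_nonneg (d m : ℕ) : 0 ≤ qTerm q d m :=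
  div_nonneg (pow_nonneg hq0.le _) (mul_pos (qPoch_pos hq0 hq _) (qPoch_pos hq0 hq _)).le

lemma qTerm_le (d m : ℕ) : qTerm q d m ≤ 4 * q ^ (m * (m + d)) := by
  rw [qTerm, div_le_iff₀ (mul_pos (qPoch_pos hq0 hq _) (qPoch_pos hq0 hq _))]
  have h1 := half_le_qPoch hq0 hq m
  have h2 := half_le_qPoch hq0 hq (m + d)
  have h3 : 1 / 4 ≤ qPoch q m * qPoch q (m + d) := by nlinarith
  nlinarith [pow_pos hq0 (m * (m + d))]

lemma qTerm_le_geom (d m : ℕ) : qTerm q d m ≤ 4 * q ^ m := by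
  refine (qTerm_le hq0 hq d m).trans (mul_le_mul_of_nonneg_left ?_ (by norm_num))
  refine pow_le_pow_of_le_one hq0.le (by linarith) ?_
  rcases Nat.eq_zero_or_pos m with rfl | h
  · simp
  · exact Nat.le_mul_of_pos_right m (by omega)

lemma summable_qTerm (d : ℕ) : Summable (qTerm q d) :=
  Summable.of_nonneg_of_le (qTerm_nonneg hq0 hq d) (qTerm_le_geom hq0 hq d)
    ((summable_geometric_of_lt_one hq0.le (by linarith)).mul_left 4)

lemma tsum_qTerm_le (d : ℕ) : ∑' m, qTerm q d m ≤ 6 := by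
  refine ((summable_qTerm hq0 hq d).tsum_le_tsum (qTerm_le_geom hq0 hq d)
    ((summable_geometric_of_lt_one hq0.le (by linarith)).mul_left 4)).trans ?_
  rw [tsum_mul_left, tsum_geometric_of_lt_one hq0.le (by linarith), ← div_eq_mul_inv,
    div_le_iff₀ (by linarith)]
  linarith

/-- The recurrence for the differences of the sums, from splitting
`1 - qᵐ - qᵐ⁺ᵈ⁺¹ = (1 - qᵐ) - qᵐ⁺ᵈ⁺¹`. -/
lemma tsum_qTerm_sub (d : ℕ) : ∑' m, qTerm q d m - ∑' m, qTerm q (d + 1) m =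
    -q ^ (d + 1) * (∑' m, qTerm q (d + 1) m - ∑' m, qTerm q (d + 2) m) := by
  have hs := summable_qTerm hq0 hq
  -- `a m` is the part of the difference that has a factor `1 - qᵐ`
  let a : ℕ → ℝ := fun m => qTerm q d m - qTerm q (d + 1) m + q ^ (d + 1) * qTerm q (d + 1) m
  have ha : Summable a := ((hs d).sub (hs (d + 1))).add ((hs (d + 1)).mul_left _)
  have ha0 : a 0 = 0 := by
    have h1 := (one_sub_pow_pos hq0 hq d).ne'
    have h2 := (qPoch_pos hq0 hq d).ne'
    simp only [a, qTerm, zero_mul, pow_zero, qPoch_zero, zero_add, one_mul, qPoch_succ]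
    field_simp
    ring
  have hasucc : ∀ m, a (m + 1) = q ^ (d + 1) * qTerm q (d + 2) m := by
    intro m
    have h1 := (one_sub_pow_pos hq0 hq m).ne'
    have h2 := (qPoch_pos hq0 hq m).ne'
    have h3 := (qPoch_pos hq0 hq (m + d + 1)).ne'
    have h4 := (one_sub_pow_pos hq0 hq (m + d + 1)).ne'
    have e1 : m + 1 + d = m + d + 1 := by ring
    have e2 : m + 1 + (d + 1) = m + d + 1 + 1 := by ring
    have e3 : m + (d + 2) = m + d + 1 + 1 := by ring
    simp only [a, qTerm, e1, e2, e3, qPoch_succ q m, qPoch_succ q (m + d + 1)]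
    have p1 : q ^ ((m + 1) * (m + d + 1 + 1)) = q ^ ((m + 1) * (m + d + 1)) * q ^ (m + 1) := by
      rw [← pow_add]
      congr 1
    have p2 : q ^ ((m + 1) * (m + d + 1)) = q ^ (d + 1) * q ^ (m * (m + d + 1 + 1)) := by
      rw [← pow_add]
      congr 1
      ring
    rw [p1, p2]
    have p3 : q ^ (m + d + 1 + 1) = q ^ (d + 1) * q ^ (m + 1) := by
      rw [← pow_add]
      congr 1
      ring
    rw [p3] at h4 ⊢
    field_simp
    ring
  have hsum : ∑' m, a m = q ^ (d + 1) * ∑' m, qTerm q (d + 2) m := by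
    rw [ha.tsum_eq_zero_add, ha0, zero_add, ← tsum_mul_left]
    exact tsum_congr hasucc
  have hsum' : ∑' m, a m = ∑' m, qTerm q d m - ∑' m, qTerm q (d + 1) m +
      q ^ (d + 1) * ∑' m, qTerm q (d + 1) m := by
    rw [((hs d).sub (hs (d + 1))).tsum_add ((hs (d + 1)).mul_left _), (hs d).tsum_sub (hs (d + 1)),
      tsum_mul_left]
  rw [hsum] at hsum'
  linarith

/-- By the recurrence the difference of consecutive sums is at most `qᵏ` times a bounded quantity,
for every `k`, so it vanishes. -/
theorem tsum_qTerm_eq (d : ℕ) : ∑' m, qTerm q d m = ∑' m, qTerm q 0 m := by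
  have hbound : ∀ d, |∑' m, qTerm q d m - ∑' m, qTerm q (d + 1) m| ≤ 6 := by
    intro d
    have h1 := tsum_qTerm_le hq0 hq d
    have h2 := tsum_qTerm_le hq0 hq (d + 1)
    have h3 : 0 ≤ ∑' m, qTerm q d m := tsum_nonneg (qTerm_nonneg hq0 hq d)
    have h4 : 0 ≤ ∑' m, qTerm q (d + 1) m := tsum_nonneg (qTerm_nonneg hq0 hq (d + 1))
    rw [abs_le]
    constructor <;> linarith
  have hiter : ∀ k d, |∑' m, qTerm q d m - ∑' m, qTerm q (d + 1) m| ≤ q ^ k * 6 := by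
    intro k
    induction k with
    | zero => simpa using hbound
    | succ k ih =>
      intro d
      rw [tsum_qTerm_sub hq0 hq d, abs_mul, abs_neg, abs_of_pos (pow_pos hq0 _), pow_succ' q k,
        mul_assoc]
      refine mul_le_mul ?_ (ih (d + 1)) (abs_nonneg _) hq0.le
      simpa using pow_le_pow_of_le_one hq0.le (by linarith) (Nat.le_add_left 1 d)
  have hzero : ∀ d, ∑' m, qTerm q d m - ∑' m, qTerm q (d + 1) m = 0 := by
    intro d
    refine abs_eq_zero.1 (le_antisymm ?_ (abs_nonneg _))
    have := (tendsto_pow_atTop_nhds_zero_of_lt_one hq0.le (by linarith : q < 1)).mul_const 6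
    rw [zero_mul] at this
    exact ge_of_tendsto' this fun k => hiter k d
  induction d with
  | zero => rfl
  | succ d ih => rw [← ih]; linarith [hzero d]

/-- For `q ≤ 1/3` the first two terms of the series are at most `1` and `3/4`, and the others add
up to less than `1/4`. -/
theorem tsum_qTerm_lt_two : ∑' m, qTerm q 0 m < 2 := by
  have hs := summable_qTerm hq0 hq 0
  have hs1 : Summable fun m => qTerm q 0 (m + 1) := (summable_nat_add_iff 1).2 hs
  have hs2 : Summable fun m => qTerm q 0 (m + 1 + 1) := (summable_nat_add_iff 1).2 hs1
  rw [hs.tsum_eq_zero_add, hs1.tsum_eq_zero_add]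
  have h0 : qTerm q 0 0 = 1 := by simp [qTerm, qPoch_zero]
  have h1 : qTerm q 0 (0 + 1) ≤ 3 / 4 := by
    simp only [qTerm, zero_add, add_zero, mul_one, pow_one, qPoch_succ q 0, qPoch_zero, one_mul]
    rw [div_le_iff₀ (mul_pos (by linarith) (by linarith))]
    nlinarith
  have h2 : ∀ m, qTerm q 0 (m + 1 + 1) ≤ 4 / 81 * (1 / 3) ^ m := by
    intro m
    refine (qTerm_le hq0 hq 0 _).trans ?_
    have : q ^ ((m + 1 + 1) * (m + 1 + 1 + 0)) ≤ (1 / 3 : ℝ) ^ (4 + m) :=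
      (pow_le_pow_of_le_one hq0.le (by linarith) (by nlinarith)).trans
        (pow_le_pow_left₀ hq0.le hq _)
    rw [pow_add] at this
    norm_num at this ⊢
    linarith
  have hg : Summable fun m : ℕ => 4 / 81 * (1 / 3 : ℝ) ^ m :=
    (summable_geometric_of_lt_one (by norm_num) (by norm_num)).mul_left _
  have h3 := hs2.tsum_le_tsum h2 hg
  rw [tsum_mul_left, tsum_geometric_of_lt_one (by norm_num) (by norm_num)] at h3
  norm_num at h3
  linarith

end QSeries

/-! ### The distribution of the rank under the Cohen-Lenstra measure -/

section RankLaw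

variable {p g : ℕ} [Fact p.Prime]

lemma genCount_mul_qPoch (m d : ℕ) : (genCount p (m + d) d : ℝ) * qPoch (p : ℝ)⁻¹ m =
    (p : ℝ) ^ ((m + d) * d) * qPoch (p : ℝ)⁻¹ (m + d) := by
  have hp : (p : ℝ) ≠ 0 := by exact_mod_cast (Fact.out : p.Prime).ne_zero
  induction d generalizing m with
  | zero => simp [genCount]
  | succ d ih =>
    have h := ih (m + 1)
    have e : m + 1 + d = m + (d + 1) := by ring
    rw [e, qPoch_succ] at h
    have h1 : genCount p (m + (d + 1)) (d + 1) =
        genCount p (m + (d + 1)) d * (p ^ (m + (d + 1)) - p ^ d) := Finset.prod_range_succ _ _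
    have h2 : ((p ^ (m + (d + 1)) - p ^ d : ℕ) : ℝ) =
        (p : ℝ) ^ (m + (d + 1)) * (1 - (p : ℝ)⁻¹ ^ (m + 1)) := by
      rw [Nat.cast_sub (Nat.pow_le_pow_right (Fact.out : p.Prime).pos (by omega))]
      have : (p : ℝ) ^ (m + (d + 1)) = (p : ℝ) ^ d * (p : ℝ) ^ (m + 1) := by
        rw [← pow_add]
        congr 1
        ring
      push_cast
      rw [mul_sub, mul_one, this, mul_assoc, ← mul_pow, mul_inv_cancel₀ hp, one_pow, mul_one]
    rw [h1, Nat.cast_mul, h2]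
    calc _ = (p : ℝ) ^ (m + (d + 1)) * ((genCount p (m + (d + 1)) d : ℝ) *
          (qPoch (p : ℝ)⁻¹ m * (1 - (p : ℝ)⁻¹ ^ (m + 1)))) := by ring
      _ = _ := by
        rw [h]
        ring

lemma inv_le_third (hp : Odd p) : (p : ℝ)⁻¹ ≤ 1 / 3 := by
  have h2 := (Fact.out : p.Prime).two_le
  have h3 : 3 ≤ p := by
    rcases Nat.lt_or_ge 2 p with h | h
    · exact h
    · obtain ⟨k, hk⟩ := hp
      omega
  rw [one_div]
  exact inv_anti₀ (by norm_num) (by exact_mod_cast h3)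

/-- The contribution of the groups of rank `g = m + d` to the moment for rank `d`, up to
normalization, is a term of the `q`-series for `q = 1/p`. -/
lemma genCount_div_presConst (hp : Odd p) (m d : ℕ) :
    (genCount p (m + d) d : ℝ≥0∞) * (presConst p (m + d))⁻¹ =
      ENNReal.ofReal (qTerm (p : ℝ)⁻¹ d m) := by
  have hp0 : 0 < (p : ℝ) := by exact_mod_cast (Fact.out : p.Prime).pos
  have hq0 : 0 < (p : ℝ)⁻¹ := inv_pos.2 hp0
  have hq := inv_le_third hp
  have h1 := genCount_mul_qPoch (p := p) m d
  have h2 := genCount_mul_qPoch (p := p) 0 (m + d)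
  rw [zero_add, qPoch_zero, mul_one] at h2
  have hm := qPoch_pos hq0 hq m
  have hmd := qPoch_pos hq0 hq (m + d)
  have hG : 0 < (genCount p (m + d) (m + d) : ℝ) := by
    rw [h2]
    exact mul_pos (pow_pos hp0 _) hmd
  have hpres : presConst p (m + d) = ENNReal.ofReal
      ((genCount p (m + d) (m + d) : ℝ) ^ 2 / ((p : ℝ) ^ (m + d)) ^ (m + d)) := by
    rw [presConst, ENNReal.ofReal_div_of_pos (pow_pos (pow_pos hp0 _) _),
      ENNReal.ofReal_pow (Nat.cast_nonneg _), ENNReal.ofReal_pow (pow_nonneg hp0.le _),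
      ENNReal.ofReal_pow hp0.le, ENNReal.ofReal_natCast, ENNReal.ofReal_natCast]
  rw [hpres, ← ENNReal.ofReal_inv_of_pos (div_pos (pow_pos hG 2) (pow_pos (pow_pos hp0 _) _)),
    ← ENNReal.ofReal_natCast, ← ENNReal.ofReal_mul (Nat.cast_nonneg _)]
  congr 1
  have h3 : (genCount p (m + d) d : ℝ) =
      (p : ℝ) ^ ((m + d) * d) * qPoch (p : ℝ)⁻¹ (m + d) / qPoch (p : ℝ)⁻¹ m := by
    rw [eq_div_iff hm.ne', h1]
  rw [h3, h2, qTerm]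
  have h4 : ((p : ℝ) ^ (m + d)) ^ (m + d) = (p : ℝ) ^ ((m + d) * d) * (p : ℝ) ^ (m * (m + d)) := by
    rw [← pow_mul, ← pow_add]
    congr 1
    ring
  have h5 : (p : ℝ) ^ ((m + d) * (m + d)) = ((p : ℝ) ^ (m + d)) ^ (m + d) := pow_mul _ _ _
  rw [h5, h4, inv_pow]
  have a1 := (pow_pos hp0 ((m + d) * d)).ne'
  have a2 := (pow_pos hp0 (m * (m + d))).ne'
  field_simp

variable (p) in
/-- The total Cohen-Lenstra weight, as the sum over the ranks of `tsum_clWeight_rank`. -/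
def clTotal : ℝ≥0∞ := ∑' g, (presConst p g)⁻¹

lemma tsum_genCount (hp : Odd p) (d : ℕ) :
    ∑' g, (genCount p g d : ℝ≥0∞) * (presConst p g)⁻¹ =
      ENNReal.ofReal (∑' m, qTerm (p : ℝ)⁻¹ 0 m) := by
  have hq0 : 0 < (p : ℝ)⁻¹ := inv_pos.2 (by exact_mod_cast (Fact.out : p.Prime).pos)
  have hq := inv_le_third hp
  rw [← tsum_qTerm_eq hq0 hq d, ENNReal.ofReal_tsum_of_nonneg (qTerm_nonneg hq0 hq d)
    (summable_qTerm hq0 hq d)]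
  rw [← (add_left_injective d).tsum_eq]
  · exact tsum_congr fun m => genCount_div_presConst hp m d
  · intro g hg
    by_contra! hlt
    refine hg ?_
    change (genCount p g d : ℝ≥0∞) * (presConst p g)⁻¹ = 0
    rw [genCount_eq_zero, Nat.cast_zero, zero_mul]
    by_contra! hle
    exact hlt ⟨g - d, Nat.sub_add_cancel hle⟩

lemma clTotal_eq (hp : Odd p) :
    clTotal p = ENNReal.ofReal (∑' m, qTerm (p : ℝ)⁻¹ 0 m) := by
  rw [← tsum_genCount hp 0]
  exact tsum_congr fun g => by simp [genCount]

lemma clTotal_lt_two (hp : Odd p) : clTotal p < 2 := by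
  have hq0 : 0 < (p : ℝ)⁻¹ := inv_pos.2 (by exact_mod_cast (Fact.out : p.Prime).pos)
  rw [clTotal_eq hp, ← ENNReal.ofReal_ofNat]
  exact (ENNReal.ofReal_lt_ofReal_iff (by norm_num)).2 (tsum_qTerm_lt_two hq0 (inv_le_third hp))

lemma clTotal_ne_zero : clTotal p ≠ 0 := by
  intro h
  exact ENNReal.inv_ne_zero.2 presConst_ne_top (ENNReal.tsum_eq_zero.1 h 0)

lemma muCL_eq (hp : Odd p) (g : ℕ) : muCL p g = (presConst p g)⁻¹ * (clTotal p)⁻¹ := by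
  have h : ∑' A : Quotient (finAbSetoid p), clWeight A = clTotal p := by
    rw [← (Equiv.sigmaFiberEquiv fun A : Quotient (finAbSetoid p) =>
      Group.rank A.out.carrier).tsum_eq, ENNReal.tsum_sigma']
    exact tsum_congr fun g => tsum_clWeight_rank hp g
  rw [muCL, tsum_clWeight_rank hp g, h, div_eq_mul_inv]

/-- The sums `∑_g μ_CL(g) ∏_{i < d} (p^g - pⁱ)`, which are the moments of `μ_BBH` for groups of rank
`d`, are all equal to `1`. -/
theorem tsum_muCL_genCount (hp : Odd p) (d : ℕ) :
    ∑' g, muCL p g * (genCount p g d : ℝ≥0∞) = 1 := by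
  have h1 : ∀ g, muCL p g * (genCount p g d : ℝ≥0∞) =
      (clTotal p)⁻¹ * ((genCount p g d : ℝ≥0∞) * (presConst p g)⁻¹) := fun g => by
    rw [muCL_eq hp]
    ring
  rw [tsum_congr h1, ENNReal.tsum_mul_left, tsum_genCount hp, ← clTotal_eq hp]
  exact ENNReal.inv_mul_cancel clTotal_ne_zero ((clTotal_lt_two hp).trans_le le_top).ne

end RankLaw

/-! ### Equivariant surjections -/

section EquivariantSurjections

variable {p : ℕ} {G H K : Type} [Group G] [TopologicalSpace G] [IsTopologicalGroup G]
  [Group H] [TopologicalSpace H] [IsTopologicalGroup H]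
  [Group K] [TopologicalSpace K] [IsTopologicalGroup K]

/-- The continuous surjective homomorphisms `G → H` that commute with `σ` and `τ`. -/
def eqSur (σ : G →* G) (τ : H →* H) : Set (G →* H) :=
  {φ | Continuous φ ∧ Function.Surjective φ ∧ ∀ x, φ (σ x) = τ (φ x)}

/-- Composition with `π` identifies the equivariant surjections `H → K` with those equivariant
surjections `G → K` that are trivial on the kernel of `π`. -/
lemma encard_eqSur_comp [DiscreteTopology H] {σ : G →* G} {τ : H →* H} {ρ : K →* K} {π : G →* H}
    (hπ : π ∈ eqSur σ τ) :
    {φ | φ ∈ eqSur σ ρ ∧ π.ker ≤ φ.ker}.encard = (eqSur τ ρ).encard := by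
  obtain ⟨hc, hs, he⟩ := hπ
  have hinj : Set.InjOn (fun ψ : H →* K => ψ.comp π) (eqSur τ ρ) := by
    intro ψ _ ψ' _ h
    refine MonoidHom.ext fun y => ?_
    obtain ⟨x, rfl⟩ := hs y
    exact DFunLike.congr_fun h x
  rw [← hinj.encard_image]
  congr 1
  ext φ
  constructor
  · rintro ⟨⟨_, h2, h3⟩, hker⟩
    let ψ : H →* K := (QuotientGroup.lift π.ker φ hker).comp
      (QuotientGroup.quotientKerEquivOfSurjective π hs).symm.toMonoidHom
    have hψ : ∀ x, ψ (π x) = φ x := by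
      intro x
      have : (QuotientGroup.quotientKerEquivOfSurjective π hs).symm (π x) = (x : G ⧸ π.ker) := by
        rw [MulEquiv.symm_apply_eq]
        rfl
      change QuotientGroup.lift π.ker φ hker
        ((QuotientGroup.quotientKerEquivOfSurjective π hs).symm (π x)) = φ x
      rw [this]
      rfl
    refine ⟨ψ, ⟨continuous_of_discreteTopology, fun z => ?_, fun y => ?_⟩, MonoidHom.ext hψ⟩
    · obtain ⟨x, rfl⟩ := h2 z
      exact ⟨π x, hψ x⟩
    · obtain ⟨x, rfl⟩ := hs y
      rw [← he, hψ, hψ, h3]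
  · rintro ⟨ψ, ⟨h1, h2, h3⟩, rfl⟩
    refine ⟨⟨h1.comp hc, h2.comp hs, fun x => ?_⟩, fun x hx => ?_⟩
    · change ψ (π (σ x)) = ρ (ψ (π x))
      rw [he, h3]
    · change ψ (π x) = 1
      rw [(MonoidHom.mem_ker).1 hx, map_one]

/-- Any isomorphism `Q_c(G) ≅ H` can be modified to be equivariant, since all the involutions
of `H` that invert `H` modulo its Frattini subgroup are conjugate. -/
lemma exists_eqSur_of_equiv [Fact p.Prime] (hp : Odd p) [CompactSpace G] [T2Space G]
    [Finite H] [DiscreteTopology H] (hH : IsPGroup p H) (hfg : IsTopFG G) {σ : G →* G}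
    (hσc : Continuous σ) (hσ : IsInvolutive p σ) {τ : H →* H} (hτ : IsInvolutive p τ) {c : ℕ}
    (e : QuotClass p G c ≃* H) :
    ∃ π ∈ eqSur σ τ, π.ker = lowerPCentral p G c := by
  have := discreteTopology_quotClass (p := p) hfg c
  let τ' : H →* H := (e.toMonoidHom.comp (quotClassMap p σ hσc c)).comp e.symm.toMonoidHom
  have hτ' : IsInvolutive p τ' :=
    (hσ.quotClassMap hσc c).of_surjective (e.toMonoidHom) continuous_of_discreteTopology
      e.surjective fun x => by
        change e (quotClassMap p σ hσc c x) = e (quotClassMap p σ hσc c (e.symm (e x)))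
        rw [e.symm_apply_apply]
  obtain ⟨α, hα⟩ := IsInvolutive.conj hH (odd_card_of_isPGroup hp hH) hτ' hτ
  let f : QuotClass p G c ≃* H := e.trans α
  have hf : Continuous f := continuous_of_discreteTopology
  refine ⟨f.toMonoidHom.comp (QuotientGroup.mk' _), ⟨hf.comp continuous_quotient_mk',
    f.surjective.comp (QuotientGroup.mk'_surjective _), fun x => ?_⟩, ?_⟩
  · have := hα (e (x : QuotClass p G c))
    change α (e (quotClassMap p σ hσc c (e.symm (e (x : QuotClass p G c))))) =
      τ (α (e (x : QuotClass p G c))) at this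
    rw [e.symm_apply_apply] at this
    exact this
  · rw [ker_equiv_comp, QuotientGroup.ker_mk']

/-- The equivariant surjections `F_g → H` correspond to the generating `g`-tuples of inverted
elements. -/
lemma encard_eqSur_free [Fact p.Prime] (hp : Odd p) [Finite H] [DiscreteTopology H]
    (hH : IsPGroup p H) {τ : H →* H} (hτ : IsInvolutive p τ) {d : ℕ}
    (hd : Nat.card (QuotClass p H 1) = p ^ d) (g : ℕ) :
    (eqSur (freeSigma p g) τ).encard =
      ((genCount p g d * (invFrattini p τ).ncard ^ g : ℕ) : ℕ∞) := by
  rw [← ncard_inverted_generators hH (odd_card_of_isPGroup hp hH) hτ hd g,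
    Set.Finite.cast_ncard_eq (Set.toFinite _)]
  have hinj : Set.InjOn (fun (φ : FreeProP p g →* H) i => φ (FreeProP.gen i))
      (eqSur (freeSigma p g) τ) := fun φ hφ ψ hψ h =>
    FreeProP.hom_ext hφ.1 hψ.1 (congrFun h)
  rw [← hinj.encard_image]
  congr 1
  ext v
  constructor
  · rintro ⟨φ, ⟨h1, h2, h3⟩, rfl⟩
    refine ⟨fun i => ?_, FreeProP.closure_range_eq_top h1 h2⟩
    rw [← h3, FreeProP.freeSigma_gen, map_inv]
  · rintro ⟨h1, h2⟩
    obtain ⟨φ, hφ, hv⟩ := FreeProP.exists_lift_finite hH v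
    refine ⟨φ, ⟨hφ, ?_, FreeProP.equivariant hφ continuous_of_discreteTopology fun i => ?_⟩,
      funext hv⟩
    · rw [← MonoidHom.range_eq_top, eq_top_iff, ← h2, Subgroup.closure_le]
      rintro _ ⟨i, rfl⟩
      exact ⟨_, hv i⟩
    · rw [hv, h1]

lemma finite_eqSur_free [Fact p.Prime] (hp : Odd p) [Finite H] [DiscreteTopology H]
    (hH : IsPGroup p H) {τ : H →* H} (hτ : IsInvolutive p τ) (g : ℕ) :
    (eqSur (freeSigma p g) τ).Finite := by
  obtain ⟨d, hd⟩ := IsPGroup.iff_card.1 (hH.to_quotient (lowerPCentral p H 1))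
  rw [← Set.encard_lt_top_iff, encard_eqSur_free hp hH hτ hd]
  exact ENat.natCast_lt_top _

lemma card_quotClass_one_free_le (p g : ℕ) [Fact p.Prime] :
    Nat.card (QuotClass p (FreeProP p g) 1) ≤ p ^ g := by
  obtain ⟨e, he⟩ := IsPGroup.iff_card.1 (isPGroup_level p g 1)
  rw [he]
  refine Nat.pow_le_pow_right (Fact.out : p.Prime).pos ?_
  by_contra! hlt
  have h := ncard_closure_eq_top (V := QuotClass p (FreeProP p g) 1) pow_quotClass_one he g
  rw [genCount_eq_zero hlt, Set.ncard_eq_zero] at h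
  have hmem : (fun i => ((FreeProP.gen i : FreeProP p g) : QuotClass p (FreeProP p g) 1)) ∈
      (∅ : Set (Fin g → QuotClass p (FreeProP p g) 1)) := by
    rw [← h]
    exact FreeProP.closure_range_eq_top
      (φ := QuotientGroup.mk' (lowerPCentral p (FreeProP p g) 1)) continuous_quotient_mk'
      (QuotientGroup.mk'_surjective _)
  exact hmem

end EquivariantSurjections

/-! ### Nakayama's lemma for normal subgroups -/

section Nakayama

variable {p : ℕ} {P : Type} [Group P] [TopologicalSpace P] [IsTopologicalGroup P]

variable (p) in
/-- The subgroup `[P, K] Kᵖ`.  For normal `K` it is the smallest normal subgroup of `P` modulo which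
`K` is central and elementary abelian. -/
def relFrattini (K : Subgroup P) : Subgroup P :=
  ⁅(⊤ : Subgroup P), K⁆ ⊔ Subgroup.closure ((fun x : P => x ^ p) '' (K : Set P))

omit [TopologicalSpace P] [IsTopologicalGroup P] in
lemma relFrattini_le_iff {K N : Subgroup P} : relFrattini p K ≤ N ↔
    (∀ g : P, ∀ x ∈ K, ⁅g, x⁆ ∈ N) ∧ ∀ x ∈ K, x ^ p ∈ N := by
  rw [relFrattini, sup_le_iff, Subgroup.commutator_le, Subgroup.closure_le]
  refine and_congr ⟨fun h g x hx => h g trivial x hx, fun h g _ x hx => h g x hx⟩ ?_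
  constructor
  · exact fun h x hx => h ⟨x, hx, rfl⟩
  · rintro h _ ⟨x, hx, rfl⟩
    exact h x hx

omit [TopologicalSpace P] [IsTopologicalGroup P] in
lemma relFrattini_le (K : Subgroup P) [hK : K.Normal] : relFrattini p K ≤ K :=
  relFrattini_le_iff.2 ⟨fun g x hx => by
    rw [commutatorElement_def]
    exact mul_mem (hK.conj_mem x hx g) (inv_mem hx), fun _ hx => pow_mem hx p⟩

omit [TopologicalSpace P] [IsTopologicalGroup P] in
instance relFrattini_normal (K : Subgroup P) [hK : K.Normal] : (relFrattini p K).Normal := by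
  have h1 : (Subgroup.closure ((fun x : P => x ^ p) '' (K : Set P))).Normal := by
    refine ⟨fun x hx g => ?_⟩
    induction hx using Subgroup.closure_induction with
    | mem x hx =>
      obtain ⟨y, hy, rfl⟩ := hx
      exact Subgroup.subset_closure ⟨g * y * g⁻¹, hK.conj_mem y hy g, by simp [conj_pow]⟩
    | one => simp
    | mul x y _ _ hx hy => simpa only [conj_mul] using mul_mem hx hy
    | inv x _ hx => simpa only [conj_inv] using inv_mem hx
  unfold relFrattini
  infer_instance

/-- Nakayama's lemma for a normal subgroup `K` of a group whose lower `p`-central series reaches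
the trivial subgroup. -/
lemma le_of_le_sup_relFrattini [CompactSpace P] [DiscreteTopology P] {c : ℕ}
    (hc : lowerPCentral p P c = ⊥) {K N : Subgroup P} [N.Normal]
    (h : K ≤ N ⊔ relFrattini p K) : K ≤ N := by
  have hn : ∀ n, K ≤ (lowerPCentral p (P ⧸ N) n).comap (QuotientGroup.mk' N) := by
    intro n
    induction n with
    | zero => exact fun _ _ => Subgroup.mem_top _
    | succ n ih =>
      refine h.trans (sup_le (fun x hx => ?_) (relFrattini_le_iff.2 ⟨fun g x hx => ?_,
        fun x hx => ?_⟩))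
      · have h0 : QuotientGroup.mk' N x = 1 := (QuotientGroup.eq_one_iff x).2 hx
        rw [Subgroup.mem_comap, h0]
        exact one_mem _
      · rw [Subgroup.mem_comap, map_commutatorElement]
        exact commutator_mem_lowerPCentral_succ _ (ih hx)
      · rw [Subgroup.mem_comap, map_pow]
        exact pow_mem_lowerPCentral_succ (ih hx)
  have h1 := hn c
  rw [← map_lowerPCentral (QuotientGroup.mk' N) continuous_quotient_mk'
    (QuotientGroup.mk'_surjective N) c, hc, Subgroup.map_bot, MonoidHom.comap_bot,
    QuotientGroup.ker_mk'] at h1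
  exact h1

end Nakayama

/-! ### Lifting equivariant surjections, and the relation module of a Schur `σ`-group -/

section Lifting

variable {p d : ℕ} [Fact p.Prime]

/-- An equivariant surjection from `F_d` onto a quotient of `G` by a subgroup of `P₁(G)` lifts to an
equivariant surjection onto `G`: the images of the generators lift to inverted elements. -/
lemma exists_lift_eqSur (hp : Odd p) {G H : Type} [Group G] [TopologicalSpace G]
    [IsTopologicalGroup G] [Group H] [TopologicalSpace H] [IsTopologicalGroup H]
    [Finite H] [DiscreteTopology H] (hG : IsProP p G) (hH : IsPGroup p H) {σ : G →* G}
    (hσc : Continuous σ) (hσ : IsInvolutive p σ) {τ : H →* H} {π : G →* H} (hπ : π ∈ eqSur σ τ)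
    (hker : π.ker ≤ lowerPCentral p G 1) {φ : FreeProP p d →* H}
    (hφ : φ ∈ eqSur (freeSigma p d) τ) :
    ∃ Φ ∈ eqSur (freeSigma p d) σ, π.comp Φ = φ := by
  have := hG.compact
  have := hG.t2
  have hz : ∀ i : Fin d, ∃ z : G, σ z = z⁻¹ ∧ π z = φ (FreeProP.gen i) := by
    intro i
    obtain ⟨y, hy⟩ := hπ.2.1 (φ (FreeProP.gen i))
    obtain ⟨z, -, h1, h2⟩ := exists_inv_lift (odd_card_of_isPGroup hp hH) σ hσ.invol π τ hπ.2.2 ⊤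
      (fun _ _ => Subgroup.mem_top _) (Subgroup.mem_top y) (by
        rw [hy, ← hφ.2.2, FreeProP.freeSigma_gen, map_inv])
    exact ⟨z, h1, h2.trans hy⟩
  choose z hz1 hz2 using hz
  obtain ⟨Φ, hΦ, hΦz⟩ := FreeProP.exists_lift hG z
  have hcomp : π.comp Φ = φ := FreeProP.hom_ext (hπ.1.comp hΦ) hφ.1 fun i => by
    change π (Φ _) = _
    rw [hΦz, hz2]
  refine ⟨Φ, ⟨hΦ, ?_, FreeProP.equivariant hΦ hσc fun i => by rw [hΦz, hz1]⟩, hcomp⟩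
  rw [← MonoidHom.range_eq_top]
  refine hG.eq_top_of_sup (isCompact_range hΦ).isClosed (eq_top_iff.2 fun x _ => ?_)
  obtain ⟨f, hf⟩ := hφ.2.1 (π x)
  have h1 : (Φ f)⁻¹ * x ∈ π.ker := by
    have : π (Φ f) = φ f := DFunLike.congr_fun hcomp f
    rw [MonoidHom.mem_ker, map_mul, map_inv, this, hf, inv_mul_cancel]
  rw [← mul_inv_cancel_left (Φ f) x]
  exact mul_mem (Subgroup.mem_sup_left ⟨f, rfl⟩) (Subgroup.mem_sup_right (hker h1))

/-- A quotient `V` of the normal subgroup `R` that is of exponent `p` and on which `F_d` acts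
trivially is controlled by the invariant homomorphisms `R → ℤ/p`, among which is the dual of `V`. -/
lemma card_le_of_rank_invHom {R : Subgroup (FreeProP p d)} [R.Normal]
    (hrank : Module.rank (ZMod p) (invHom p R) = d) {V : Type} [AddCommGroup V]
    [Module (ZMod p) V] [Finite V] [TopologicalSpace V] [DiscreteTopology V] (q : R → V)
    (hqc : Continuous q) (hq : Function.Surjective q) (hmul : ∀ a b, q (a * b) = q a + q b)
    (hconj : ∀ (x : FreeProP p d) (a : R),
      q ⟨x * a * x⁻¹, Subgroup.Normal.conj_mem inferInstance a.1 a.2 x⟩ = q a) :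
    (∃ e ≤ d, Nat.card V = p ^ e) ∧
      ∀ r s : R, (∀ f ∈ invHom p R, f s = -f r) → q s = -q r := by
  let T : Module.Dual (ZMod p) V →ₗ[ZMod p] invHom p R :=
    { toFun := fun χ => ⟨fun r => χ (q r),
        (continuous_of_discreteTopology (f := fun a : V => χ a)).comp hqc,
        fun a b => by simp only [hmul, map_add],
        fun x a => congrArg (fun a => χ a) (hconj x a)⟩
      map_add' := fun _ _ => rfl
      map_smul' := fun _ _ => rfl }
  have hT : Function.Injective T := by
    intro χ χ' h
    refine LinearMap.ext fun v => ?_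
    obtain ⟨r, rfl⟩ := hq v
    exact congrFun (congrArg Subtype.val h) r
  have hfin : Module.Finite (ZMod p) V := Module.Finite.of_finite
  constructor
  · refine ⟨Module.finrank (ZMod p) V, ?_, ?_⟩
    · have h1 := LinearMap.rank_le_of_injective T hT
      rw [hrank, ← Module.finrank_eq_rank, Subspace.dual_finrank_eq] at h1
      exact_mod_cast h1
    · have h2 := Module.natCard_eq_pow_finrank (K := ZMod p) (V := V)
      rwa [Nat.card_zmod] at h2
  · intro r s h
    have h1 : ∀ χ : Module.Dual (ZMod p) V, χ (q s) = χ (-q r) := by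
      intro χ
      rw [map_neg]
      exact h _ (T χ).2
    refine sub_eq_zero.1 ((Module.forall_dual_apply_eq_zero_iff (ZMod p) _).1 fun χ => ?_)
    rw [map_sub, h1, sub_self]

/-- In a presentation `F_d / R` of a Schur `σ`-group of rank `d`, a quotient `θ(R)` of `R` that is
central of exponent `p` has rank at most `d`, and `σ` acts on it by inversion. -/
lemma inverted_of_isSchurSigma {G E : Type} [Group G] [TopologicalSpace G] [IsTopologicalGroup G]
    [Group E] [TopologicalSpace E] [IsTopologicalGroup E] [Finite E] [DiscreteTopology E]
    (hG : IsSchurSigma p G) {Φ : FreeProP p d →* G} (hΦ : Continuous Φ)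
    (hs : Function.Surjective Φ) (hΦσ : ∀ x ∈ Φ.ker, freeSigma p d x ∈ Φ.ker)
    (hΦk : Φ.ker ≤ lowerPCentral p (FreeProP p d) 1) (θ : FreeProP p d →* E)
    (hθ : Continuous θ) (hcent : ∀ x ∈ Φ.ker, ∀ y, θ y * θ x = θ x * θ y)
    (hpow : ∀ x ∈ Φ.ker, θ x ^ p = 1) :
    (∃ e ≤ d, Nat.card (Φ.ker.map θ) = p ^ e) ∧
      ∀ x ∈ Φ.ker, θ (freeSigma p d x) = (θ x)⁻¹ := by
  have := hG.proP.t2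
  have := hG.finite_ab
  obtain ⟨n, hfull⟩ := exists_isFullAt hΦ hs
  have hrank : Module.rank (ZMod p) (invHom p Φ.ker) = d := by
    rw [← rank_H2 hΦk hΦ hs, ← hG.rank_eq, rank_H1 hΦk hΦ hs]
  let _ : CommGroup (Φ.ker.map θ) :=
    { (inferInstance : Group (Φ.ker.map θ)) with
      mul_comm := by
        rintro ⟨_, x, hx, rfl⟩ ⟨_, y, hy, rfl⟩
        exact Subtype.ext (hcent y hy x) }
  let _ : Module (ZMod p) (Additive (Φ.ker.map θ)) := AddCommGroup.zmodModule (n := p) (by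
    rintro ⟨_, x, hx, rfl⟩
    exact Subtype.ext (hpow x hx))
  let _ : TopologicalSpace (Additive (Φ.ker.map θ)) := ⊥
  have : DiscreteTopology (Additive (Φ.ker.map θ)) := ⟨rfl⟩
  obtain ⟨h1, h2⟩ := card_le_of_rank_invHom hrank (V := Additive (Φ.ker.map θ))
    (fun r => Additive.ofMul (θ.subgroupMap Φ.ker r))
    ((continuous_of_discreteTopology (f := fun a : Φ.ker.map θ => Additive.ofMul a)).comp
      ((hθ.comp continuous_subtype_val).subtype_mk _)) (θ.subgroupMap_surjective Φ.ker)
    (fun a b => congrArg Additive.ofMul (map_mul (θ.subgroupMap Φ.ker) a b)) (by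
      intro x a
      refine congrArg Additive.ofMul (Subtype.ext ?_)
      change θ (x * a * x⁻¹) = θ a
      rw [map_mul, map_mul, hcent a a.2 x, mul_assoc, ← map_mul, mul_inv_cancel, map_one, mul_one])
  refine ⟨h1, fun x hx => ?_⟩
  exact congrArg (fun w : Additive (Φ.ker.map θ) => ((Additive.toMul w : Φ.ker.map θ) : E))
    (h2 ⟨x, hx⟩ ⟨freeSigma p d x, hΦσ x hx⟩ fun f hf =>
      invHom_freeSigma hfull hrank hf ⟨x, hx⟩ (hΦσ x hx))

end Lifting

/-! ### The lower bound for the mass of a level set -/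

lemma genCount_mul_le {p d e : ℕ} (h : e ≤ d) :
    genCount p d d * (p ^ e) ^ d ≤ genCount p d e * (p ^ d) ^ d := by
  have h1 : genCount p d d = genCount p d e * ∏ i ∈ Finset.Ico e d, (p ^ d - p ^ i) :=
    (Finset.prod_range_mul_prod_Ico _ h).symm
  have h2 : ∏ i ∈ Finset.Ico e d, (p ^ d - p ^ i) ≤ (p ^ d) ^ (d - e) := by
    rw [← Nat.card_Ico e d]
    exact Finset.prod_le_pow_card _ _ _ fun i _ => Nat.sub_le _ _
  have h3 : (p ^ d) ^ d = (p ^ d) ^ (d - e) * (p ^ e) ^ d := by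
    rw [← pow_mul, ← pow_mul, ← pow_mul, ← pow_add]
    congr 1
    obtain ⟨k, rfl⟩ := Nat.exists_eq_add_of_le h
    rw [Nat.add_sub_cancel_left]
    ring
  rw [h1, h3, mul_assoc]
  exact Nat.mul_le_mul_left _ (Nat.mul_le_mul_right _ h2)

/-- The number of members of a finite family of sets that contain a given point. -/
lemma sum_indicator_eq_encard {α β : Type*} {s : Set β} (hs : s.Finite) (T : β → Set α) (r : α) :
    ∑ b ∈ hs.toFinset, (T b).indicator (1 : α → ℝ≥0∞) r =
      (({b | b ∈ s ∧ r ∈ T b}.encard : ℕ∞) : ℝ≥0∞) := by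
  classical
  have h1 : {b | b ∈ s ∧ r ∈ T b} = ((hs.toFinset.filter fun b => r ∈ T b : Finset β) : Set β) := by
    ext b
    simp
  rw [h1, Set.encard_coe_eq_coe_finsetCard, Finset.card_filter, ENat.toENNReal_coe]
  push_cast
  refine Finset.sum_congr rfl fun b _ => ?_
  by_cases h : r ∈ T b <;> simp [h]

section LowerBound

variable {p d c : ℕ} [Fact p.Prime]

/-- A lower bound for the probability that the images in `E` of the random relations generate a
given subgroup `W` that is central, elementary abelian of rank `e ≤ d`, and inverted.  If `X_H` is
the set of inverted elements of the Frattini subgroup of `H = E / W`, then this probability is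
`genCount p d e / (|W| |X_H|) ^ d`, which is smallest for `e = d`. -/
lemma genCount_le_relLaw (hp : Odd p) {E H : Type} [Group E] [TopologicalSpace E]
    [IsTopologicalGroup E] [Finite E] [DiscreteTopology E] [Group H] [TopologicalSpace H]
    [IsTopologicalGroup H] [Finite H] [DiscreteTopology H] (hEp : IsPGroup p E)
    (hEc : lowerPCentral p E c = ⊥) {τE : E →* E} {τ : H →* H} {θ : FreeProP p d →* E}
    (hθ : θ ∈ eqSur (freeSigma p d) τE) (hτE : IsInvolutive p τE) (χ : E →* H)
    (hχs : Function.Surjective χ) (hχσ : ∀ x, χ (τE x) = τ (χ x)) {W : Subgroup E}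
    (hχW : ∀ x, χ x = 1 ↔ x ∈ W) (hWcomm : ∀ a ∈ W, ∀ b : E, b * a = a * b)
    (hWpow : ∀ a ∈ W, a ^ p = 1) (hWinv : ∀ a ∈ W, a ∈ invFrattini p τE) {e : ℕ} (hed : e ≤ d)
    (hWe : Nat.card W = p ^ e) :
    (genCount p d d : ℝ≥0∞) ≤
      relLaw p d {r | (fun i => θ (r i).1) ∈ {s | Subgroup.closure (Set.range s) = W}} *
        (((p ^ d) ^ d * (invFrattini p τ).ncard ^ d : ℕ) : ℝ≥0∞) := by
  have hfib : {x | x ∈ invFrattini p τE ∧ χ x = 1} = (W : Set E) :=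
    Set.ext fun x => ⟨fun h => (hχW x).1 h.2, fun h => ⟨hWinv x h, (hχW x).2 h⟩⟩
  have hXE : (invFrattini p τE).ncard = (invFrattini p τ).ncard * p ^ e := by
    have h1 := ncard_fiberwise χ (invFrattini p τE) (invFrattini p τ) (p ^ e) (fun y hy => by
      rw [ncard_invFrattini_fiber (odd_card_of_isPGroup hp hEp) hτE χ hχs hχσ hy, hfib, ← hWe]
      exact (Nat.card_coe_set_eq _).symm) (invFrattini p τ) subset_rfl
    rw [← h1]
    congr 1
    ext x
    exact ⟨fun hx => ⟨hx, invFrattini_of_mem continuous_of_discreteTopology hχσ hx⟩, fun hx => hx.1⟩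
  rw [relLaw_image hp hEc θ hθ.1 hθ.2.1 hθ.2.2, hXE]
  have hcount : {s : Fin d → E | s ∈ {s : Fin d → E | Subgroup.closure (Set.range s) = W} ∧
      ∀ i, s i ∈ invFrattini p τE}.ncard = genCount p d e := by
    have h1 : {s : Fin d → E | s ∈ {s : Fin d → E | Subgroup.closure (Set.range s) = W} ∧
        ∀ i, s i ∈ invFrattini p τE} = {s | Subgroup.closure (Set.range s) = W} := by
      ext s
      refine ⟨fun h => h.1, fun h => ⟨h, fun i => hWinv _ ?_⟩⟩
      have h' : Subgroup.closure (Set.range s) = W := h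
      exact h'.le (Subgroup.subset_closure ⟨i, rfl⟩)
    rw [h1, ncard_closure_range_eq]
    let _ : CommGroup W :=
      { (inferInstance : Group W) with
        mul_comm := fun a b => Subtype.ext (hWcomm b b.2 a) }
    exact ncard_closure_eq_top (V := W) (fun a => Subtype.ext (hWpow a a.2)) hWe d
  rw [hcount]
  have hX0 : 0 < (invFrattini p τ).ncard := ncard_invFrattini_pos τ
  have hp0 := (Fact.out : p.Prime).pos
  have hne : (((invFrattini p τ).ncard * p ^ e : ℕ) : ℝ≥0∞) ^ d ≠ 0 :=
    pow_ne_zero _ (by exact_mod_cast (Nat.mul_pos hX0 (pow_pos hp0 e)).ne')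
  have hnt : (((invFrattini p τ).ncard * p ^ e : ℕ) : ℝ≥0∞) ^ d ≠ ⊤ :=
    ENNReal.pow_ne_top (ENNReal.natCast_ne_top _)
  rw [← ENNReal.mul_div_right_comm, ENNReal.le_div_iff_mul_le (Or.inl hne) (Or.inl hnt)]
  have h := Nat.mul_le_mul_right ((invFrattini p τ).ncard ^ d) (genCount_mul_le (p := p) hed)
  rw [mul_assoc, mul_assoc, ← mul_pow, mul_comm (p ^ e)] at h
  exact_mod_cast h

/-- Given an equivariant surjection `φ : F_d → H` onto `H ≅ Q_c(G)`, where `G` is a Schur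
`σ`-group of rank `d`, random relations present a group with `Q_c` equal to `F_d / ker φ` with
a probability that is bounded below.  The relations have to lie in `ker φ`, and to generate the
maximal quotient `V` of `ker φ / P_c` that is central and elementary abelian.  Since `V` is also a
quotient of the relation module of `G`, it has rank at most `d`, and `σ` inverts it. -/
lemma exists_event_ker (hp : Odd p) {G H : Type} [Group G] [TopologicalSpace G]
    [IsTopologicalGroup G] [Group H] [TopologicalSpace H] [IsTopologicalGroup H]
    [Finite H] [DiscreteTopology H] (hG : IsSchurSigma p G) (hH : IsPGroup p H) {σ : G →* G}
    (hσc : Continuous σ) (hσ : IsInvolutive p σ) {τ : H →* H}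
    {π : G →* H} (hπ : π ∈ eqSur σ τ) (hc : 1 ≤ c) (hker : π.ker = lowerPCentral p G c)
    (hd : Nat.card (QuotClass p H 1) = p ^ d) {φ : FreeProP p d →* H}
    (hφ : φ ∈ eqSur (freeSigma p d) τ) :
    ∃ T : Set (Fin d → Relator p d), MeasurableSet T ∧
      (∀ r ∈ T, relSubgroup r ⊔ lowerPCentral p (FreeProP p d) c = φ.ker) ∧
      (genCount p d d : ℝ≥0∞) ≤
        relLaw p d T * (((p ^ d) ^ d * (invFrattini p τ).ncard ^ d : ℕ) : ℝ≥0∞) := by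
  have := hG.proP.compact
  have := hG.proP.t2
  have hHc : lowerPCentral p H c = ⊥ := by
    rw [← map_lowerPCentral π hπ.1 hπ.2.1 c, ← hker]
    exact (Subgroup.map_eq_bot_iff _).2 le_rfl
  obtain ⟨Φ, hΦ, hcomp⟩ := exists_lift_eqSur hp hG.proP hH hσc hσ hπ
    (hker.trans_le (lowerPCentral_antitone p G hc)) hφ
  obtain ⟨ψ, hψ⟩ := exists_factor hHc φ hφ.1
  have hψs : Function.Surjective ψ := fun y => by
    obtain ⟨x, hx⟩ := hφ.2.1 y
    exact ⟨x, (hψ x).trans hx⟩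
  have hφk : φ.ker ≤ lowerPCentral p (FreeProP p d) 1 :=
    ker_le_lowerPCentral_one φ hφ.1 hφ.2.1 ((card_quotClass_one_free_le p d).trans_eq hd.symm)
  -- the kernel of `φ` is generated by the kernel of the lift and `P_c`
  have hφΦ : φ.ker = lowerPCentral p (FreeProP p d) c ⊔ Φ.ker := by
    rw [← hcomp, ← MonoidHom.comap_ker, hker, ← map_lowerPCentral Φ hΦ.1 hΦ.2.1 c,
      Subgroup.comap_map_eq]
  have hψσ : ∀ x, ψ (sigmaLevel p d c x) = τ (ψ x) := by
    intro x
    obtain ⟨y, rfl⟩ := QuotientGroup.mk_surjective x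
    rw [hψ, ← hφ.2.2, ← hψ]
    rfl
  -- `K = ker φ / P_c`, and `V = K / [Q_c, K] Kᵖ` is the subgroup `W` of `E`
  let K : Subgroup (QuotClass p (FreeProP p d) c) := ψ.ker
  have hmemK : ∀ x : FreeProP p d, (x : QuotClass p (FreeProP p d) c) ∈ K ↔ x ∈ φ.ker := by
    intro x
    rw [MonoidHom.mem_ker, MonoidHom.mem_ker, hψ]
  obtain ⟨hcomm, hpow⟩ := relFrattini_le_iff.1 (le_refl (relFrattini p K))
  let E := QuotClass p (FreeProP p d) c ⧸ relFrattini p K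
  have hEd : DiscreteTopology E := QuotientGroup.discreteTopology (isOpen_discrete _)
  have hEp : IsPGroup p E := (isPGroup_level p d c).to_quotient _
  have hEc : lowerPCentral p E c = ⊥ := by
    rw [← map_lowerPCentral (QuotientGroup.mk' (relFrattini p K)) continuous_quotient_mk'
      (QuotientGroup.mk'_surjective _) c, lowerPCentral_quotClass, Subgroup.map_bot]
  have hσK : relFrattini p K ≤ (relFrattini p K).comap (sigmaLevel p d c) := by
    have hKσ : ∀ x ∈ K, sigmaLevel p d c x ∈ K := fun x hx => by
      rw [MonoidHom.mem_ker, hψσ, (MonoidHom.mem_ker).1 hx, map_one]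
    refine relFrattini_le_iff.2 ⟨fun g x hx => ?_, fun x hx => ?_⟩
    · rw [Subgroup.mem_comap, map_commutatorElement]
      exact hcomm _ _ (hKσ x hx)
    · rw [Subgroup.mem_comap, map_pow]
      exact hpow _ (hKσ x hx)
  let τE : E →* E := QuotientGroup.map _ _ (sigmaLevel p d c) hσK
  let θ : FreeProP p d →* E := (QuotientGroup.mk' (relFrattini p K)).comp (QuotientGroup.mk' _)
  have hθc : Continuous θ := continuous_quotient_mk'.comp continuous_quotient_mk'
  have hθs : Function.Surjective θ :=
    (QuotientGroup.mk'_surjective _).comp (QuotientGroup.mk'_surjective _)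
  have hθσ : ∀ x, θ (freeSigma p d x) = τE (θ x) := fun _ => rfl
  have hτE : IsInvolutive p τE :=
    (FreeProP.isInvolutive_freeSigma p d).of_surjective θ hθc hθs hθσ
  have hΦφ : Φ.ker ≤ φ.ker := hφΦ ▸ le_sup_right
  obtain ⟨⟨e, hed, hWe⟩, hinv⟩ := inverted_of_isSchurSigma hG hΦ.1 hΦ.2.1
    (fun x hx => by rw [MonoidHom.mem_ker, hΦ.2.2, (MonoidHom.mem_ker).1 hx, map_one])
    (hΦφ.trans hφk) θ hθc
    (fun x hx y => commutatorElement_eq_one_iff_mul_comm.1 (by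
      rw [← map_commutatorElement]
      exact (QuotientGroup.eq_one_iff _).2 (hcomm y x ((hmemK x).2 (hΦφ hx)))))
    (fun x hx => by
      rw [← map_pow]
      exact (QuotientGroup.eq_one_iff _).2 (hpow x ((hmemK x).2 (hΦφ hx))))
  set W : Subgroup E := Φ.ker.map θ with hW
  have hWcomm : ∀ a ∈ W, ∀ b : E, b * a = a * b := by
    rintro _ ⟨x, hx, rfl⟩ b
    obtain ⟨y, rfl⟩ := hθs b
    refine commutatorElement_eq_one_iff_mul_comm.1 ?_
    rw [← map_commutatorElement]
    exact (QuotientGroup.eq_one_iff _).2 (hcomm y x ((hmemK x).2 (hΦφ hx)))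
  have hWpow : ∀ a ∈ W, a ^ p = 1 := by
    rintro _ ⟨x, hx, rfl⟩
    rw [← map_pow]
    exact (QuotientGroup.eq_one_iff _).2 (hpow x ((hmemK x).2 (hΦφ hx)))
  have hWφ : ∀ x, θ x ∈ W ↔ x ∈ φ.ker := by
    intro x
    constructor
    · rintro ⟨y, hy, hyx⟩
      rw [← hmemK]
      have h1 : (y : QuotClass p (FreeProP p d) c)⁻¹ * x ∈ relFrattini p K := QuotientGroup.eq.1 hyx
      have h2 := mul_mem ((hmemK y).2 (hΦφ hy)) (relFrattini_le K h1)
      rwa [mul_inv_cancel_left] at h2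
    · intro hx
      rw [hφΦ] at hx
      obtain ⟨a, ha, b, hb, rfl⟩ := Subgroup.mem_sup_of_normal_left.1 hx
      refine ⟨b, hb, ?_⟩
      have h1 : (QuotientGroup.mk' (lowerPCentral p (FreeProP p d) c)) a = 1 :=
        (QuotientGroup.eq_one_iff a).2 ha
      have : θ a = 1 := by
        change (QuotientGroup.mk' (relFrattini p K)) ((QuotientGroup.mk' _) a) = 1
        rw [h1, map_one]
      rw [map_mul, this, one_mul]
  have hWinv : ∀ a ∈ W, a ∈ invFrattini p τE := by
    rintro _ ⟨x, hx, rfl⟩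
    exact ⟨map_mem_lowerPCentral θ hθc 1 (hφk (hΦφ hx)), by rw [← hθσ, hinv x hx]⟩
  -- the map `E → H`, with kernel `W`
  let χ : E →* H := QuotientGroup.lift _ ψ (relFrattini_le K)
  have hχθ : ∀ x, χ (θ x) = φ x := hψ
  have hχs : Function.Surjective χ := fun y => by
    obtain ⟨x, hx⟩ := hφ.2.1 y
    exact ⟨θ x, (hχθ x).trans hx⟩
  have hχσ : ∀ x, χ (τE x) = τ (χ x) := by
    intro x
    obtain ⟨y, rfl⟩ := hθs x
    rw [← hθσ, hχθ, hχθ, hφ.2.2]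
  have hχW : ∀ x, χ x = 1 ↔ x ∈ W := by
    intro x
    obtain ⟨y, rfl⟩ := hθs x
    rw [hχθ, hWφ, MonoidHom.mem_ker]
  refine ⟨{r | (fun i => θ (r i).1) ∈ {s | Subgroup.closure (Set.range s) = W}},
    measurableSet_image hEc θ hθc _, fun r hr => ?_, ?_⟩
  · have hr' : Subgroup.closure (Set.range fun i => θ (r i).1) = W := hr
    have hrφ : relSubgroup r ≤ φ.ker := relSubgroup_le r
      (K := φ.ker) ((isClosed_discrete ({1} : Set H)).preimage hφ.1) fun i =>
        (hWφ _).1 (hr'.le (Subgroup.subset_closure ⟨i, rfl⟩))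
    let N := (relSubgroup r).map (QuotientGroup.mk' (lowerPCentral p (FreeProP p d) c))
    have hN : N.Normal := Subgroup.Normal.map inferInstance _ (QuotientGroup.mk'_surjective _)
    have hKN : K ≤ N := by
      refine le_of_le_sup_relFrattini (lowerPCentral_quotClass (G := FreeProP p d) c) fun k hk => ?_
      obtain ⟨x, rfl⟩ := QuotientGroup.mk_surjective k
      have h1 : θ x ∈ W := (hWφ x).2 ((hmemK x).1 hk)
      have h2 : W ≤ N.map (QuotientGroup.mk' (relFrattini p K)) := by
        rw [← hr', Subgroup.closure_le]
        rintro _ ⟨i, rfl⟩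
        exact ⟨_, ⟨_, mem_relSubgroup r i, rfl⟩, rfl⟩
      have h3 : (x : QuotClass p (FreeProP p d) c) ∈
          (N.map (QuotientGroup.mk' (relFrattini p K))).comap
            (QuotientGroup.mk' (relFrattini p K)) := h2 h1
      rwa [Subgroup.comap_map_eq, QuotientGroup.ker_mk'] at h3
    refine le_antisymm (sup_le hrφ (hφΦ ▸ le_sup_left)) fun x hx => ?_
    have h1 : x ∈ N.comap (QuotientGroup.mk' (lowerPCentral p (FreeProP p d) c)) :=
      hKN ((hmemK x).2 hx)
    rwa [Subgroup.comap_map_eq, QuotientGroup.ker_mk'] at h1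
  · exact genCount_le_relLaw hp hEp hEc ⟨hθc, hθs, hθσ⟩ hτE χ hχs hχσ hχW hWcomm hWpow hWinv hed hWe

/-- A lower bound for the mass that `μ_BBH` gives to a level set `{G | Q_c(G) ≅ H}`, weighted by
the number of equivariant automorphisms of `H`. There are `genCount p d d * |X_H| ^ d` equivariant
surjections `φ : F_d → H`, where `d` is the rank of `H`, each with its event of `exists_event_ker`,
and the events that contain a given tuple of relations are those of surjections with the same
kernel, which differ by equivariant automorphisms of `H`. Thus the random group of rank `d` is in
the level set with a weighted probability of at least `presConst p d`, and `μ_CL(d)` is the inverse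
of `presConst p d * clTotal p`. -/
theorem inv_clTotal_le (hp : Odd p) {G H : Type} [Group G] [TopologicalSpace G]
    [IsTopologicalGroup G] [Group H] [TopologicalSpace H] [IsTopologicalGroup H]
    [Finite H] [DiscreteTopology H] (hG : IsSchurSigma p G) (hH : IsPGroup p H) {τ : H →* H}
    (hτ : IsInvolutive p τ) (hc : 1 ≤ c) (e : QuotClass p G c ≃* H) :
    (clTotal p)⁻¹ ≤ muBBH p (quotClassSet p c H) * ((eqSur τ τ).encard : ℝ≥0∞) := by
  have := hG.proP.compact
  have := hG.proP.t2
  obtain ⟨σ, hσ⟩ := hG.exists_GI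
  have hσc : Continuous (σ : G →* G) := σ.continuous_toFun
  have hσi : IsInvolutive p (σ : G →* G) := hσ.isInvolutive
  obtain ⟨π, hπ, hker⟩ := exists_eqSur_of_equiv hp hH hG.fg hσc hσi hτ e
  obtain ⟨d, hd⟩ := IsPGroup.iff_card.1 (hH.to_quotient (lowerPCentral p H 1))
  have hfin := finite_eqSur_free hp hH hτ d
  have hcard := encard_eqSur_free hp hH hτ hd d
  have := isProbabilityMeasure_muX (p := p) (g := d) hp
  let B : Set (Fin d → Relator p d) :=
    {r | Nonempty (QuotClass p (FreeProP p d ⧸ relSubgroup r) c ≃* H)}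
  have hB : MeasurableSet B := measurableSet_nonempty_quotClass c H
  choose! T hTm hTk hTl using fun (φ : FreeProP p d →* H) (hφ : φ ∈ eqSur (freeSigma p d) τ) =>
    exists_event_ker hp hG hH hσc hσi hπ hc hker hd hφ
  have hTB : ∀ φ ∈ eqSur (freeSigma p d) τ, T φ ⊆ B := by
    intro φ hφ r hr
    exact nonempty_quotClass_equiv (QuotientGroup.mk' (relSubgroup r)) continuous_quotient_mk'
      (QuotientGroup.mk'_surjective _) φ hφ.2.1 (by
        rw [QuotientGroup.ker_mk', hTk φ hφ r hr])
  have hpt : ∀ r, ∑ φ ∈ hfin.toFinset, (T φ).indicator (1 : (Fin d → Relator p d) → ℝ≥0∞) r ≤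
      B.indicator (fun _ => ((eqSur τ τ).encard : ℝ≥0∞)) r := by
    intro r
    rw [sum_indicator_eq_encard]
    by_cases hne : ∃ φ₀ ∈ eqSur (freeSigma p d) τ, r ∈ T φ₀
    · obtain ⟨φ₀, hφ₀, hr⟩ := hne
      rw [Set.indicator_of_mem (hTB φ₀ hφ₀ hr), ← encard_eqSur_comp (ρ := τ) hφ₀]
      refine ENat.toENNReal_le.2 (Set.encard_le_encard fun φ hφ => ⟨hφ.1, ?_⟩)
      rw [← hTk φ₀ hφ₀ r hr, ← hTk φ hφ.1 r hφ.2]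
    · have : {φ | φ ∈ eqSur (freeSigma p d) τ ∧ r ∈ T φ} = ∅ :=
        Set.eq_empty_of_forall_notMem fun φ hφ => hne ⟨φ, hφ.1, hφ.2⟩
      rw [this, Set.encard_empty]
      exact (ENat.toENNReal_zero).trans_le (zero_le)
  have hint := lintegral_mono (μ := relLaw p d) hpt
  rw [lintegral_finsetSum' _ (fun φ hφ => (measurable_one.indicator
      (hTm φ (hfin.mem_toFinset.1 hφ))).aemeasurable), lintegral_indicator_const hB] at hint
  rw [Finset.sum_congr rfl (fun φ hφ =>
    lintegral_indicator_one (hTm φ (hfin.mem_toFinset.1 hφ)))] at hint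
  set X := (invFrattini p τ).ncard with hX
  have hX0 : 0 < X := ncard_invFrattini_pos τ
  have hp0 := (Fact.out : p.Prime).pos
  have hpres : presConst p d ≤ ∑ φ ∈ hfin.toFinset, relLaw p d (T φ) := by
    have hcard' : (hfin.toFinset.card : ℕ) = genCount p d d * X ^ d := by
      have := hfin.encard_eq_coe_toFinset_card
      rw [hcard] at this
      exact_mod_cast this.symm
    have hD0 : (((p ^ d) ^ d * X ^ d : ℕ) : ℝ≥0∞) ≠ 0 := by
      exact_mod_cast (Nat.mul_pos (pow_pos (pow_pos hp0 _) _) (pow_pos hX0 _)).ne'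
    have hDt : (((p ^ d) ^ d * X ^ d : ℕ) : ℝ≥0∞) ≠ ⊤ := ENNReal.natCast_ne_top _
    have h1 : ∑ φ ∈ hfin.toFinset, (genCount p d d : ℝ≥0∞) ≤
        ∑ φ ∈ hfin.toFinset, relLaw p d (T φ) * (((p ^ d) ^ d * X ^ d : ℕ) : ℝ≥0∞) :=
      Finset.sum_le_sum fun φ hφ => hTl φ (hfin.mem_toFinset.1 hφ)
    rw [Finset.sum_const, hcard', ← Finset.sum_mul, nsmul_eq_mul] at h1
    have hXd0 : (X : ℝ≥0∞) ^ d ≠ 0 := pow_ne_zero _ (by exact_mod_cast hX0.ne')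
    have hXdt : (X : ℝ≥0∞) ^ d ≠ ⊤ := ENNReal.pow_ne_top (ENNReal.natCast_ne_top _)
    rw [presConst]
    refine ENNReal.div_le_of_le_mul ?_
    rw [← ENNReal.mul_le_mul_iff_left hXd0 hXdt]
    push_cast at h1
    calc _ = (genCount p d d : ℝ≥0∞) * (X : ℝ≥0∞) ^ d * (genCount p d d : ℝ≥0∞) := by ring
      _ ≤ _ := h1
      _ = _ := by ring
  have hrel : relLaw p d B ≤ relLaw p d (relEvent p d (quotClassSet p c H)) := by
    rw [relEvent_quotClassSet, Set.inter_comm]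
    refine (measure_inter_conull ?_).ge
    rw [prob_compl_eq_zero_iff measurableSet_relEvent_univ]
    exact relLaw_relEvent_univ hp
  calc (clTotal p)⁻¹ = (presConst p d)⁻¹ * (clTotal p)⁻¹ * presConst p d := by
        rw [mul_right_comm, ENNReal.inv_mul_cancel presConst_ne_zero presConst_ne_top, one_mul]
    _ ≤ muCL p d * (((eqSur τ τ).encard : ℝ≥0∞) *
          relLaw p d (relEvent p d (quotClassSet p c H))) := by
        rw [muCL_eq hp]
        gcongr
        exact hpres.trans (hint.trans (mul_le_mul_right hrel _))
    _ = muCL p d * relLaw p d (relEvent p d (quotClassSet p c H)) *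
          ((eqSur τ τ).encard : ℝ≥0∞) := by ring
    _ ≤ _ := mul_le_mul_left (ENNReal.le_tsum (f := fun g => muCL p g *
          Measure.pi (fun _ : Fin g => muX p g) (relEvent p g (quotClassSet p c H))) d) _

end LowerBound

/-! ### Uniqueness in a moment problem -/

section Contraction

/-- Uniqueness in a moment problem with a dominant diagonal.  In terms of the normalized masses
`ν k * S k k` and `μ k * S k k`, the moment equations bound the distance of `ν` and `μ` by
`T - 1 < 1` times itself. -/
lemma eq_of_moments {J : Type*} {ν μ : J → ℝ≥0∞} {S : J → J → ℝ≥0∞} {T : ℝ≥0∞} (hT : T < 2)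
    (hν : ∀ j, ∑' k, ν k * S k j = 1) (hμ : ∀ j, ∑' k, μ k * S k j = 1)
    (h0 : ∀ j, S j j ≠ 0) (ht : ∀ j, S j j ≠ ⊤) (hlow : ∀ j, 1 ≤ T * (μ j * S j j)) : ν = μ := by
  classical
  have hsplit : ∀ (f : J → ℝ≥0∞) (j : J), ∑' k, f k * S k j =
      f j * S j j + ∑' k, if k = j then 0 else f k * S k j :=
    fun f j => ENNReal.tsum_eq_add_tsum_ite j
  set off : (J → ℝ≥0∞) → J → ℝ≥0∞ := fun f j => ∑' k, if k = j then 0 else f k * S k j with hoff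
  have hρ : ∀ j, T * off μ j ≤ T - 1 := by
    intro j
    refine ENNReal.le_sub_of_add_le_right ENNReal.one_ne_top ?_
    calc T * off μ j + 1 ≤ T * off μ j + T * (μ j * S j j) := by gcongr; exact hlow j
      _ = T * (μ j * S j j + off μ j) := by ring
      _ = T := by rw [← hsplit μ j, hμ, mul_one]
  have hS : ∀ k, (S k k)⁻¹ ≤ T * μ k := by
    intro k
    rw [← one_div]
    exact ENNReal.div_le_of_le_mul ((hlow k).trans_eq (mul_assoc _ _ _).symm)
  have step : ∀ (α β : J → ℝ≥0∞), (∀ j, ∑' k, α k * S k j = 1) → (∀ j, ∑' k, β k * S k j = 1) →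
      ∀ x, (∀ k, α k * S k k ≤ β k * S k k + x) →
        ∀ j, β j * S j j ≤ α j * S j j + x * (T - 1) := by
    intro α β hα hβ x hx j
    have h1 : ∀ k, α k ≤ β k + x * (T * μ k) := by
      intro k
      calc α k = α k * S k k * (S k k)⁻¹ := by
            rw [mul_assoc, ENNReal.mul_inv_cancel (h0 k) (ht k), mul_one]
        _ ≤ (β k * S k k + x) * (S k k)⁻¹ := by gcongr; exact hx k
        _ = β k + x * (S k k)⁻¹ := by
            rw [add_mul, mul_assoc, ENNReal.mul_inv_cancel (h0 k) (ht k), mul_one]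
        _ ≤ _ := by gcongr; exact hS k
    have h2 : off α j ≤ off β j + x * (T * off μ j) := by
      simp only [hoff, ← ENNReal.tsum_mul_left, ← ENNReal.tsum_add]
      refine ENNReal.tsum_le_tsum fun k => ?_
      split_ifs with h
      · simp
      · calc α k * S k j ≤ (β k + x * (T * μ k)) * S k j := by gcongr; exact h1 k
          _ = _ := by ring
    have h3 : off β j ≠ ⊤ := by
      refine ne_top_of_le_ne_top ENNReal.one_ne_top ?_
      rw [← hβ j, hsplit β j]
      exact le_add_self
    have h4 : β j * S j j + off β j ≤ α j * S j j + x * (T - 1) + off β j := by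
      calc β j * S j j + off β j = α j * S j j + off α j := by
            rw [← hsplit β j, hβ, ← hsplit α j, hα]
        _ ≤ α j * S j j + (off β j + x * (T * off μ j)) := by gcongr
        _ ≤ α j * S j j + (off β j + x * (T - 1)) := by gcongr; exact hρ j
        _ = _ := by ring
    exact (ENNReal.add_le_add_iff_right h3).1 h4
  have hle1 : ∀ α : J → ℝ≥0∞, (∀ j, ∑' k, α k * S k j = 1) → ∀ j, α j * S j j ≤ 1 := by
    intro α hα j
    rw [← hα j, hsplit α j]
    exact le_self_add
  have iter : ∀ n : ℕ, (∀ k, ν k * S k k ≤ μ k * S k k + (T - 1) ^ n) ∧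
      ∀ k, μ k * S k k ≤ ν k * S k k + (T - 1) ^ n := by
    intro n
    induction n with
    | zero =>
      simp only [pow_zero]
      exact ⟨fun k => (hle1 ν hν k).trans le_add_self, fun k => (hle1 μ hμ k).trans le_add_self⟩
    | succ n ih =>
      simp only [pow_succ]
      exact ⟨step μ ν hμ hν _ ih.2, step ν μ hν hμ _ ih.1⟩
  have hT1 : T - 1 < 1 := by
    by_cases h : 1 ≤ T
    · refine (ENNReal.sub_lt_iff_lt_right ENNReal.one_ne_top h).2 ?_
      rwa [one_add_one_eq_two]
    · rw [tsub_eq_zero_of_le (not_le.1 h).le]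
      exact zero_lt_one
  have hlim : ∀ x : ℝ≥0∞, Tendsto (fun n : ℕ => x + (T - 1) ^ n) atTop (nhds (x + 0)) := fun x =>
    tendsto_const_nhds.add (ENNReal.tendsto_pow_atTop_nhds_zero_of_lt_one hT1)
  funext j
  have h1 : ν j * S j j = μ j * S j j := by
    refine le_antisymm ?_ ?_
    · have := ge_of_tendsto' (hlim (μ j * S j j)) fun n => (iter n).1 j
      rwa [add_zero] at this
    · have := ge_of_tendsto' (hlim (ν j * S j j)) fun n => (iter n).2 j
      rwa [add_zero] at this
  exact (ENNReal.mul_left_inj (h0 j) (ht j)).1 h1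

end Contraction

/-! ### The partition according to `Q_c` -/

section LevelSets

variable {p : ℕ} [Fact p.Prime]

instance (G : SchurSigmaGrp p) : CompactSpace G.carrier := G.isSchur.proP.compact

instance (G : SchurSigmaGrp p) : T2Space G.carrier := G.isSchur.proP.t2

instance (G : SchurSigmaGrp p) (c : ℕ) : DiscreteTopology (QuotClass p G.carrier c) :=
  discreteTopology_quotClass G.isSchur.fg c

instance (G : SchurSigmaGrp p) (c : ℕ) : Finite (QuotClass p G.carrier c) :=
  finite_quotClass G.isSchur.fg c

lemma isPGroup_schur (G : SchurSigmaGrp p) (c : ℕ) : IsPGroup p (QuotClass p G.carrier c) :=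
  isPGroup_quotClass G.isSchur.proP G.isSchur.fg c

omit [Fact p.Prime] in
lemma mk_rep (C : SchurClass p) : SchurClass.mk C.rep = C := Quotient.out_eq C

omit [Fact p.Prime] in
lemma mem_quotClassSet {c : ℕ} {P : Type} [Group P] {C : SchurClass p} :
    C ∈ quotClassSet p c P ↔ Nonempty (QuotClass p C.rep.carrier c ≃* P) := by
  rw [← mem_quotClassSet_mk, mk_rep]

/-- The isomorphism of topological groups underlying an isomorphism of discrete groups. -/
def discreteEquiv {H K : Type} [Group H] [TopologicalSpace H] [DiscreteTopology H] [Group K]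
    [TopologicalSpace K] [DiscreteTopology K] (e : H ≃* K) : H ≃ₜ* K :=
  { e with
    continuous_toFun := continuous_of_discreteTopology
    continuous_invFun := continuous_of_discreteTopology }

lemma exists_isGI_quotClass (G : SchurSigmaGrp p) (c : ℕ) :
    ∃ σ : QuotClass p G.carrier c ≃ₜ* QuotClass p G.carrier c, IsGI σ := by
  obtain ⟨σ, hσ⟩ := G.isSchur.exists_GI
  exact ⟨discreteEquiv (quotClassCongr p σ c), hσ.of_surjective (QuotientGroup.mk' _)
    continuous_quotient_mk' (QuotientGroup.mk'_surjective _) _ fun _ => rfl⟩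

/-- The chosen GI-automorphism of `Q_c(G)`, as a homomorphism. -/
def levelInv (c : ℕ) (C : SchurClass p) :
    QuotClass p C.rep.carrier c →* QuotClass p C.rep.carrier c :=
  (chosenGI (QuotClass p C.rep.carrier c) : _ →* _)

lemma isInvolutive_levelInv (c : ℕ) (C : SchurClass p) : IsInvolutive p (levelInv c C) :=
  (isGI_chosenGI (exists_isGI_quotClass C.rep c)).isInvolutive

/-- The set of classes with the same `Q_c` as a given one. -/
def levelSet (c : ℕ) (C : SchurClass p) : Set (SchurClass p) :=
  quotClassSet p c (QuotClass p C.rep.carrier c)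

omit [Fact p.Prime] in
lemma mem_levelSet_self (c : ℕ) (C : SchurClass p) : C ∈ levelSet c C :=
  mem_quotClassSet.2 ⟨MulEquiv.refl _⟩

omit [Fact p.Prime] in
lemma quotClassSet_eq_levelSet {c : ℕ} {P : Type} [Group P] {C : SchurClass p}
    (h : C ∈ quotClassSet p c P) : quotClassSet p c P = levelSet c C := by
  obtain ⟨e⟩ := mem_quotClassSet.1 h
  ext D
  rw [levelSet, mem_quotClassSet, mem_quotClassSet]
  exact ⟨fun ⟨f⟩ => ⟨f.trans e.symm⟩, fun ⟨f⟩ => ⟨f.trans e⟩⟩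

lemma measurableSet_levelSet (c : ℕ) (C : SchurClass p) : MeasurableSet (levelSet c C) :=
  MeasurableSpace.measurableSet_generateFrom
    ⟨c, _, inferInstance, inferInstance, isPGroup_schur C.rep c, rfl⟩

variable (p) in
/-- The index set of the partition of the set of isomorphism classes according to `Q_c`. -/
abbrev LevelIndex (c : ℕ) : Type 1 := Set.range (levelSet (p := p) c)

/-- A class in a given part of the partition. -/
def LevelIndex.rep {c : ℕ} (j : LevelIndex p c) : SchurClass p := j.2.choose

omit [Fact p.Prime] in
lemma LevelIndex.levelSet_rep {c : ℕ} (j : LevelIndex p c) : levelSet c j.rep = j.1 :=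
  j.2.choose_spec

instance (n : ℕ) : Finite (Group (Fin n)) :=
  Finite.of_injective (fun G : Group (Fin n) => (G.mul : Fin n → Fin n → Fin n))
    fun _ _ h => Group.ext h

instance (c : ℕ) : Countable (LevelIndex p c) := by
  rw [Set.countable_coe_iff]
  refine (Set.countable_range fun x : Σ n : ℕ, Group (Fin n) =>
    @quotClassSet p c (Fin x.1) x.2).mono ?_
  rintro _ ⟨C, rfl⟩
  let e := Finite.equivFin (QuotClass p C.rep.carrier c)
  let G : Group (Fin (Nat.card (QuotClass p C.rep.carrier c))) := e.symm.group
  refine ⟨⟨_, G⟩, ?_⟩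
  exact @quotClassSet_eq_levelSet p c _ G C ((@mem_quotClassSet p c _ G C).2
    ⟨@MulEquiv.symm _ _ e.symm.mul _ e.symm.mulEquiv⟩)

omit [Fact p.Prime] in
lemma pairwise_disjoint_level (c : ℕ) :
    Pairwise (Function.onFun Disjoint fun j : LevelIndex p c => j.1) := by
  rintro ⟨_, C, rfl⟩ ⟨_, D, rfl⟩ hne
  refine Set.disjoint_left.2 fun E hE hE' => hne (Subtype.ext ?_)
  change levelSet c C = levelSet c D
  exact (quotClassSet_eq_levelSet hE).trans (quotClassSet_eq_levelSet hE').symm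

omit [Fact p.Prime] in
lemma iUnion_level (c : ℕ) : ⋃ j : LevelIndex p c, j.1 = Set.univ :=
  Set.eq_univ_of_forall fun C => Set.mem_iUnion.2 ⟨⟨_, C, rfl⟩, mem_levelSet_self c C⟩

lemma measurableSet_level_index {c : ℕ} (j : LevelIndex p c) : MeasurableSet j.1 := by
  rw [← j.levelSet_rep]
  exact measurableSet_levelSet c _

/-- The number of equivariant surjections between the groups `Q_c` of two classes. -/
def surCount {c : ℕ} (k j : LevelIndex p c) : ℝ≥0∞ :=
  ((eqSur (levelInv c k.rep) (levelInv c j.rep)).encard : ℝ≥0∞)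

lemma surCount_ne_top {c : ℕ} (k j : LevelIndex p c) : surCount k j ≠ ⊤ := by
  rw [surCount, ENat.toENNReal_ne_top]
  exact Set.encard_ne_top_iff.2 (Set.toFinite _)

lemma surCount_self_ne_zero {c : ℕ} (j : LevelIndex p c) : surCount j j ≠ 0 := by
  rw [surCount, ne_eq, ENat.toENNReal_eq_zero, Set.encard_eq_zero]
  exact (Set.nonempty_iff_ne_empty).1 ⟨MonoidHom.id _, continuous_id, Function.surjective_id,
    fun _ => rfl⟩

end LevelSets

/-! ### The moments of `μ_BBH`, and the identification of `ν` -/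

section Moments

variable {p : ℕ} [Fact p.Prime]

lemma encard_surSigma (G H : Type) [Group G] [TopologicalSpace G] [IsTopologicalGroup G]
    [Group H] [TopologicalSpace H] [IsTopologicalGroup H] :
    (SurSigma G H).encard =
      (eqSur (chosenGI G : G →* G) (chosenGI H : H →* H)).encard := by
  have hinj : Function.Injective fun φ : G →ₜ* H => (φ : G →* H) := fun φ ψ h =>
    ContinuousMonoidHom.ext fun x => DFunLike.congr_fun h x
  rw [← hinj.encard_image]
  congr 1
  ext φ
  constructor
  · rintro ⟨ψ, ⟨h1, h2⟩, rfl⟩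
    exact ⟨ψ.continuous_toFun, h1, h2⟩
  · rintro ⟨h1, h2, h3⟩
    exact ⟨⟨φ, h1⟩, ⟨h2, h3⟩, rfl⟩

lemma lowerPCentral_le_ker {G H : Type} [Group G] [TopologicalSpace G] [IsTopologicalGroup G]
    [Group H] [TopologicalSpace H] [IsTopologicalGroup H] {c : ℕ}
    (hH : lowerPCentral p H c = ⊥) {φ : G →* H} (hφ : Continuous φ) :
    lowerPCentral p G c ≤ φ.ker := fun x hx => by
  have := map_mem_lowerPCentral φ hφ c hx
  rwa [hH, Subgroup.mem_bot] at this

lemma encard_surSigma_level (hp : Odd p) {c : ℕ} {k j : LevelIndex p c} {C : SchurClass p}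
    (hC : C ∈ k.1) :
    ((SurSigma C.rep.carrier (QuotClass p j.rep.rep.carrier c)).encard : ℝ≥0∞) =
      surCount k j := by
  rw [← k.levelSet_rep] at hC
  obtain ⟨e⟩ := mem_quotClassSet.1 hC
  have hGI := isGI_chosenGI C.rep.isSchur.exists_GI
  obtain ⟨π, hπ, hker⟩ := exists_eqSur_of_equiv hp (isPGroup_schur k.rep.rep c) C.rep.isSchur.fg
    (chosenGI C.rep.carrier).continuous_toFun hGI.isInvolutive (isInvolutive_levelInv c k.rep) e
  rw [encard_surSigma, surCount, ← encard_eqSur_comp (ρ := levelInv c j.rep) hπ]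
  congr 2
  ext φ
  refine ⟨fun h => ⟨h, ?_⟩, fun h => h.1⟩
  rw [hker]
  exact lowerPCentral_le_ker (lowerPCentral_quotClass c) h.1

/-- The moments of a measure in terms of its masses on the parts of the partition by `Q_c`. -/
lemma moment_level (hp : Odd p) (ν : Measure (SchurClass p)) {c : ℕ} (j : LevelIndex p c) :
    moment ν (QuotClass p j.rep.rep.carrier c) = ∑' k : LevelIndex p c, ν k.1 * surCount k j := by
  rw [moment, ← setLIntegral_univ, ← iUnion_level c,
    lintegral_iUnion measurableSet_level_index (pairwise_disjoint_level c)]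
  refine tsum_congr fun k => ?_
  rw [setLIntegral_congr_fun (measurableSet_level_index k) fun C hC =>
    encard_surSigma_level hp hC, setLIntegral_const, mul_comm]

/-- For random relations that present a group with `Q_c ≅ Q_c(k)`, the equivariant surjections of
`F_g` onto `Q_c(j)` that kill the relations are counted by `surCount k j`. -/
lemma encard_killing (hp : Odd p) {g c : ℕ} {k j : LevelIndex p c} {r : Fin g → Relator p g}
    (hr : r ∈ relEvent p g k.1) :
    (({φ | φ ∈ eqSur (freeSigma p g) (levelInv c j.rep) ∧ ∀ i, φ (r i).1 = 1}.encard : ℕ∞) :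
      ℝ≥0∞) = surCount k j := by
  rw [← k.levelSet_rep] at hr
  obtain ⟨h, hr⟩ := hr
  obtain ⟨e⟩ := (mem_quotClassSet_mk _).1 hr
  have := h.proP.compact
  have := h.proP.t2
  obtain ⟨σ, hσ, hσr⟩ := exists_isGI_quotient fun _ => freeSigma_mem_relSubgroup r
  obtain ⟨π, hπ, hker⟩ := exists_eqSur_of_equiv hp (isPGroup_schur k.rep.rep c) h.fg
    (σ := (σ : _ →* _)) σ.continuous_toFun hσ.isInvolutive (isInvolutive_levelInv c k.rep) e
  have hπ' : π.comp (QuotientGroup.mk' (relSubgroup r)) ∈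
      eqSur (freeSigma p g) (levelInv c k.rep) := by
    refine ⟨hπ.1.comp continuous_quotient_mk', hπ.2.1.comp (QuotientGroup.mk'_surjective _),
      fun x => ?_⟩
    rw [MonoidHom.comp_apply, MonoidHom.comp_apply, ← hπ.2.2]
    exact congrArg π (hσr x).symm
  have hker' : (π.comp (QuotientGroup.mk' (relSubgroup r))).ker =
      lowerPCentral p (FreeProP p g) c ⊔ relSubgroup r := by
    rw [← MonoidHom.comap_ker, hker, ← map_lowerPCentral (QuotientGroup.mk' (relSubgroup r))
      continuous_quotient_mk' (QuotientGroup.mk'_surjective _) c, Subgroup.comap_map_eq,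
      QuotientGroup.ker_mk']
  rw [surCount, ← encard_eqSur_comp (ρ := levelInv c j.rep) hπ', hker']
  congr 2
  ext φ
  refine and_congr_right fun hφ => ⟨fun h => sup_le ?_ ?_, fun h i => ?_⟩
  · exact lowerPCentral_le_ker (lowerPCentral_quotClass c) hφ.1
  · exact relSubgroup_le r (K := φ.ker) ((isClosed_discrete ({1} : Set _)).preimage hφ.1) h
  · exact h (Subgroup.mem_sup_right (mem_relSubgroup r i))

/-- The expected number of equivariant surjections `F_g → H = Q_c(j)` that kill `g` random
relations: there are `genCount p g d * |X_H| ^ g` of them, and each kills the relations with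
probability `|X_H| ^ (-g)`, where `X_H` is the set of inverted elements of the Frattini subgroup of
`H`. -/
lemma tsum_relLaw_surCount (hp : Odd p) (g : ℕ) {c d : ℕ} (j : LevelIndex p c)
    (hd : Nat.card (QuotClass p (QuotClass p j.rep.rep.carrier c) 1) = p ^ d) :
    ∑' k : LevelIndex p c, relLaw p g (relEvent p g k.1) * surCount k j = genCount p g d := by
  have := isProbabilityMeasure_muX (p := p) (g := g) hp
  set H := QuotClass p j.rep.rep.carrier c with hH
  set τ := levelInv c j.rep with hτ
  have hHp : IsPGroup p H := isPGroup_schur j.rep.rep c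
  have hHc : lowerPCentral p H c = ⊥ := lowerPCentral_quotClass c
  have hτi : IsInvolutive p τ := isInvolutive_levelInv c j.rep
  have hfin := finite_eqSur_free hp hHp hτi g
  have hcard := encard_eqSur_free hp hHp hτi hd g
  let K : (FreeProP p g →* H) → Set (Fin g → Relator p g) := fun φ => {r | ∀ i, φ (r i).1 = 1}
  have hK : ∀ φ, K φ = {r | (fun i => φ (r i).1) ∈ ({1} : Set (Fin g → H))} := by
    intro φ
    ext r
    exact ⟨fun h => funext h, fun h i => congrFun h i⟩
  have hKm : ∀ φ ∈ eqSur (freeSigma p g) τ, MeasurableSet (K φ) := fun φ hφ => by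
    rw [hK]
    exact measurableSet_image hHc φ hφ.1 _
  let N : (Fin g → Relator p g) → ℝ≥0∞ := fun r =>
    ∑ φ ∈ hfin.toFinset, (K φ).indicator (1 : (Fin g → Relator p g) → ℝ≥0∞) r
  have hN : ∀ k : LevelIndex p c, ∀ r ∈ relEvent p g k.1, N r = surCount k j := by
    intro k r hr
    rw [← encard_killing hp hr]
    exact sum_indicator_eq_encard hfin K r
  have hdisj : Pairwise (Function.onFun Disjoint fun k : LevelIndex p c => relEvent p g k.1) :=
    fun k l hkl => disjoint_relEvent (pairwise_disjoint_level c hkl)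
  have hmeas : ∀ k : LevelIndex p c, MeasurableSet (relEvent p g k.1) := fun k =>
    measurableSet_relEvent (measurableSet_level_index k)
  have h1 : ∑' k : LevelIndex p c, relLaw p g (relEvent p g k.1) * surCount k j =
      ∫⁻ r, N r ∂(relLaw p g) := by
    have h2 : ∫⁻ r in relEvent p g Set.univ, N r ∂(relLaw p g) = ∫⁻ r, N r ∂(relLaw p g) := by
      rw [Measure.restrict_eq_self_of_ae_mem]
      exact (mem_ae_iff_prob_eq_one measurableSet_relEvent_univ).2 (relLaw_relEvent_univ hp)
    rw [← h2, ← iUnion_level c, relEvent_iUnion, lintegral_iUnion hmeas hdisj]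
    refine tsum_congr fun k => ?_
    rw [setLIntegral_congr_fun (hmeas k) (hN k), setLIntegral_const, mul_comm]
  rw [h1]
  change ∫⁻ r, ∑ φ ∈ hfin.toFinset, (K φ).indicator (1 : (Fin g → Relator p g) → ℝ≥0∞) r
    ∂(relLaw p g) = _
  rw [lintegral_finsetSum' _ (fun φ hφ => (measurable_one.indicator
      (hKm φ (hfin.mem_toFinset.1 hφ))).aemeasurable)]
  rw [Finset.sum_congr rfl (fun φ hφ =>
    lintegral_indicator_one (hKm φ (hfin.mem_toFinset.1 hφ)))]
  set X := (invFrattini p τ).ncard with hX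
  have hX0 : (X : ℝ≥0∞) ^ g ≠ 0 := pow_ne_zero _ (by exact_mod_cast (ncard_invFrattini_pos τ).ne')
  have hXt : (X : ℝ≥0∞) ^ g ≠ ⊤ := ENNReal.pow_ne_top (ENNReal.natCast_ne_top _)
  have hlaw : ∀ φ ∈ hfin.toFinset, relLaw p g (K φ) = ((X : ℝ≥0∞) ^ g)⁻¹ := by
    intro φ hφ
    have hφ' := hfin.mem_toFinset.1 hφ
    rw [hK, relLaw_image hp hHc φ hφ'.1 hφ'.2.1 hφ'.2.2]
    have : {s : Fin g → H | s ∈ ({1} : Set (Fin g → H)) ∧ ∀ i, s i ∈ invFrattini p τ} = {1} := by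
      ext s
      refine ⟨fun h => h.1, fun h => ⟨h, fun i => ?_⟩⟩
      rw [show s = 1 from h]
      exact one_mem_invFrattini τ
    rw [this, Set.ncard_singleton, Nat.cast_one, one_div]
  have hcard' : (hfin.toFinset.card : ℕ) = genCount p g d * X ^ g := by
    have := hfin.encard_eq_coe_toFinset_card
    rw [hcard] at this
    exact_mod_cast this.symm
  rw [Finset.sum_congr rfl hlaw, Finset.sum_const, hcard', nsmul_eq_mul]
  push_cast
  rw [mul_assoc, ENNReal.mul_inv_cancel hX0 hXt, mul_one]

/-- The moments of `μ_BBH` are all `1`. -/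
theorem tsum_muBBH_surCount (hp : Odd p) {c : ℕ} (j : LevelIndex p c) :
    ∑' k : LevelIndex p c, muBBH p k.1 * surCount k j = 1 := by
  obtain ⟨d, hd⟩ := IsPGroup.iff_card.1 ((isPGroup_schur j.rep.rep c).to_quotient
    (lowerPCentral p (QuotClass p j.rep.rep.carrier c) 1))
  simp only [muBBH, ← ENNReal.tsum_mul_right]
  rw [ENNReal.tsum_comm, ← tsum_muCL_genCount hp d]
  refine tsum_congr fun g => ?_
  rw [← tsum_relLaw_surCount hp g j hd, ← ENNReal.tsum_mul_left]
  exact tsum_congr fun k => mul_assoc _ _ _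

lemma muBBH_univ (hp : Odd p) : muBBH p Set.univ = 1 := by
  rw [← tsum_muCL_genCount hp 0]
  refine tsum_congr fun g => ?_
  have : relLaw p g (relEvent p g Set.univ) = 1 := relLaw_relEvent_univ hp
  rw [this]
  simp [genCount]

variable (p) in
/-- `μ_BBH` as a measure. -/
def bbhMeasure : Measure (SchurClass p) :=
  Measure.ofMeasurable (fun A _ => muBBH p A) (by simp [muBBH, relEvent_empty])
    (fun A hA hd => by
      simp only [muBBH, relEvent_iUnion]
      rw [ENNReal.tsum_comm]
      refine tsum_congr fun g => ?_
      rw [ENNReal.tsum_mul_left, measure_iUnion (fun i j hij => disjoint_relEvent (hd hij))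
        fun i => measurableSet_relEvent (hA i)])

lemma bbhMeasure_apply {A : Set (SchurClass p)} (hA : MeasurableSet A) :
    bbhMeasure p A = muBBH p A := Measure.ofMeasurable_apply A hA

/-- `ν` and `μ_BBH` agree on the level sets, since their masses solve the same moment problem. -/
lemma measure_level_eq_muBBH {ν : Measure (SchurClass p)} (hp : Odd p)
    (hν : ∀ (H : Type) [Group H] [TopologicalSpace H] [DiscreteTopology H],
      IsSchurAncestor p H → moment ν H = 1) {c : ℕ} (hc : 1 ≤ c) (j : LevelIndex p c) :
    ν j.1 = muBBH p j.1 := by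
  refine congrFun (eq_of_moments (ν := fun k : LevelIndex p c => ν k.1)
    (μ := fun k : LevelIndex p c => muBBH p k.1) (S := surCount) (T := clTotal p)
    (clTotal_lt_two hp) (fun j => ?_) (tsum_muBBH_surCount hp) surCount_self_ne_zero
    (fun j => surCount_ne_top j j) fun j => ?_) j
  · rw [← moment_level hp]
    exact hν _ ⟨j.rep.rep, c, ⟨MulEquiv.refl _⟩⟩
  · have h := inv_clTotal_le hp j.rep.rep.isSchur (isPGroup_schur j.rep.rep c)
      (isInvolutive_levelInv c j.rep) hc (MulEquiv.refl _)
    have h1 : muBBH p j.1 = muBBH p (quotClassSet p c (QuotClass p j.rep.rep.carrier c)) := by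
      rw [← j.levelSet_rep]
      rfl
    have hT : clTotal p ≠ ⊤ := ((clTotal_lt_two hp).trans_le le_top).ne
    calc (1 : ℝ≥0∞) = clTotal p * (clTotal p)⁻¹ := (ENNReal.mul_inv_cancel clTotal_ne_zero hT).symm
      _ ≤ _ := mul_le_mul_right (h.trans_eq (by rw [h1]; rfl)) _

/-- `Q_c(Q_{c'}(G)) ≅ Q_c(G)` for `c ≤ c'`. -/
lemma nonempty_quotClass_of_le {G G' : SchurSigmaGrp p} {c c' : ℕ} (h : c ≤ c')
    (e : QuotClass p G.carrier c' ≃* QuotClass p G'.carrier c') :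
    Nonempty (QuotClass p G.carrier c ≃* QuotClass p G'.carrier c) := by
  have key : ∀ K : SchurSigmaGrp p, Nonempty (QuotClass p (QuotClass p K.carrier c') c ≃*
      QuotClass p K.carrier c) := fun K =>
    nonempty_quotClass_equiv (QuotientGroup.mk' (lowerPCentral p K.carrier c'))
      continuous_quotient_mk' (QuotientGroup.mk'_surjective _)
      (QuotientGroup.mk' (lowerPCentral p K.carrier c)) (QuotientGroup.mk'_surjective _) (by
        rw [QuotientGroup.ker_mk', QuotientGroup.ker_mk',
          sup_eq_right.2 (lowerPCentral_antitone p K.carrier h)])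
  obtain ⟨f⟩ := key G
  obtain ⟨f'⟩ := key G'
  exact ⟨f.symm.trans ((quotClassCongr p (discreteEquiv e) c).trans f')⟩

lemma quotClassSet_inter_eq {c c' : ℕ} (h : c ≤ c') {P P' : Type} [Group P] [Group P']
    (hne : (quotClassSet p c P ∩ quotClassSet p c' P').Nonempty) :
    quotClassSet p c P ∩ quotClassSet p c' P' = quotClassSet p c' P' := by
  obtain ⟨C, hC, hC'⟩ := hne
  refine Set.inter_eq_right.2 fun D hD => ?_
  obtain ⟨e⟩ := mem_quotClassSet.1 hC
  obtain ⟨e'⟩ := mem_quotClassSet.1 hC'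
  obtain ⟨f⟩ := mem_quotClassSet.1 hD
  obtain ⟨t⟩ := nonempty_quotClass_of_le h (f.trans e'.symm)
  exact mem_quotClassSet.2 ⟨t.trans e⟩

/-- `Q_{c'}(G)` determines `Q_c(G)` for `c ≤ c'`, so any two of the generating sets are nested or
disjoint. -/
lemma isPiSystem_quotClassSet : IsPiSystem
    {A : Set (SchurClass p) | ∃ (c : ℕ) (P : Type) (_ : Group P), Finite P ∧ IsPGroup p P ∧
      A = quotClassSet p c P} := by
  rintro _ ⟨c, P, hP, hP1, hP2, rfl⟩ _ ⟨c', P', hP', hP1', hP2', rfl⟩ hne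
  rcases le_total c c' with h | h
  · exact ⟨c', P', hP', hP1', hP2', quotClassSet_inter_eq h hne⟩
  · rw [Set.inter_comm] at hne ⊢
    exact ⟨c, P, hP, hP1, hP2, quotClassSet_inter_eq h hne⟩

/-- The moment of the trivial group is the total mass. -/
lemma measure_univ_of_moment {ν : Measure (SchurClass p)} (hp : Odd p)
    (hν : ∀ (H : Type) [Group H] [TopologicalSpace H] [DiscreteTopology H],
      IsSchurAncestor p H → moment ν H = 1) : ν Set.univ = 1 := by
  obtain ⟨r, hr⟩ : (relEvent p 0 Set.univ).Nonempty := by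
    rw [Set.nonempty_iff_ne_empty]
    intro h
    have := relLaw_relEvent_univ (p := p) (g := 0) hp
    rw [h, measure_empty] at this
    exact zero_ne_one this
  obtain ⟨hr, -⟩ := hr
  let G : SchurSigmaGrp p := ⟨FreeProP p 0 ⧸ relSubgroup r, hr⟩
  have hsub : Subsingleton (QuotClass p G.carrier 0) := QuotientGroup.subsingleton_quotient_top
  have h1 := hν (QuotClass p G.carrier 0) ⟨G, 0, ⟨MulEquiv.refl _⟩⟩
  rw [moment] at h1
  have h2 : ∀ C : SchurClass p,
      ((SurSigma C.rep.carrier (QuotClass p G.carrier 0)).encard : ℝ≥0∞) = 1 := by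
    intro C
    have : SurSigma C.rep.carrier (QuotClass p G.carrier 0) = {1} := by
      ext φ
      constructor
      · exact fun _ => ContinuousMonoidHom.ext fun x => Subsingleton.elim _ _
      · exact fun _ => ⟨fun y => ⟨1, Subsingleton.elim _ _⟩, fun x => Subsingleton.elim _ _⟩
    rw [this, Set.encard_singleton, ENat.toENNReal_one]
  simpa only [h2, lintegral_one] using h1

/-- A measure on the set of isomorphism classes of Schur `σ`-groups all of whose moments are `1` is
`μ_BBH`. -/
theorem measure_eq_muBBH {ν : Measure (SchurClass p)} (hp : Odd p)
    (hν : ∀ (H : Type) [Group H] [TopologicalSpace H] [DiscreteTopology H],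
      IsSchurAncestor p H → moment ν H = 1) {A : Set (SchurClass p)} (hA : MeasurableSet A) :
    ν A = muBBH p A := by
  have h1 := measure_univ_of_moment hp hν
  have hfin : IsFiniteMeasure ν := ⟨by rw [h1]; exact ENNReal.one_lt_top⟩
  have h2 : bbhMeasure p Set.univ = 1 := (bbhMeasure_apply MeasurableSet.univ).trans (muBBH_univ hp)
  rw [← bbhMeasure_apply hA]
  congr 1
  refine ext_of_generate_finite _ rfl isPiSystem_quotClassSet ?_ (h1.trans h2.symm)
  rintro _ ⟨c, P, _, hP1, hP2, rfl⟩
  have hm : MeasurableSet (quotClassSet p c P) :=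
    MeasurableSpace.measurableSet_generateFrom ⟨c, P, inferInstance, hP1, hP2, rfl⟩
  rcases (quotClassSet p c P).eq_empty_or_nonempty with h | ⟨C, hC⟩
  · rw [h, measure_empty, measure_empty]
  · rcases Nat.eq_zero_or_pos c with rfl | hc
    · have : quotClassSet p 0 P = Set.univ := by
        refine Set.eq_univ_of_forall fun D => ?_
        obtain ⟨e⟩ := mem_quotClassSet.1 hC
        have hs : ∀ E : SchurClass p, Subsingleton (QuotClass p E.rep.carrier 0) := fun _ =>
          QuotientGroup.subsingleton_quotient_top
        have := hs C
        have := hs D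
        let t : QuotClass p D.rep.carrier 0 ≃* QuotClass p C.rep.carrier 0 :=
          { toFun := fun _ => 1
            invFun := fun _ => 1
            left_inv := fun _ => Subsingleton.elim _ _
            right_inv := fun _ => Subsingleton.elim _ _
            map_mul' := fun _ _ => Subsingleton.elim _ _ }
        exact mem_quotClassSet.2 ⟨t.trans e⟩
      rw [this, h1, h2]
    · rw [bbhMeasure_apply hm]
      have h3 : ν (levelSet c C) = muBBH p (levelSet c C) :=
        measure_level_eq_muBBH hp hν hc ⟨_, C, rfl⟩
      rw [quotClassSet_eq_levelSet hC, h3]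

end Moments

end BBH

end

theorem theorem4p8 (p : ℕ) [Fact p.Prime] (hp : Odd p) :
    (∀ (A : Set (BBH.SchurClass p)), MeasurableSet A →
      ∀ g : ℕ, MeasurableSet (BBH.relEvent p g A)) ∧
    ∀ ν : MeasureTheory.Measure (BBH.SchurClass p),
      (∀ (H : Type) [Group H] [TopologicalSpace H] [DiscreteTopology H],
        BBH.IsSchurAncestor p H → BBH.moment ν H = 1) →
      ∀ A : Set (BBH.SchurClass p), MeasurableSet A → ν A = BBH.muBBH p A := by
  exact ⟨fun _ hA _ => BBH.measurableSet_relEvent hA,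
    fun _ hν _ hA => BBH.measure_eq_muBBH hp hν hA⟩
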